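/- Let $\mathbf H=\mathbf R^4$ be the quaternions, and let $h:S^7\to S^4$, $h(u,v)=(2u\bar v,|u|^2-|v|^2)$, be the Hopf fibration of the unit sphere $S^7\subset\mathbf R^8=\mathbf H\times\mathbf H$ over the unit sphere $S^4\subset\mathbf R^5=\mathbf H\times\mathbf R$. A compact connected embedded smooth submanifold $V\subset S^n$ is called taut if, for every $p\in S^n$ for which the spherical distance function $d_p(x)=\arccos(p\cdot x)$ is nondegenerate on $V$ (all its critical points on $V$ are nondegenerate), the number of its critical points on $V$ equals $\beta(V;\mathbf Z_2)$, the sum of the $\mathbf Z_2$-Betti numbers of $V$ (the minimum allowed by the Morse inequalities); the points $\pm p$, if they lie on $V$, are counted as nondegenerate critical points of $d_p$. Let $M\subset S^4$ be a compact connected embedded smooth submanifold of dimension $d$. Then: (1) If $M$ is taut in $S^4$, then $h^{-1}(M)$ is a compact connected embedded smooth submanifold of $S^7$ of dimension $d+3$ and is taut in $S^7$. (2) For $q=(\bar a,\bar b)\in S^7$ let $f_{ab}(x)=q\cdot x$ be the linear height function on $h^{-1}(M)$ in the direction $q$, and $\ell_{ab}(x)=h(q)\cdot x$ the linear height function on $M$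 in the direction $h(q)$. If $-h(q)\notin M$, then $f_{ab}$ has exactly twice as many critical points on $h^{-1}(M)$ as $\ell_{ab}$ has on $M$. If $M\neq S^4$, the set of $q\in S^7$ with $-h(q)\in M$ has measure zero. (3) $\beta(M\times S^3;\mathbf Z_2)=2\,\beta(M;\mathbf Z_2)$. -/

import Mathlib

open Set Metric MeasureTheory
open scoped Quaternion ContDiff

noncomputable section

namespace HopfTaut

/-! ## Submanifolds of a Euclidean space and critical points of functions on them -/

section Submanifolds

variable {E : Type} [NormedAddCommGroup E] [InnerProductSpace ℝ E]

/-- `c`, restricted to the open set `U ⊆ ℝᵈ`, is a smooth local parametrization of the set `M`: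
a `C^∞` immersion that is a homeomorphism of `U` onto an open subset of `M`. -/
structure IsLocalParam (d : ℕ) (M : Set E) (U : Set (EuclideanSpace ℝ (Fin d)))
    (c : EuclideanSpace ℝ (Fin d) → E) : Prop where
  isOpen : IsOpen U
  contDiffOn : ContDiffOn ℝ ∞ c U
  immersion : ∀ u ∈ U, Function.Injective (fderiv ℝ c u)
  isOpenEmbedding : ∃ h : MapsTo c U M, Topology.IsOpenEmbedding (h.restrict c U M)

/-- `M` is an embedded smooth submanifold of dimension `d`: every point of `M` lies in the image
of a smooth local parametrization.  When `M` is contained in the unit sphere, this says that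
`M` is an embedded smooth `d`-dimensional submanifold of that sphere. -/
def IsSubmanifold (d : ℕ) (M : Set E) : Prop :=
  ∀ x ∈ M, ∃ U c, IsLocalParam d M U c ∧ x ∈ c '' U

/-- `x` is a critical point of the restriction of `g` to the `d`-dimensional submanifold `M`: in
local coordinates on `M` around `x` the function is differentiable with derivative zero.  (For
smooth `g` this does not depend on the parametrization.) -/
def IsCriticalPt (d : ℕ) (M : Set E) (g : E → ℝ) (x : E) : Prop :=
  ∃ U c, IsLocalParam d M U c ∧ ∃ u ∈ U, c u = x ∧
    HasFDerivAt (g ∘ c) (0 : EuclideanSpace ℝ (Fin d) →L[ℝ] ℝ) u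

/-- `x` is a nondegenerate critical point of the restriction of `g` to the `d`-dimensional
submanifold `M`: in local coordinates on `M` around `x`, the derivative vanishes and the Hessian
is a nondegenerate bilinear form. -/
def IsNondegCriticalPt (d : ℕ) (M : Set E) (g : E → ℝ) (x : E) : Prop :=
  ∃ U c, IsLocalParam d M U c ∧ ∃ u ∈ U, c u = x ∧
    HasFDerivAt (g ∘ c) (0 : EuclideanSpace ℝ (Fin d) →L[ℝ] ℝ) u ∧
    ∀ v, (∀ w, fderiv ℝ (fderiv ℝ (g ∘ c)) u v w = 0) → v = 0

end Submanifolds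

/-! ## Betti numbers -/

/-- The `k`-th singular homology of `X` with coefficients in `ℤ/2`. -/
abbrev H (k : ℕ) (X : Type) [TopologicalSpace X] : ModuleCat.{0} (ZMod 2) :=
  ((AlgebraicTopology.singularHomologyFunctor (ModuleCat.{0} (ZMod 2)) k).obj
    (ModuleCat.of (ZMod 2) (ZMod 2))).obj (TopCat.of X)

/-- The `k`-th `ℤ/2`-Betti number (possibly infinite). -/
def betti (k : ℕ) (X : Type) [TopologicalSpace X] : ℕ∞ :=
  Cardinal.toENat (Module.rank (ZMod 2) (H k X))

/-- The sum over all `k` of the `ℤ/2`-Betti numbers (possibly infinite), as the supremum of the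
partial sums. -/
def bettiSum (X : Type) [TopologicalSpace X] : ℕ∞ :=
  ⨆ n : ℕ, ∑ k ∈ Finset.range n, betti k X

/-! ## Taut submanifolds of spheres -/

section Taut

variable {E : Type} [NormedAddCommGroup E] [InnerProductSpace ℝ E]

/-- The spherical (great circle) distance from `p`, for points of the unit sphere. -/
def sphDist (p x : E) : ℝ := Real.arccos (inner ℝ p x)

/-- The critical points of the spherical distance function `d_p` on the submanifold `M` of the
unit sphere.  At `p` and `-p`, where it takes its absolute minimum `0` and maximum `π`, the
function `d_p` is not differentiable; there `d_p ^ 2` and `(π - d_p) ^ 2` (and `cos d_p`) are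
smooth with a nondegenerate critical point on any submanifold through it, and so these points,
if they lie on `M`, are counted as (nondegenerate) critical points of `d_p`. -/
def sphDistCriticalSet (d : ℕ) (M : Set E) (p : E) : Set E :=
  {x ∈ M | x = p ∨ x = -p ∨ IsCriticalPt d M (sphDist p) x}

/-- The spherical distance function `d_p` is nondegenerate (a Morse function) on `M`: all of its
critical points are nondegenerate (the points `p` and `-p` always are, see above). -/
def IsNondegSphDist (d : ℕ) (M : Set E) (p : E) : Prop :=
  ∀ x ∈ M, x ≠ p → x ≠ -p → IsCriticalPt d M (sphDist p) x →
    IsNondegCriticalPt d M (sphDist p) x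

/-- The compact connected `d`-dimensional submanifold `M` of the unit sphere of `E` is taut:
every nondegenerate spherical distance function `d_p` has on `M` the minimum number of critical
points required by the Morse inequalities, the sum of the `ℤ/2`-Betti numbers of `M`. -/
structure IsTaut (d : ℕ) (M : Set E) : Prop where
  subset_sphere : M ⊆ sphere 0 1
  isCompact : IsCompact M
  isConnected : IsConnected M
  isSubmanifold : IsSubmanifold d M
  perfect : ∀ p ∈ sphere (0 : E) 1, IsNondegSphDist d M p →
    (sphDistCriticalSet d M p).encard = bettiSum M

/-- The linear height function in the direction `q`. -/
def height (q x : E) : ℝ := inner ℝ q x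

/-- The critical points on `M` of the linear height function in the direction `q`. -/
def heightCriticalSet (d : ℕ) (M : Set E) (q : E) : Set E :=
  {x ∈ M | IsCriticalPt d M (height q) x}

end Taut

/-! ## The quaternionic Hopf fibration -/

/-- The Euclidean space `ℝ⁸ = ℍ × ℍ`. -/
abbrev R8 : Type := WithLp 2 (ℍ[ℝ] × ℍ[ℝ])

/-- The Euclidean space `ℝ⁵ = ℍ × ℝ`. -/
abbrev R5 : Type := WithLp 2 (ℍ[ℝ] × ℝ)

/-- The map `h (u, v) = (2 u v̄, |u|² - |v|²)`. -/
def hopf (x : R8) : R5 :=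
  WithLp.toLp 2 ((2 : ℝ) • (x.fst * star x.snd), ‖x.fst‖ ^ 2 - ‖x.snd‖ ^ 2)

/-- The map `h` takes the unit sphere `S⁷` to the unit sphere `S⁴`. -/
theorem hopf_mem_sphere {x : R8} (hx : x ∈ sphere (0 : R8) 1) : hopf x ∈ sphere (0 : R5) 1 := by
  rw [mem_sphere_zero_iff_norm] at hx ⊢
  have h1 : ‖x.fst‖ ^ 2 + ‖x.snd‖ ^ 2 = 1 := by
    rw [← WithLp.prod_norm_sq_eq_of_L2, hx]; norm_num
  have h2 : ‖hopf x‖ ^ 2 = 1 := by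
    rw [WithLp.prod_norm_sq_eq_of_L2]
    change ‖(2 : ℝ) • (x.fst * star x.snd)‖ ^ 2 + ‖‖x.fst‖ ^ 2 - ‖x.snd‖ ^ 2‖ ^ 2 = 1
    rw [norm_smul, norm_mul, norm_star, Real.norm_eq_abs, Real.norm_eq_abs, sq_abs, mul_pow,
      sq_abs]
    linear_combination (‖x.fst‖ ^ 2 + ‖x.snd‖ ^ 2 + 1) * h1
  exact (sq_eq_sq₀ (norm_nonneg _) zero_le_one).1 (by rw [h2]; norm_num)

/-- The inverse image `h⁻¹(M) ⊆ S⁷` of a set `M ⊆ S⁴` under `h : S⁷ → S⁴`. -/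
def hopfPreimage (M : Set R5) : Set R8 := {x | x ∈ sphere (0 : R8) 1 ∧ hopf x ∈ M}

instance : MeasurableSpace R8 := borel R8

instance : BorelSpace R8 := ⟨rfl⟩

/-- The standard (surface area) measure on the unit sphere `S⁷`. -/
def sphereMeasure : Measure (sphere (0 : R8) 1) := (volume : Measure R8).toSphere

end HopfTaut

end

/-!
A unit vector `y` of `ℝ⁵ = ℍ × ℝ` acts on `ℍ²` as a symmetric involution (Clifford multiplication),
and `h⁻¹(y)` is the unit sphere of its eigenspace for the eigenvalue `1`, on which the unit
quaternions act simply transitively by right multiplication. For `p ∈ S⁷` the normalized projection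
of `p` onto these eigenspaces, `y ↦ (p + y p) / ‖p + y p‖`, is a section of `h` over
`S⁴ ∖ {-h(p)}`.

If `-h(p) ∉ M`, this section trivializes `h⁻¹(M) ≅ M × S³`. In the coordinates `(y, g)` the height
in the direction `p` is `cos(θ/2) · Re g`, where `cos θ = h(p) · y`. Hence its critical points are
`g = ±1` over the critical points of the height in the direction `h(p)` on `M`, and nondegeneracy is
the same on both sides. If `-h(p) ∈ M`, there are further critical points in the fibre over `-h(p)`;
they form the unit sphere of a linear space of dimension `4 - d`. For `M ≠ S⁴`, nondegeneracy thus
forces `d = 3`, and there are two of these points over the single critical point `-h(p)` of `M`.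

The Betti sum doubles because the first projection `X × S³ → X` has a section: the homology of
`X × Sᵐ` is that of `X` plus the kernel of the projection, and by Mayer–Vietoris for the two
hemispheres these kernels are shifted in degree when `m` grows, down to `X × S⁰`. The exceptional
directions are null because `h⁻¹(-M)` has positive codimension in `S⁷`.
-/

noncomputable section

namespace HopfTaut

/-! ## Singular chains modulo two -/

/-- The singular `n`-simplices of `X`. -/
abbrev SingularSimplex (n : ℕ) (X : Type*) [TopologicalSpace X] : Type _ :=
  C(stdSimplex ℝ (Fin (n + 1)), X)

/-- The singular `n`-chains of `X` modulo two. With these coefficients the boundary needs no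
signs; `rank_H` identifies the resulting homology with `H n X`. -/
abbrev SingularChain (n : ℕ) (X : Type*) [TopologicalSpace X] : Type _ :=
  SingularSimplex n X →₀ ZMod 2

/-- The inclusion of the face of the standard simplex opposite to the vertex `i`. -/
def faceMap (n : ℕ) (i : Fin (n + 2)) :
    C(stdSimplex ℝ (Fin (n + 1)), stdSimplex ℝ (Fin (n + 2))) :=
  ⟨stdSimplex.map i.succAbove, stdSimplex.continuous_map _⟩

lemma sum_sum_succAbove_eq_zero {A : Type*} [AddCommGroup A] [Module (ZMod 2) A] {n : ℕ}
    (F : (Fin (n + 1) → Fin (n + 3)) → A) :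
    ∑ i : Fin (n + 3), ∑ j : Fin (n + 2), F (fun k ↦ i.succAbove (j.succAbove k)) = 0 := by
  -- Deleting vertex `i` and then `j` is the same as deleting the same two in the other order.
  rw [← Finset.sum_product']
  refine Finset.sum_involution (fun p _ ↦ (p.1.succAbove p.2, p.2.predAbove p.1)) ?_ ?_ ?_ ?_
  · intro p _
    simp only [Fin.succAbove_succAbove_succAbove_predAbove]
    exact ZModModule.add_self _
  · rintro ⟨i, j⟩ _ _ h
    exact Fin.succAbove_ne i j (congrArg Prod.fst h)
  · simp
  · rintro ⟨i, j⟩ _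
    simp [Fin.succAbove_succAbove_predAbove, Fin.predAbove_predAbove_succAbove]

namespace SingularChain

section Basic

variable {X Y W : Type*} [TopologicalSpace X] [TopologicalSpace Y] [TopologicalSpace W]

/-- The boundary of singular chains modulo two. -/
def boundary (n : ℕ) : SingularChain (n + 1) X →ₗ[ZMod 2] SingularChain n X :=
  ∑ i : Fin (n + 2), Finsupp.lmapDomain _ _ fun σ : SingularSimplex (n + 1) X ↦
    σ.comp (faceMap n i)

/-- The map of singular chains induced by a continuous map. -/
def map (n : ℕ) (f : C(X, Y)) : SingularChain n X →ₗ[ZMod 2] SingularChain n Y :=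
  Finsupp.lmapDomain _ _ fun σ ↦ f.comp σ

@[simp]
lemma boundary_single (n : ℕ) (σ : SingularSimplex (n + 1) X) (r : ZMod 2) :
    boundary n (Finsupp.single σ r) =
      ∑ i : Fin (n + 2), Finsupp.single (σ.comp (faceMap n i)) r := by
  simp [boundary, LinearMap.sum_apply, Finsupp.mapDomain_single]

@[simp]
lemma map_single (n : ℕ) (f : C(X, Y)) (σ : SingularSimplex n X) (r : ZMod 2) :
    map n f (Finsupp.single σ r) = Finsupp.single (f.comp σ) r := by
  simp [map, Finsupp.mapDomain_single]

lemma map_map (n : ℕ) (g : C(Y, W)) (f : C(X, Y)) (c : SingularChain n X) :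
    map n g (map n f c) = map n (g.comp f) c := by
  have : map n g ∘ₗ map n f = map n (g.comp f) := by
    ext σ : 1
    ext1
    simp [ContinuousMap.comp_assoc]
  exact LinearMap.congr_fun this c

lemma map_id (n : ℕ) (c : SingularChain n X) : map n (ContinuousMap.id X) c = c := by
  have : map n (ContinuousMap.id X) = LinearMap.id := by
    ext σ : 1
    ext1
    simp
  exact LinearMap.congr_fun this c

lemma boundary_map (n : ℕ) (f : C(X, Y)) (c : SingularChain (n + 1) X) :
    boundary n (map (n + 1) f c) = map n f (boundary n c) := by
  have : boundary n ∘ₗ map (n + 1) f = map n f ∘ₗ boundary n := by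
    ext σ : 1
    ext1
    simp [ContinuousMap.comp_assoc]
  exact LinearMap.congr_fun this c

lemma boundary_boundary (n : ℕ) (c : SingularChain (n + 2) X) :
    boundary n (boundary (n + 1) c) = 0 := by
  have : boundary n ∘ₗ boundary (n + 1) = (0 : SingularChain (n + 2) X →ₗ[ZMod 2] _) := by
    ext σ : 1
    ext1
    simp only [LinearMap.comp_apply, Finsupp.lsingle_apply, boundary_single, map_sum]
    refine Eq.trans ?_ (sum_sum_succAbove_eq_zero fun θ ↦ Finsupp.single
      (σ.comp (⟨stdSimplex.map θ, stdSimplex.continuous_map _⟩ :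
        C(stdSimplex ℝ (Fin (n + 1)), stdSimplex ℝ (Fin (n + 3))))) (1 : ZMod 2))
    refine Finset.sum_congr rfl fun i _ ↦ Finset.sum_congr rfl fun j _ ↦ ?_
    congr 1
    ext x
    simp only [ContinuousMap.comp_apply, faceMap, ContinuousMap.coe_mk, stdSimplex.map_comp_apply]
    rfl
  exact LinearMap.congr_fun this c

/-- The singular cycles; every `0`-chain is a cycle. -/
def cycles (X : Type*) [TopologicalSpace X] : (n : ℕ) → Submodule (ZMod 2) (SingularChain n X)
  | 0 => ⊤
  | n + 1 => LinearMap.ker (boundary n)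

/-- The singular boundaries. -/
def boundaries (X : Type*) [TopologicalSpace X] (n : ℕ) :
    Submodule (ZMod 2) (SingularChain n X) :=
  LinearMap.range (boundary n)

lemma boundary_mem_cycles (n : ℕ) (c : SingularChain (n + 1) X) : boundary n c ∈ cycles X n := by
  cases n with
  | zero => trivial
  | succ n => exact boundary_boundary n c

lemma map_mem_cycles {n : ℕ} (f : C(X, Y)) {c : SingularChain n X} (hc : c ∈ cycles X n) :
    map n f c ∈ cycles Y n := by
  cases n with
  | zero => trivial
  | succ n =>
    change boundary n _ = 0
    rw [boundary_map, show boundary n c = 0 from hc, map_zero]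

lemma map_mem_boundaries {n : ℕ} (f : C(X, Y)) {c : SingularChain n X}
    (hc : c ∈ boundaries X n) : map n f c ∈ boundaries Y n := by
  obtain ⟨e, rfl⟩ := hc
  exact ⟨map _ f e, boundary_map n f e⟩

end Basic

section Comparison

open CategoryTheory Limits AlgebraicTopology
open scoped Simplicial

variable {X Y : Type} [TopologicalSpace X] [TopologicalSpace Y]

/-- The coefficients `ℤ/2` of the homology functor `H`. -/
abbrev coeff : ModuleCat.{0} (ZMod 2) := ModuleCat.of (ZMod 2) (ZMod 2)

/-- The simplicial chain complex whose homology is `H`. -/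
abbrev chainComplex (X : Type) [TopologicalSpace X] : ChainComplex (ModuleCat.{0} (ZMod 2)) ℕ :=
  (TopCat.toSSet.obj (TopCat.of X)).chainComplex coeff

/-- Singular simplices as simplices of the singular simplicial set. -/
def toSSetEquiv (n : ℕ) : SingularSimplex n X ≃ (TopCat.toSSet.obj (TopCat.of X)) _⦋n⦌ :=
  (TopCat.toSSetObjEquiv (TopCat.of X) (Opposite.op ⦋n⦌)).symm

lemma δ_toSSetEquiv (n : ℕ) (i : Fin (n + 2)) (σ : SingularSimplex (n + 1) X) :
    (TopCat.toSSet.obj (TopCat.of X)).δ i (toSSetEquiv (n + 1) σ) =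
      toSSetEquiv n (σ.comp (faceMap n i)) := rfl

/-- The comparison map from finitely supported functions on simplices to `chainComplex X`, whose
terms are abstract coproducts. -/
def toChainComplex (n : ℕ) : SingularChain n X →ₗ[ZMod 2] (chainComplex X).X n :=
  Finsupp.lsum ℕ fun σ ↦ ((TopCat.toSSet.obj (TopCat.of X)).ιChainComplex (R := coeff)
    (toSSetEquiv n σ)).hom

lemma toChainComplex_single (n : ℕ) (σ : SingularSimplex n X) (r : ZMod 2) :
    toChainComplex n (Finsupp.single σ r) =
      ((TopCat.toSSet.obj (TopCat.of X)).ιChainComplex (R := coeff) (toSSetEquiv n σ)).hom r := by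
  simp [toChainComplex]

/-- The inverse of `toChainComplex`, given by the universal property of the coproduct. -/
def ofChainComplex (n : ℕ) : (chainComplex X).X n ⟶ ModuleCat.of (ZMod 2) (SingularChain n X) :=
  Cofan.IsColimit.desc
    ((TopCat.toSSet.obj (TopCat.of X)).isColimitChainComplexXCofan coeff n)
    fun x ↦ ModuleCat.ofHom (Finsupp.lsingle ((toSSetEquiv n).symm x))

lemma ι_ofChainComplex (n : ℕ) (x : (TopCat.toSSet.obj (TopCat.of X)) _⦋n⦌) :
    (TopCat.toSSet.obj (TopCat.of X)).ιChainComplex (R := coeff) x ≫ ofChainComplex n =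
      ModuleCat.ofHom (Finsupp.lsingle ((toSSetEquiv n).symm x)) :=
  Cofan.IsColimit.fac _ _ x

/-- The isomorphism between `SingularChain n X` and the `n`-th term of `chainComplex X`. -/
def chainComplexEquiv (n : ℕ) : SingularChain n X ≃ₗ[ZMod 2] (chainComplex X).X n :=
  LinearEquiv.ofLinearMap (toChainComplex n) (ofChainComplex n).hom
    (by
      have : ofChainComplex (X := X) n ≫ ModuleCat.ofHom (toChainComplex n) = 𝟙 _ := by
        refine SSet.chainComplex_hom_ext fun x ↦ ?_
        rw [← Category.assoc, ι_ofChainComplex]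
        ext
        simp [toChainComplex_single]
      exact congrArg ModuleCat.Hom.hom this)
    (by
      ext σ : 1
      ext1
      have := congrArg (fun f ↦ ModuleCat.Hom.hom f (1 : ZMod 2))
        (ι_ofChainComplex n (toSSetEquiv n σ))
      simpa [toChainComplex_single] using this)

lemma chainComplexEquiv_boundary (n : ℕ) (c : SingularChain (n + 1) X) :
    chainComplexEquiv n (boundary n c) =
      ((chainComplex X).d (n + 1) n).hom (chainComplexEquiv (n + 1) c) := by
  have h : toChainComplex n ∘ₗ boundary n =
      ((chainComplex X).d (n + 1) n).hom ∘ₗ toChainComplex (n + 1) := by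
    ext σ : 1
    ext1
    have hd := congrArg (fun f ↦ ModuleCat.Hom.hom f (1 : ZMod 2))
      (SSet.ιChainComplex_d (TopCat.toSSet.obj (TopCat.of X)) coeff (toSSetEquiv (n + 1) σ))
    have neg_one_pow_smul (j : ℕ) (m : (chainComplex X).X n) : ((-1 : ℤ) ^ j) • m = m := by
      rcases neg_one_pow_eq_or ℤ j with h | h
      · rw [h, one_smul]
      · rw [h, neg_one_smul, ZModModule.neg_eq_self]
    simp only [ModuleCat.hom_comp, LinearMap.comp_apply] at hd
    simp only [LinearMap.comp_apply, Finsupp.lsingle_apply, boundary_single, map_sum,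
      toChainComplex_single]
    rw [hd]
    simp only [ModuleCat.hom_sum, LinearMap.sum_apply, δ_toSSetEquiv]
    exact Finset.sum_congr rfl fun i _ ↦ (neg_one_pow_smul _ _).symm
  exact LinearMap.congr_fun h c

lemma chainComplexEquiv_map (n : ℕ) (f : C(X, Y)) (c : SingularChain n X) :
    chainComplexEquiv n (map n f c) =
      ((SSet.chainComplexMap (TopCat.toSSet.map (TopCat.ofHom f)) coeff).f n).hom
        (chainComplexEquiv n c) := by
  have h : toChainComplex n ∘ₗ map n f =
      ((SSet.chainComplexMap (TopCat.toSSet.map (TopCat.ofHom f)) coeff).f n).hom ∘ₗ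
        toChainComplex n := by
    ext σ : 1
    ext1
    simp only [LinearMap.comp_apply, Finsupp.lsingle_apply, map_single, toChainComplex_single]
    exact (congrArg (fun f ↦ ModuleCat.Hom.hom f (1 : ZMod 2))
      (SSet.ι_chainComplexMap_f _ _ (TopCat.toSSet.map (TopCat.ofHom f)) coeff
        (toSSetEquiv n σ))).symm
  exact LinearMap.congr_fun h c

lemma map_sub_map_mem_boundaries {f g : C(X, Y)} (h : f.Homotopic g) {n : ℕ}
    {c : SingularChain n X} (hc : c ∈ cycles X n) : map n f c - map n g c ∈ boundaries Y n := by
  obtain ⟨F⟩ := h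
  have G : Homotopy (SSet.chainComplexMap (TopCat.toSSet.map (TopCat.ofHom f)) coeff)
      (SSet.chainComplexMap (TopCat.toSSet.map (TopCat.ofHom g)) coeff) :=
    TopCat.Homotopy.singularChainComplexFunctorObjMap (f := TopCat.ofHom f)
      (g := TopCat.ofHom g) F coeff
  have homotopy_formula := congrArg (fun φ ↦ ModuleCat.Hom.hom φ (chainComplexEquiv n c)) (G.comm n)
  have dNext_eq_zero : ((dNext n) G.hom).hom (chainComplexEquiv n c) = 0 := by
    cases n with
    | zero => simp
    | succ n =>
      rw [dNext_eq G.hom (show (ComplexShape.down ℕ).Rel (n + 1) n from rfl),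
        ModuleCat.hom_comp, LinearMap.comp_apply, ← chainComplexEquiv_boundary,
        show boundary n c = 0 from hc, map_zero, map_zero]
  obtain ⟨e, he⟩ := (chainComplexEquiv (X := Y) (n + 1)).surjective
    ((G.hom n (n + 1)).hom (chainComplexEquiv n c))
  rw [prevD_eq G.hom (show (ComplexShape.down ℕ).Rel (n + 1) n from rfl)] at homotopy_formula
  simp only [ModuleCat.hom_add, LinearMap.add_apply, dNext_eq_zero, zero_add, ModuleCat.hom_comp,
    LinearMap.comp_apply] at homotopy_formula
  rw [← he, ← chainComplexEquiv_map, ← chainComplexEquiv_boundary, ← chainComplexEquiv_map,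
    ← map_add] at homotopy_formula
  exact ⟨e, eq_sub_of_add_eq ((chainComplexEquiv n).injective homotopy_formula).symm⟩

end Comparison

end SingularChain

/-! ## Ranks of subquotients -/

section Subquotient

universe u v

variable {R : Type u} [Ring R] {V V₁ V₂ : Type v} [AddCommGroup V] [Module R V]
  [AddCommGroup V₁] [Module R V₁] [AddCommGroup V₂] [Module R V₂]

/-- The rank of the subquotient `P / (P ∩ Q)`; homology groups are of this form with `Q ≤ P`. -/
def subquotientRank (P Q : Submodule R V) : Cardinal := Module.rank R (P ⧸ Q.submoduleOf P)

lemma mkQ_submoduleOf_eq_zero_iff {P Q : Submodule R V} (v : P) :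
    (Q.submoduleOf P).mkQ v = 0 ↔ (v : V) ∈ Q := by
  rw [Submodule.mkQ_apply, Submodule.Quotient.mk_eq_zero, Submodule.submoduleOf,
    Submodule.mem_comap, Submodule.subtype_apply]

lemma subquotientRank_eq_zero [Nontrivial R] {P Q : Submodule R V} (h : P ≤ Q) :
    subquotientRank P Q = 0 := by
  rw [subquotientRank, Submodule.submoduleOf, Submodule.comap_subtype_eq_top.2 h]
  exact rank_subsingleton' _ _

lemma subquotientRank_eq_of_linearMap {P₁ Q₁ : Submodule R V₁} {P₂ Q₂ : Submodule R V₂}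
    (L : V₁ →ₗ[R] V₂) (hP : ∀ z ∈ P₁, L z ∈ P₂) (hQ : ∀ z ∈ P₁, L z ∈ Q₂ ↔ z ∈ Q₁)
    (hsurj : ∀ w ∈ P₂, ∃ z ∈ P₁, L z - w ∈ Q₂) :
    subquotientRank P₁ Q₁ = subquotientRank P₂ Q₂ := by
  let f : P₁ →ₗ[R] P₂ ⧸ Q₂.submoduleOf P₂ := (Q₂.submoduleOf P₂).mkQ ∘ₗ L.restrict hP
  have ker_f : LinearMap.ker f = Q₁.submoduleOf P₁ := by
    ext z
    exact (mkQ_submoduleOf_eq_zero_iff (L.restrict hP z)).trans (hQ z z.2)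
  have f_surjective : Function.Surjective f := by
    intro w
    obtain ⟨w, rfl⟩ := Submodule.mkQ_surjective _ w
    obtain ⟨z, hz, hzw⟩ := hsurj w w.2
    exact ⟨⟨z, hz⟩, (Submodule.Quotient.eq _).2 hzw⟩
  rw [subquotientRank, ← ker_f]
  exact (f.quotKerEquivOfSurjective f_surjective).rank_eq

end Subquotient

universe u v in
lemma subquotientRank_eq_add_of_linearMap {R : Type u} [DivisionRing R] {V₁ V₂ : Type v}
    [AddCommGroup V₁] [Module R V₁] [AddCommGroup V₂] [Module R V₂]
    {P₁ Q₁ : Submodule R V₁} {P₂ Q₂ : Submodule R V₂}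
    (L : V₁ →ₗ[R] V₂) (hP : ∀ z ∈ P₁, L z ∈ P₂) (hQ : ∀ z ∈ Q₁, L z ∈ Q₂)
    (hsurj : ∀ w ∈ P₂, ∃ z ∈ P₁, L z = w) :
    subquotientRank P₁ Q₁ = subquotientRank P₂ Q₂ + subquotientRank (P₁ ⊓ Q₂.comap L) Q₁ := by
  let f₀ : P₁ →ₗ[R] P₂ ⧸ Q₂.submoduleOf P₂ := (Q₂.submoduleOf P₂).mkQ ∘ₗ L.restrict hP
  have f₀_eq_zero_iff (v : P₁) : f₀ v = 0 ↔ L v ∈ Q₂ := mkQ_submoduleOf_eq_zero_iff _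
  let f : (P₁ ⧸ Q₁.submoduleOf P₁) →ₗ[R] P₂ ⧸ Q₂.submoduleOf P₂ :=
    Submodule.liftQ _ f₀ fun v hv ↦ (f₀_eq_zero_iff v).2 (hQ _ hv)
  have f_mkQ (v : P₁) : f ((Q₁.submoduleOf P₁).mkQ v) = f₀ v := Submodule.liftQ_apply _ _ _
  have f_surjective : Function.Surjective f := by
    intro w
    obtain ⟨w, rfl⟩ := Submodule.mkQ_surjective _ w
    obtain ⟨z, hz, hzw⟩ := hsurj w w.2
    refine ⟨(Q₁.submoduleOf P₁).mkQ ⟨z, hz⟩, (f_mkQ _).trans ?_⟩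
    exact congrArg (Q₂.submoduleOf P₂).mkQ (Subtype.ext hzw : L.restrict hP ⟨z, hz⟩ = w)
  let g : ↥(P₁ ⊓ Q₂.comap L) →ₗ[R] LinearMap.ker f :=
    LinearMap.codRestrict _ ((Q₁.submoduleOf P₁).mkQ ∘ₗ Submodule.inclusion inf_le_left) fun v ↦ by
      rw [LinearMap.mem_ker, LinearMap.comp_apply, f_mkQ, f₀_eq_zero_iff]
      exact v.2.2
  have ker_g : LinearMap.ker g = Q₁.submoduleOf (P₁ ⊓ Q₂.comap L) := by
    ext v
    rw [LinearMap.mem_ker, Subtype.ext_iff]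
    exact mkQ_submoduleOf_eq_zero_iff (⟨v.1, v.2.1⟩ : P₁)
  have g_surjective : Function.Surjective g := by
    rintro ⟨w, hw⟩
    obtain ⟨w, rfl⟩ := Submodule.mkQ_surjective _ w
    rw [LinearMap.mem_ker, f_mkQ, f₀_eq_zero_iff] at hw
    exact ⟨⟨w, w.2, hw⟩, rfl⟩
  rw [subquotientRank, f.rank_eq_of_surjective f_surjective,
    ← (g.quotKerEquivOfSurjective g_surjective).rank_eq, ker_g]
  rfl

universe u v in
lemma rank_homology_eq_subquotientRank {R : Type u} [Ring R]
    (S : CategoryTheory.ShortComplex (ModuleCat.{v} R)) {V : Type v} [AddCommGroup V] [Module R V]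
    (e : V ≃ₗ[R] S.X₂) {P Q : Submodule R V} (hP : ∀ v, v ∈ P ↔ S.g.hom (e v) = 0)
    (hQ : ∀ v, v ∈ Q ↔ ∃ x, S.f.hom x = e v) :
    Module.rank R S.homology = subquotientRank P Q := by
  let E : P ≃ₗ[R] LinearMap.ker S.g.hom :=
    e.submoduleMap P ≪≫ₗ LinearEquiv.ofEq _ _ (by
      ext x
      obtain ⟨v, rfl⟩ := e.surjective x
      simp [hP])
  have coe_E (v : P) : (E v : S.X₂) = e v := rfl
  refine (S.moduleCatHomologyIso.toLinearEquiv ≪≫ₗ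
    (Submodule.Quotient.equiv _ _ E.symm ?_)).rank_eq
  ext v
  rw [Submodule.mem_map_equiv, LinearEquiv.symm_symm, Submodule.submoduleOf, Submodule.mem_comap,
    hQ, LinearMap.mem_range]
  refine exists_congr fun x ↦ ?_
  rw [Submodule.subtype_apply, ← coe_E, Subtype.ext_iff]
  rfl

open SingularChain in
lemma rank_H (n : ℕ) (X : Type) [TopologicalSpace X] :
    Module.rank (ZMod 2) (H n X) = subquotientRank (cycles X n) (boundaries X n) := by
  have mem_boundaries_iff (v : SingularChain n X) : v ∈ boundaries X n ↔
      ∃ x, ((chainComplex X).d (n + 1) n).hom x = chainComplexEquiv n v := by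
    constructor
    · rintro ⟨c, rfl⟩
      exact ⟨_, (chainComplexEquiv_boundary n c).symm⟩
    · rintro ⟨x, hx⟩
      obtain ⟨c, rfl⟩ := (chainComplexEquiv (X := X) (n + 1)).surjective x
      exact ⟨c, (chainComplexEquiv n).injective ((chainComplexEquiv_boundary n c).trans hx)⟩
  cases n with
  | zero =>
    rw [← rank_homology_eq_subquotientRank ((chainComplex X).sc' 1 0 0) (chainComplexEquiv 0)
      (fun v ↦ by
        rw [show ((chainComplex X).sc' 1 0 0).g = 0 from (chainComplex X).shape _ _ (by simp)]
        simp [cycles]) mem_boundaries_iff]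
    exact ((chainComplex X).homologyIsoSc' 1 0 0 (by simp) (by simp)).toLinearEquiv.rank_eq
  | succ n =>
    rw [← rank_homology_eq_subquotientRank ((chainComplex X).sc' (n + 2) (n + 1) n)
      (chainComplexEquiv (n + 1)) (fun v ↦ by
        change boundary n v = 0 ↔
          ((chainComplex X).d (n + 1) n).hom (chainComplexEquiv (n + 1) v) = 0
        rw [← chainComplexEquiv_boundary, LinearEquiv.map_eq_zero_iff]) mem_boundaries_iff]
    exact ((chainComplex X).homologyIsoSc' (n + 2) (n + 1) n
      (by simp) (by simp)).toLinearEquiv.rank_eq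

/-! ## Ordered chains and barycentric subdivision -/

/-- The `k`-chains modulo two on ordered tuples of points of `α`: the tuple `v` stands for a
`k`-simplex with vertices `v 0, …, v k`. -/
abbrev OrderedChain (k : ℕ) (α : Type*) : Type _ := (Fin (k + 1) → α) →₀ ZMod 2

namespace OrderedChain

section Algebra

variable {α β : Type*}

/-- The boundary of ordered chains modulo two. -/
def boundary (k : ℕ) : OrderedChain (k + 1) α →ₗ[ZMod 2] OrderedChain k α :=
  ∑ i : Fin (k + 2), Finsupp.lmapDomain _ _ fun v : Fin (k + 2) → α ↦ v ∘ i.succAbove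

/-- The cone with apex `b` over an ordered chain. -/
def cone (b : α) (k : ℕ) : OrderedChain k α →ₗ[ZMod 2] OrderedChain (k + 1) α :=
  Finsupp.lmapDomain _ _ fun v : Fin (k + 1) → α ↦ (Fin.cons b v : Fin (k + 2) → α)

/-- The map of ordered chains induced by a map of vertices. -/
def map (k : ℕ) (u : α → β) : OrderedChain k α →ₗ[ZMod 2] OrderedChain k β :=
  Finsupp.lmapDomain _ _ fun v ↦ u ∘ v

@[simp]
lemma boundary_single (k : ℕ) (v : Fin (k + 2) → α) (r : ZMod 2) :
    boundary k (Finsupp.single v r) =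
      ∑ i : Fin (k + 2), Finsupp.single (v ∘ i.succAbove) r := by
  simp [boundary, LinearMap.sum_apply, Finsupp.mapDomain_single]

@[simp]
lemma cone_single (b : α) (k : ℕ) (v : Fin (k + 1) → α) (r : ZMod 2) :
    cone b k (Finsupp.single v r) = Finsupp.single (Fin.cons b v : Fin (k + 2) → α) r := by
  simp [cone, Finsupp.mapDomain_single]

@[simp]
lemma map_single (k : ℕ) (u : α → β) (v : Fin (k + 1) → α) (r : ZMod 2) :
    map k u (Finsupp.single v r) = Finsupp.single (u ∘ v) r := by
  simp [map, Finsupp.mapDomain_single]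

lemma boundary_boundary (k : ℕ) (c : OrderedChain (k + 2) α) :
    boundary k (boundary (k + 1) c) = 0 := by
  have : boundary k ∘ₗ boundary (k + 1) = (0 : OrderedChain (k + 2) α →ₗ[ZMod 2] _) := by
    ext v : 1
    ext1
    simp only [LinearMap.comp_apply, Finsupp.lsingle_apply, boundary_single, map_sum]
    exact sum_sum_succAbove_eq_zero fun θ ↦ Finsupp.single (v ∘ θ) (1 : ZMod 2)
  exact LinearMap.congr_fun this c

lemma boundary_map (k : ℕ) (u : α → β) (c : OrderedChain (k + 1) α) :
    boundary k (map (k + 1) u c) = map k u (boundary k c) := by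
  have : boundary k ∘ₗ map (k + 1) u = map k u ∘ₗ boundary k := by
    ext v : 1
    ext1
    simp [Function.comp_assoc]
  exact LinearMap.congr_fun this c

lemma map_cone (k : ℕ) (u : α → β) (b : α) (c : OrderedChain k α) :
    map (k + 1) u (cone b k c) = cone (u b) k (map k u c) := by
  have : map (k + 1) u ∘ₗ cone b k = cone (u b) k ∘ₗ map k u := by
    ext v : 1
    ext1
    simp [Fin.comp_cons]
  exact LinearMap.congr_fun this c

lemma cons_comp_succAbove_zero {k : ℕ} (b : α) (v : Fin k → α) :
    (Fin.cons b v : Fin (k + 1) → α) ∘ (0 : Fin (k + 1)).succAbove = v := by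
  ext j
  simp

lemma cons_comp_succAbove_succ {k : ℕ} (b : α) (v : Fin (k + 1) → α) (i : Fin (k + 1)) :
    (Fin.cons b v : Fin (k + 2) → α) ∘ i.succ.succAbove = Fin.cons b (v ∘ i.succAbove) := by
  ext j
  refine Fin.cases ?_ (fun j ↦ ?_) j <;> simp

lemma boundary_cone (b : α) (k : ℕ) (c : OrderedChain (k + 1) α) :
    boundary (k + 1) (cone b (k + 1) c) = c + cone b k (boundary k c) := by
  have : boundary (k + 1) ∘ₗ cone b (k + 1) = LinearMap.id + cone b k ∘ₗ boundary k := by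
    ext v : 1
    ext1
    simp only [LinearMap.comp_apply, Finsupp.lsingle_apply, cone_single, boundary_single,
      LinearMap.add_apply, LinearMap.id_apply, map_sum]
    rw [Fin.sum_univ_succ, cons_comp_succAbove_zero]
    simp only [cons_comp_succAbove_succ]
  exact LinearMap.congr_fun this c

lemma boundary_cone_zero (b : α) (v : Fin 1 → α) :
    boundary 0 (cone b 0 (Finsupp.single v 1)) =
      Finsupp.single v 1 + Finsupp.single (fun _ ↦ b) 1 := by
  rw [cone_single, boundary_single, Fin.sum_univ_two, cons_comp_succAbove_zero]
  congr 2
  ext1 j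
  obtain rfl : j = (0 : Fin 1) := Subsingleton.elim (α := Fin 1) j 0
  rfl

lemma boundary_cone_boundary (b : α) (c : OrderedChain 1 α) :
    boundary 0 (cone b 0 (boundary 0 c)) = boundary 0 c := by
  have : boundary 0 ∘ₗ cone b 0 ∘ₗ boundary 0 = boundary 0 := by
    ext v : 1
    ext1
    simp only [LinearMap.comp_apply, Finsupp.lsingle_apply, boundary_single 0 v, map_sum,
      boundary_cone_zero, Finset.sum_add_distrib]
    rw [Fin.sum_univ_two (f := fun _ ↦ Finsupp.single (fun _ ↦ b) 1), ZModModule.add_self, add_zero]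
  exact LinearMap.congr_fun this c

end Algebra

section Subdivision

variable {α β : Type*}

/-- The subdivision of ordered chains that replaces a simplex `v` of positive dimension by the
cone with apex `apex _ v` over its subdivided boundary. -/
def subdiv (apex : ∀ k, (Fin (k + 1) → α) → α) :
    (k : ℕ) → OrderedChain k α →ₗ[ZMod 2] OrderedChain k α
  | 0 => LinearMap.id
  | k + 1 => Finsupp.linearCombination (ZMod 2) fun v ↦
      cone (apex _ v) k (subdiv apex k (boundary k (Finsupp.single v 1)))

/-- The chain homotopy between `subdiv apex` and the identity. -/
def subdivHomotopy (apex : ∀ k, (Fin (k + 1) → α) → α) :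
    (k : ℕ) → OrderedChain k α →ₗ[ZMod 2] OrderedChain (k + 1) α
  | 0 => 0
  | k + 1 => Finsupp.linearCombination (ZMod 2) fun v ↦ cone (apex _ v) (k + 1)
      (Finsupp.single v 1 + subdivHomotopy apex k (boundary k (Finsupp.single v 1)))

variable (apex : ∀ k, (Fin (k + 1) → α) → α)

lemma subdiv_single (k : ℕ) (v : Fin (k + 2) → α) :
    subdiv apex (k + 1) (Finsupp.single v 1) =
      cone (apex _ v) k (subdiv apex k (boundary k (Finsupp.single v 1))) := by
  simp [subdiv]

lemma subdivHomotopy_single (k : ℕ) (v : Fin (k + 2) → α) :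
    subdivHomotopy apex (k + 1) (Finsupp.single v 1) = cone (apex _ v) (k + 1)
      (Finsupp.single v 1 + subdivHomotopy apex k (boundary k (Finsupp.single v 1))) := by
  simp [subdivHomotopy]

lemma boundary_subdiv (k : ℕ) (c : OrderedChain (k + 1) α) :
    boundary k (subdiv apex (k + 1) c) = subdiv apex k (boundary k c) := by
  induction k with
  | zero =>
    suffices boundary 0 ∘ₗ subdiv apex 1 = subdiv apex 0 ∘ₗ boundary 0 from
      LinearMap.congr_fun this c
    ext v : 1
    ext1
    simp only [LinearMap.comp_apply, Finsupp.lsingle_apply, subdiv_single]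
    exact boundary_cone_boundary _ _
  | succ k ih =>
    suffices boundary (k + 1) ∘ₗ subdiv apex (k + 2) = subdiv apex (k + 1) ∘ₗ boundary (k + 1) from
      LinearMap.congr_fun this c
    ext v : 1
    ext1
    simp only [LinearMap.comp_apply, Finsupp.lsingle_apply, subdiv_single]
    rw [boundary_cone, ih, boundary_boundary, map_zero, map_zero, add_zero]

lemma boundary_subdivHomotopy (k : ℕ) (c : OrderedChain (k + 1) α) :
    boundary (k + 1) (subdivHomotopy apex (k + 1) c) + subdivHomotopy apex k (boundary k c) =
      c + subdiv apex (k + 1) c := by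
  suffices boundary (k + 1) ∘ₗ subdivHomotopy apex (k + 1) + subdivHomotopy apex k ∘ₗ boundary k =
      LinearMap.id + subdiv apex (k + 1) from LinearMap.congr_fun this c
  ext v : 1
  ext1
  simp only [LinearMap.comp_apply, Finsupp.lsingle_apply, LinearMap.add_apply, LinearMap.id_apply,
    subdiv_single, subdivHomotopy_single]
  have hboundary : boundary k (Finsupp.single v 1 +
      subdivHomotopy apex k (boundary k (Finsupp.single v 1))) =
        subdiv apex k (boundary k (Finsupp.single v 1)) := by
    rw [map_add]
    cases k with
    | zero => exact (congrArg _ (map_zero _)).trans (add_zero _)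
    | succ k =>
      have ih := boundary_subdivHomotopy k (boundary (k + 1) (Finsupp.single v 1))
      rw [boundary_boundary, map_zero, add_zero] at ih
      rw [ih, ← add_assoc, ZModModule.add_self, zero_add]
  rw [boundary_cone, hboundary, add_right_comm, add_assoc (Finsupp.single v 1), ZModModule.add_self,
    add_zero]

variable {apex} {apex' : ∀ k, (Fin (k + 1) → β) → β} {u : α → β}

lemma map_subdiv (hu : ∀ k v, u (apex k v) = apex' k (u ∘ v)) (k : ℕ) (c : OrderedChain k α) :
    map k u (subdiv apex k c) = subdiv apex' k (map k u c) := by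
  induction k with
  | zero => rfl
  | succ k ih =>
    suffices map (k + 1) u ∘ₗ subdiv apex (k + 1) = subdiv apex' (k + 1) ∘ₗ map (k + 1) u from
      LinearMap.congr_fun this c
    ext v : 1
    ext1
    simp only [LinearMap.comp_apply, Finsupp.lsingle_apply, map_single, subdiv_single]
    rw [map_cone, ih, ← boundary_map, map_single, hu]

lemma map_subdivHomotopy (hu : ∀ k v, u (apex k v) = apex' k (u ∘ v)) (k : ℕ)
    (c : OrderedChain k α) :
    map (k + 1) u (subdivHomotopy apex k c) = subdivHomotopy apex' k (map k u c) := by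
  induction k with
  | zero => exact map_zero _
  | succ k ih =>
    suffices map (k + 2) u ∘ₗ subdivHomotopy apex (k + 1) =
        subdivHomotopy apex' (k + 1) ∘ₗ map (k + 1) u from LinearMap.congr_fun this c
    ext v : 1
    ext1
    simp only [LinearMap.comp_apply, Finsupp.lsingle_apply, map_single, subdivHomotopy_single]
    rw [map_cone, map_add, ih, ← boundary_map, map_single, hu]

end Subdivision

end OrderedChain

lemma mem_of_mem_supported {R α V : Type*} [Semiring R] [AddCommMonoid V] [Module R V]
    {s : Set α} {Q : Submodule R V} (L : (α →₀ R) →ₗ[R] V)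
    (h : ∀ a ∈ s, L (Finsupp.single a 1) ∈ Q) {c : α →₀ R} (hc : c ∈ Finsupp.supported R R s) :
    L c ∈ Q := by
  rw [Finsupp.supported_eq_span_single] at hc
  refine Submodule.span_le (p := Q.comap L).2 ?_ hc
  rintro _ ⟨a, ha, rfl⟩
  exact h a ha

namespace OrderedChain

/-- The ordered `k`-chains all of whose vertices lie in `C`. -/
def verticesIn {α : Type*} (k : ℕ) (C : Set α) : Submodule (ZMod 2) (OrderedChain k α) :=
  Finsupp.supported _ _ {v | ∀ i, v i ∈ C}

/-- The ordered `k`-chains of mesh at most `D`: the vertices of each of their simplices are at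
mutual distance at most `D`. -/
def meshLE {α : Type*} [PseudoMetricSpace α] (k : ℕ) (D : ℝ) :
    Submodule (ZMod 2) (OrderedChain k α) :=
  Finsupp.supported _ _ {v | ∀ i j, dist (v i) (v j) ≤ D}

lemma boundary_single_mem_verticesIn {α : Type*} {k : ℕ} {C : Set α} {v : Fin (k + 2) → α}
    (hv : ∀ i, v i ∈ C) : boundary k (Finsupp.single v 1) ∈ verticesIn k C := by
  rw [boundary_single]
  exact Submodule.sum_mem _ fun i _ ↦ Finsupp.single_mem_supported _ _ fun j ↦ hv _

lemma boundary_single_mem_meshLE {α : Type*} [PseudoMetricSpace α] {k : ℕ} {D : ℝ}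
    {v : Fin (k + 2) → α} (hv : ∀ i j, dist (v i) (v j) ≤ D) :
    boundary k (Finsupp.single v 1) ∈ meshLE k D := by
  rw [boundary_single]
  exact Submodule.sum_mem _ fun i _ ↦ Finsupp.single_mem_supported _ _ fun j l ↦ hv _ _

lemma cone_mem_verticesIn {α : Type*} {k : ℕ} {C : Set α} {b : α} (hb : b ∈ C)
    {c : OrderedChain k α} (hc : c ∈ verticesIn k C) : cone b k c ∈ verticesIn (k + 1) C := by
  refine mem_of_mem_supported _ (fun v hv ↦ ?_) hc
  rw [cone_single]
  exact Finsupp.single_mem_supported _ _ (Fin.cases hb hv)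

lemma subdiv_mem_verticesIn {α : Type*} {apex : ∀ k, (Fin (k + 1) → α) → α} {C : Set α}
    (hC : ∀ k v, (∀ i, v i ∈ C) → apex k v ∈ C) (k : ℕ) {c : OrderedChain k α}
    (hc : c ∈ verticesIn k C) : subdiv apex k c ∈ verticesIn k C := by
  induction k with
  | zero => exact hc
  | succ k ih =>
    refine mem_of_mem_supported _ (fun v hv ↦ ?_) hc
    rw [subdiv_single]
    exact cone_mem_verticesIn (hC _ v hv) (ih (boundary_single_mem_verticesIn hv))

lemma cone_mem_meshLE {α : Type*} [PseudoMetricSpace α] {k : ℕ} {D : ℝ} (hD : 0 ≤ D) {b : α}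
    {c : OrderedChain k α} (hc : c ∈ meshLE k D) (hb : c ∈ verticesIn k (closedBall b D)) :
    cone b k c ∈ meshLE (k + 1) D := by
  have hcb : c ∈ Finsupp.supported (ZMod 2) (ZMod 2) ({v | ∀ i j, dist (v i) (v j) ≤ D} ∩
      {v | ∀ i, v i ∈ closedBall b D}) := by
    rw [Finsupp.supported_inter]
    exact ⟨hc, hb⟩
  refine mem_of_mem_supported _ (fun v hv ↦ ?_) hcb
  rw [cone_single]
  refine Finsupp.single_mem_supported _ _ fun i j ↦ ?_
  cases i using Fin.cases <;> cases j using Fin.cases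
  · simpa using hD
  · exact mem_closedBall'.1 (hv.2 _)
  · exact mem_closedBall.1 (hv.2 _)
  · exact hv.1 _ _

end OrderedChain

/-! ## Affine simplices -/

/-- The standard `n`-simplex. -/
abbrev Δ (n : ℕ) : Type := stdSimplex ℝ (Fin (n + 1))

/-- The affine map of standard simplices with vertices `v`. -/
def affineMap {k N : ℕ} (v : Fin (k + 1) → Δ N) : C(Δ k, Δ N) where
  toFun t := ⟨fun j ↦ ∑ i, t i * v i j, fun j ↦ Finset.sum_nonneg fun i _ ↦
    mul_nonneg (t.2.1 i) ((v i).2.1 j), by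
      rw [Finset.sum_comm]
      simp [← Finset.mul_sum]⟩
  continuous_toFun := by
    refine Continuous.subtype_mk (continuous_pi fun j ↦ continuous_finsetSum _ fun i _ ↦ ?_) _
    exact ((continuous_apply i).comp continuous_subtype_val).mul continuous_const

lemma affineMap_apply {k N : ℕ} (v : Fin (k + 1) → Δ N) (t : Δ k) (j : Fin (N + 1)) :
    affineMap v t j = ∑ i, t i * v i j := rfl

lemma affineMap_affineMap {k M N : ℕ} (w : Fin (M + 1) → Δ N) (v : Fin (k + 1) → Δ M) (t : Δ k) :
    affineMap w (affineMap v t) = affineMap (affineMap w ∘ v) t := by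
  ext j
  simp only [affineMap_apply, Finset.sum_mul, Finset.mul_sum, Function.comp_apply]
  rw [Finset.sum_comm]
  exact Finset.sum_congr rfl fun i _ ↦ Finset.sum_congr rfl fun l _ ↦ mul_assoc _ _ _

lemma affineMap_vertex {k N : ℕ} (v : Fin (k + 1) → Δ N) (i : Fin (k + 1)) :
    affineMap v (stdSimplex.vertex i) = v i := by
  ext j
  simp [affineMap_apply, Pi.single_apply]

lemma affineMap_vertices (n : ℕ) :
    affineMap (stdSimplex.vertex : Fin (n + 1) → Δ n) = ContinuousMap.id _ := by
  ext t j
  simp [affineMap_apply, Pi.single_apply]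

lemma affineMap_comp_faceMap {k N : ℕ} (v : Fin (k + 2) → Δ N) (i : Fin (k + 2)) :
    (affineMap v).comp (faceMap k i) = affineMap (v ∘ i.succAbove) := by
  have hface : faceMap k i = affineMap (stdSimplex.vertex ∘ i.succAbove) := by
    ext t j
    simp [faceMap, affineMap_apply, FunOnFinite.linearMap_apply_apply, Pi.single_apply,
      Finset.sum_filter, eq_comm]
  ext1 t
  rw [hface, ContinuousMap.comp_apply, affineMap_affineMap]
  congr 2
  ext1 l
  exact affineMap_vertex v _

lemma dist_affineMap_le {k N : ℕ} (v : Fin (k + 1) → Δ N) (t : Δ k) (x : Δ N)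
    {r : Fin (k + 1) → ℝ} (h : ∀ i, dist (v i) x ≤ r i) :
    dist (affineMap v t) x ≤ ∑ i, t i * r i := by
  have hcoord (i j) : |v i j - x j| ≤ r i := (dist_le_pi_dist (v i).1 x.1 j).trans (h i)
  refine (dist_pi_le_iff <| Finset.sum_nonneg fun i _ ↦
    mul_nonneg (t.2.1 i) (dist_nonneg.trans (h i))).2 fun j ↦ ?_
  have hsub : affineMap v t j - x j = ∑ i, t i * (v i j - x j) := by
    simp only [mul_sub, Finset.sum_sub_distrib, ← Finset.sum_mul, stdSimplex.sum_eq_one, one_mul,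
      affineMap_apply]
  change |affineMap v t j - x j| ≤ _
  rw [hsub]
  refine (Finset.abs_sum_le_sum_abs _ _).trans (Finset.sum_le_sum fun i _ ↦ ?_)
  rw [abs_mul, abs_of_nonneg (stdSimplex.zero_le t i)]
  exact mul_le_mul_of_nonneg_left (hcoord i j) (t.2.1 i)

lemma affineMap_mem_closedBall {k N : ℕ} {v : Fin (k + 1) → Δ N} {x : Δ N} {r : ℝ}
    (h : ∀ i, v i ∈ closedBall x r) (t : Δ k) : affineMap v t ∈ closedBall x r := by
  simpa [← Finset.sum_mul] using dist_affineMap_le v t x h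

/-- The barycenter of the affine simplex with vertices `v`. -/
def barycenter {N : ℕ} (k : ℕ) (v : Fin (k + 1) → Δ N) : Δ N := affineMap v stdSimplex.barycenter

lemma affineMap_barycenter {M N : ℕ} (w : Fin (M + 1) → Δ N) (k : ℕ) (v : Fin (k + 1) → Δ M) :
    affineMap w (barycenter k v) = barycenter k (affineMap w ∘ v) := affineMap_affineMap w v _

lemma dist_barycenter_le {N k : ℕ} {v : Fin (k + 1) → Δ N} {D : ℝ}
    (h : ∀ i j, dist (v i) (v j) ≤ D) (i : Fin (k + 1)) :
    dist (v i) (barycenter k v) ≤ k / (k + 1) * D := by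
  have hr (j : Fin (k + 1)) : dist (v j) (v i) ≤ if j = i then 0 else D := by
    split_ifs with hj
    · rw [hj, dist_self]
    · exact h j i
  rw [dist_comm]
  refine (dist_affineMap_le v stdSimplex.barycenter (v i) hr).trans (le_of_eq ?_)
  have hb (j : Fin (k + 1)) : (stdSimplex.barycenter : Δ k) j = ((k : ℝ) + 1)⁻¹ := by
    change ((Fintype.card (Fin (k + 1)) : ℕ) : ℝ)⁻¹ = _
    simp
  simp only [hb, ← Finset.mul_sum, Finset.sum_ite, Finset.sum_const_zero, Finset.sum_const,
    zero_add, Finset.filter_ne' Finset.univ i, Finset.card_erase_of_mem (Finset.mem_univ i),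
    Finset.card_univ, Fintype.card_fin, Nat.add_sub_cancel, nsmul_eq_mul]
  ring

namespace OrderedChain

lemma meshLE_mono {α : Type*} [PseudoMetricSpace α] (k : ℕ) {D D' : ℝ} (h : D ≤ D') :
    (meshLE k D : Submodule _ (OrderedChain k α)) ≤ meshLE k D' :=
  Finsupp.supported_mono fun _ hv i j ↦ (hv i j).trans h

lemma subdiv_barycenter_mem_meshLE {N : ℕ} (k : ℕ) {D : ℝ} (hD : 0 ≤ D)
    {c : OrderedChain k (Δ N)} (hc : c ∈ meshLE k D) :
    subdiv barycenter k c ∈ meshLE k (k / (k + 1) * D) := by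
  induction k with
  | zero =>
    refine mem_of_mem_supported _ (fun v _ ↦ Finsupp.single_mem_supported _ _ fun i j ↦ ?_) hc
    simp [Subsingleton.elim (α := Fin 1) i j]
  | succ k ih =>
    refine mem_of_mem_supported _ (fun v hv ↦ ?_) hc
    have hle : (k : ℝ) / (k + 1) * D ≤ (k + 1 : ℕ) / ((k + 1 : ℕ) + 1) * D := by
      refine mul_le_mul_of_nonneg_right ?_ hD
      rw [div_le_div_iff₀ (by positivity) (by positivity)]
      push_cast
      nlinarith
    rw [subdiv_single]
    exact cone_mem_meshLE (by positivity) (meshLE_mono k hle (ih (boundary_single_mem_meshLE hv)))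
      (subdiv_mem_verticesIn (fun k w hw ↦ affineMap_mem_closedBall hw _) k
        (boundary_single_mem_verticesIn (dist_barycenter_le hv)))

lemma subdiv_barycenter_pow_mem_meshLE {N : ℕ} (k m : ℕ) {D : ℝ} (hD : 0 ≤ D)
    {c : OrderedChain k (Δ N)} (hc : c ∈ meshLE k D) :
    (subdiv barycenter k ^ m : Module.End _ _) c ∈ meshLE k ((k / (k + 1)) ^ m * D) := by
  induction m with
  | zero => simpa using hc
  | succ m ih =>
    rw [pow_succ', pow_succ', mul_assoc]
    exact subdiv_barycenter_mem_meshLE k (by positivity) ih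

end OrderedChain

namespace OrderedChain

/-- The singular chain of affine simplices with the vertices of an ordered chain. -/
def toSingular {N : ℕ} (k : ℕ) : OrderedChain k (Δ N) →ₗ[ZMod 2] SingularChain k (Δ N) :=
  Finsupp.lmapDomain _ _ affineMap

@[simp]
lemma toSingular_single {N : ℕ} (k : ℕ) (v : Fin (k + 1) → Δ N) (r : ZMod 2) :
    toSingular k (Finsupp.single v r) = Finsupp.single (affineMap v) r := by
  simp [toSingular, Finsupp.mapDomain_single]

lemma boundary_toSingular {N : ℕ} (k : ℕ) (c : OrderedChain (k + 1) (Δ N)) :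
    SingularChain.boundary k (toSingular (k + 1) c) = toSingular k (boundary k c) := by
  have : SingularChain.boundary k ∘ₗ toSingular (k + 1) =
      toSingular k ∘ₗ boundary (α := Δ N) k := by
    ext v : 1
    ext1
    simp [affineMap_comp_faceMap]
  exact LinearMap.congr_fun this c

lemma map_affineMap_toSingular {M N : ℕ} (k : ℕ) (w : Fin (M + 1) → Δ N)
    (c : OrderedChain k (Δ M)) :
    SingularChain.map k (affineMap w) (toSingular k c) = toSingular k (map k (affineMap w) c) := by
  have : SingularChain.map k (affineMap w) ∘ₗ toSingular k =
      toSingular k ∘ₗ map k (affineMap w) := by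
    ext v : 1
    ext1
    simp only [LinearMap.comp_apply, Finsupp.lsingle_apply, map_single, toSingular_single,
      SingularChain.map_single]
    exact congrArg (Finsupp.single · 1) (ContinuousMap.ext (affineMap_affineMap w v))
  exact LinearMap.congr_fun this c

/-- The standard simplex `Δ n` as an ordered chain. -/
def fundamental (n : ℕ) : OrderedChain n (Δ n) := Finsupp.single stdSimplex.vertex 1

lemma map_affineMap_fundamental {k N : ℕ} (v : Fin (k + 1) → Δ N) :
    map k (affineMap v) (fundamental k) = Finsupp.single v 1 := by
  rw [fundamental, map_single]
  exact congrArg (Finsupp.single · 1) (funext (affineMap_vertex v))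

lemma fundamental_mem_meshLE (n : ℕ) : fundamental n ∈ meshLE n 1 := by
  refine Finsupp.single_mem_supported _ _ fun i j ↦ ?_
  refine (dist_pi_le_iff zero_le_one).2 fun l ↦ ?_
  rw [Real.dist_eq, abs_sub_le_iff]
  have h0 (i : Fin (n + 1)) := stdSimplex.zero_le (stdSimplex.vertex i : Δ n) l
  have h1 (i : Fin (n + 1)) := stdSimplex.le_one (stdSimplex.vertex i : Δ n) l
  constructor
  · exact sub_le_iff_le_add.2 ((h1 i).trans (le_add_of_nonneg_right (h0 j)))
  · exact sub_le_iff_le_add.2 ((h1 j).trans (le_add_of_nonneg_right (h0 i)))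

end OrderedChain

namespace SingularChain

open OrderedChain (toSingular fundamental)

section Subdivision

variable {X Y : Type*} [TopologicalSpace X] [TopologicalSpace Y]

lemma map_toSingular_fundamental (n : ℕ) (σ : SingularSimplex n X) :
    map n σ (toSingular n (fundamental n)) = Finsupp.single σ 1 := by
  rw [fundamental, OrderedChain.toSingular_single, map_single, affineMap_vertices,
    ContinuousMap.comp_id]

/-- Barycentric subdivision of singular chains. -/
def subdiv (n : ℕ) : Module.End (ZMod 2) (SingularChain n X) :=
  Finsupp.linearCombination (ZMod 2) fun σ ↦
    map n σ (toSingular n (OrderedChain.subdiv barycenter n (fundamental n)))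

/-- The chain homotopy between barycentric subdivision and the identity. -/
def subdivHomotopy (n : ℕ) : SingularChain n X →ₗ[ZMod 2] SingularChain (n + 1) X :=
  Finsupp.linearCombination (ZMod 2) fun σ ↦
    map (n + 1) σ (toSingular (n + 1) (OrderedChain.subdivHomotopy barycenter n (fundamental n)))

lemma subdiv_single (n : ℕ) (σ : SingularSimplex n X) :
    subdiv n (Finsupp.single σ 1) =
      map n σ (toSingular n (OrderedChain.subdiv barycenter n (fundamental n))) := by
  simp [subdiv]

lemma subdivHomotopy_single (n : ℕ) (σ : SingularSimplex n X) :
    subdivHomotopy n (Finsupp.single σ 1) = map (n + 1) σ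
      (toSingular (n + 1) (OrderedChain.subdivHomotopy barycenter n (fundamental n))) := by
  simp [subdivHomotopy]

lemma subdiv_map (n : ℕ) (f : C(X, Y)) (c : SingularChain n X) :
    subdiv n (map n f c) = map n f (subdiv n c) := by
  have : subdiv n ∘ₗ map n f = map n f ∘ₗ subdiv n := by
    ext σ : 1
    ext1
    simp [subdiv_single, map_map]
  exact LinearMap.congr_fun this c

lemma subdivHomotopy_map (n : ℕ) (f : C(X, Y)) (c : SingularChain n X) :
    subdivHomotopy n (map n f c) = map (n + 1) f (subdivHomotopy n c) := by
  have : subdivHomotopy n ∘ₗ map n f = map (n + 1) f ∘ₗ subdivHomotopy n := by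
    ext σ : 1
    ext1
    simp [subdivHomotopy_single, map_map]
  exact LinearMap.congr_fun this c

lemma subdiv_toSingular {N : ℕ} (n : ℕ) (c : OrderedChain n (Δ N)) :
    subdiv n (toSingular n c) = toSingular n (OrderedChain.subdiv barycenter n c) := by
  have : subdiv n ∘ₗ toSingular n =
      toSingular n ∘ₗ OrderedChain.subdiv (barycenter (N := N)) n := by
    ext v : 1
    ext1
    simp only [LinearMap.comp_apply, Finsupp.lsingle_apply, OrderedChain.toSingular_single,
      subdiv_single]
    rw [OrderedChain.map_affineMap_toSingular,
      OrderedChain.map_subdiv (affineMap_barycenter v), OrderedChain.map_affineMap_fundamental]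
  exact LinearMap.congr_fun this c

lemma subdivHomotopy_toSingular {N : ℕ} (n : ℕ) (c : OrderedChain n (Δ N)) :
    subdivHomotopy n (toSingular n c) =
      toSingular (n + 1) (OrderedChain.subdivHomotopy barycenter n c) := by
  have : subdivHomotopy n ∘ₗ toSingular n =
      toSingular (n + 1) ∘ₗ OrderedChain.subdivHomotopy (barycenter (N := N)) n := by
    ext v : 1
    ext1
    simp only [LinearMap.comp_apply, Finsupp.lsingle_apply, OrderedChain.toSingular_single,
      subdivHomotopy_single]
    rw [OrderedChain.map_affineMap_toSingular,
      OrderedChain.map_subdivHomotopy (affineMap_barycenter v),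
      OrderedChain.map_affineMap_fundamental]
  exact LinearMap.congr_fun this c

lemma boundary_subdiv (n : ℕ) (c : SingularChain (n + 1) X) :
    boundary n (subdiv (n + 1) c) = subdiv n (boundary n c) := by
  have : boundary n ∘ₗ subdiv (n + 1) = subdiv n ∘ₗ boundary (X := X) n := by
    ext σ : 1
    ext1
    simp only [LinearMap.comp_apply, Finsupp.lsingle_apply]
    rw [← map_toSingular_fundamental]
    simp only [subdiv_map, boundary_map, subdiv_toSingular, OrderedChain.boundary_toSingular,
      OrderedChain.boundary_subdiv]
  exact LinearMap.congr_fun this c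

lemma boundary_subdivHomotopy (n : ℕ) (c : SingularChain (n + 1) X) :
    boundary (n + 1) (subdivHomotopy (n + 1) c) + subdivHomotopy n (boundary n c) =
      c + subdiv (n + 1) c := by
  have : boundary (n + 1) ∘ₗ subdivHomotopy (n + 1) + subdivHomotopy n ∘ₗ boundary (X := X) n =
      LinearMap.id + subdiv (n + 1) := by
    ext σ : 1
    ext1
    simp only [LinearMap.comp_apply, Finsupp.lsingle_apply, LinearMap.add_apply, LinearMap.id_apply]
    rw [← map_toSingular_fundamental]
    simp only [subdiv_map, subdivHomotopy_map, boundary_map, subdiv_toSingular,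
      subdivHomotopy_toSingular, OrderedChain.boundary_toSingular]
    rw [← map_add, ← map_add, OrderedChain.boundary_subdivHomotopy, map_add, map_add]
  exact LinearMap.congr_fun this c

/-- The chain homotopy between the `m`-fold barycentric subdivision and the identity. -/
def subdivPowHomotopy (n : ℕ) : ℕ → SingularChain n X →ₗ[ZMod 2] SingularChain (n + 1) X
  | 0 => 0
  | m + 1 => subdivHomotopy n + subdivPowHomotopy n m ∘ₗ subdiv n

lemma subdivPowHomotopy_succ (n m : ℕ) (c : SingularChain n X) :
    subdivPowHomotopy n (m + 1) c =
      subdivHomotopy n c + subdivPowHomotopy n m (subdiv n c) := rfl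

lemma subdiv_pow_succ (n m : ℕ) (c : SingularChain n X) :
    (subdiv n ^ (m + 1)) c = (subdiv n ^ m) (subdiv n c) := rfl

lemma boundary_subdivPowHomotopy (n m : ℕ) (c : SingularChain (n + 1) X) :
    boundary (n + 1) (subdivPowHomotopy (n + 1) m c) + subdivPowHomotopy n m (boundary n c) =
      c + (subdiv (n + 1) ^ m) c := by
  induction m generalizing c with
  | zero =>
    change boundary (n + 1) 0 + 0 = c + c
    rw [map_zero, add_zero, ZModModule.add_self]
  | succ m ih =>
    rw [subdivPowHomotopy_succ, subdivPowHomotopy_succ, subdiv_pow_succ, map_add, add_add_add_comm,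
      boundary_subdivHomotopy, ← boundary_subdiv, ih, add_assoc, ← add_assoc (subdiv (n + 1) c),
      ZModModule.add_self, zero_add]

lemma subdiv_pow_map (n m : ℕ) (f : C(X, Y)) (c : SingularChain n X) :
    (subdiv n ^ m) (map n f c) = map n f ((subdiv n ^ m) c) := by
  induction m generalizing c with
  | zero => rfl
  | succ m ih => rw [subdiv_pow_succ, subdiv_pow_succ, subdiv_map, ih]

lemma subdiv_pow_toSingular {N : ℕ} (n m : ℕ) (c : OrderedChain n (Δ N)) :
    (subdiv n ^ m) (toSingular n c) =
      toSingular n ((OrderedChain.subdiv barycenter n ^ m : Module.End _ _) c) := by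
  induction m generalizing c with
  | zero => rfl
  | succ m ih =>
    rw [subdiv_pow_succ, subdiv_toSingular, ih]
    rfl

end Subdivision

/-! ## Small chains -/

section Small

variable {X Y : Type*} [TopologicalSpace X] [TopologicalSpace Y]

/-- The singular chains of simplices with image in `A`. -/
def supportedIn (n : ℕ) (A : Set X) : Submodule (ZMod 2) (SingularChain n X) :=
  Finsupp.supported _ _ {σ | range σ ⊆ A}

lemma single_mem_supportedIn {n : ℕ} {A : Set X} {σ : SingularSimplex n X} (h : range σ ⊆ A)
    (r : ZMod 2) : Finsupp.single σ r ∈ supportedIn n A :=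
  Finsupp.single_mem_supported _ _ h

lemma supportedIn_inter (n : ℕ) (A B : Set X) :
    supportedIn n (A ∩ B) = supportedIn n A ⊓ supportedIn n B := by
  simp only [supportedIn, ← Finsupp.supported_inter, subset_inter_iff, ofPred_and]

lemma map_mem_supportedIn {n : ℕ} {A : Set Y} (f : C(X, Y)) (h : range f ⊆ A)
    (c : SingularChain n X) : map n f c ∈ supportedIn n A := by
  refine mem_of_mem_supported (s := univ) (map n f) (fun σ _ ↦ ?_) (by simp)
  rw [map_single]
  exact single_mem_supportedIn ((range_comp_subset_range σ f).trans h) _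

lemma boundary_mem_supportedIn {n : ℕ} {A : Set X} {c : SingularChain (n + 1) X}
    (hc : c ∈ supportedIn (n + 1) A) : boundary n c ∈ supportedIn n A := by
  refine mem_of_mem_supported _ (fun σ hσ ↦ ?_) hc
  rw [boundary_single]
  refine Submodule.sum_mem _ fun i _ ↦ single_mem_supportedIn ?_ _
  exact (range_comp_subset_range _ σ).trans hσ

lemma subdiv_mem_supportedIn {n : ℕ} {A : Set X} {c : SingularChain n X}
    (hc : c ∈ supportedIn n A) : subdiv n c ∈ supportedIn n A := by
  refine mem_of_mem_supported _ (fun σ hσ ↦ ?_) hc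
  rw [subdiv_single]
  exact map_mem_supportedIn _ hσ _

lemma subdivHomotopy_mem_supportedIn {n : ℕ} {A : Set X} {c : SingularChain n X}
    (hc : c ∈ supportedIn n A) : subdivHomotopy n c ∈ supportedIn (n + 1) A := by
  refine mem_of_mem_supported _ (fun σ hσ ↦ ?_) hc
  rw [subdivHomotopy_single]
  exact map_mem_supportedIn _ hσ _

lemma subdivPowHomotopy_mem_supportedIn {n : ℕ} (m : ℕ) {A : Set X} {c : SingularChain n X}
    (hc : c ∈ supportedIn n A) : subdivPowHomotopy n m c ∈ supportedIn (n + 1) A := by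
  induction m generalizing c with
  | zero => exact Submodule.zero_mem _
  | succ _ ih =>
    exact Submodule.add_mem _ (subdivHomotopy_mem_supportedIn hc) (ih (subdiv_mem_supportedIn hc))

lemma map_toSingular_mem_supportedIn_sup {n : ℕ} {A B : Set X} {σ : SingularSimplex n X} {δ : ℝ}
    (hδ : ∀ x : Δ n, ball x δ ⊆ σ ⁻¹' A ∨ ball x δ ⊆ σ ⁻¹' B) {D : ℝ} (hD : D < δ)
    {c : OrderedChain n (Δ n)} (hc : c ∈ OrderedChain.meshLE n D) :
    map n σ (toSingular n c) ∈ supportedIn n A ⊔ supportedIn n B := by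
  refine mem_of_mem_supported (map n σ ∘ₗ toSingular n) (fun v hv ↦ ?_) hc
  have hball (t : Δ n) : affineMap v t ∈ ball (v 0) δ :=
    closedBall_subset_ball hD (affineMap_mem_closedBall (fun i ↦ hv i 0) t)
  rw [LinearMap.comp_apply, OrderedChain.toSingular_single, map_single]
  rcases hδ (v 0) with h | h
  · refine Submodule.mem_sup_left (single_mem_supportedIn ?_ _)
    exact range_subset_iff.2 fun t ↦ h (hball t)
  · refine Submodule.mem_sup_right (single_mem_supportedIn ?_ _)
    exact range_subset_iff.2 fun t ↦ h (hball t)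

lemma exists_ball_subset_preimage_or {n : ℕ} {A B : Set X} (hA : IsOpen A) (hB : IsOpen B)
    (hAB : A ∪ B = univ) (σ : SingularSimplex n X) :
    ∃ δ > 0, ∀ x : Δ n, ball x δ ⊆ σ ⁻¹' A ∨ ball x δ ⊆ σ ⁻¹' B := by
  obtain ⟨δ, hδ, hball⟩ := lebesgue_number_lemma_of_metric (s := (univ : Set (Δ n)))
    (c := fun b : Bool ↦ σ ⁻¹' cond b A B) isCompact_univ
    (fun b ↦ IsOpen.preimage σ.continuous (by cases b <;> assumption))
    (by simp [← union_eq_iUnion, ← preimage_iUnion, hAB])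
  refine ⟨δ, hδ, fun x ↦ ?_⟩
  obtain ⟨_ | _, hb⟩ := hball x trivial
  · exact Or.inr hb
  · exact Or.inl hb

lemma eventually_subdiv_pow_mem_sup {A B : Set X} (hA : IsOpen A) (hB : IsOpen B)
    (hAB : A ∪ B = univ) (n : ℕ) (c : SingularChain n X) :
    ∀ᶠ m in Filter.atTop, (subdiv n ^ m) c ∈ supportedIn n A ⊔ supportedIn n B := by
  induction c using Finsupp.induction_linear with
  | zero => exact .of_forall fun m ↦ by simp
  | add f g hf hg =>
    filter_upwards [hf, hg] with m hmf hmg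
    rw [map_add]
    exact Submodule.add_mem _ hmf hmg
  | single σ r =>
    obtain ⟨δ, hδ, hball⟩ := exists_ball_subset_preimage_or hA hB hAB σ
    have hlim := tendsto_pow_atTop_nhds_zero_of_lt_one (r := (n : ℝ) / (n + 1)) (by positivity)
      ((div_lt_one (by positivity)).2 (lt_add_one _))
    filter_upwards [hlim.eventually_lt_const hδ] with m hm
    rw [← mul_one r, ← smul_eq_mul, ← Finsupp.smul_single, map_smul, ← map_toSingular_fundamental,
      subdiv_pow_map, subdiv_pow_toSingular]
    refine Submodule.smul_mem _ _ (map_toSingular_mem_supportedIn_sup hball hm ?_)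
    simpa using OrderedChain.subdiv_barycenter_pow_mem_meshLE n m zero_le_one
      (OrderedChain.fundamental_mem_meshLE n)

end Small

end SingularChain

open scoped ContinuousMap

namespace SingularChain

/-! ## The kernel in homology of a map with a section -/

section Kernel

variable {X Y W : Type} [TopologicalSpace X] [TopologicalSpace Y] [TopologicalSpace W]

/-- The cycles of `Y` that become boundaries under `p`. -/
def kernelCycles (p : C(Y, X)) (n : ℕ) : Submodule (ZMod 2) (SingularChain n Y) :=
  cycles Y n ⊓ (boundaries X n).comap (map n p)

/-- The dimension of the kernel of the map induced by `p` in homology. -/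
def kernelRank (p : C(Y, X)) (n : ℕ) : Cardinal :=
  subquotientRank (kernelCycles p n) (boundaries Y n)

lemma boundary_mem_kernelCycles (p : C(Y, X)) (n : ℕ) (c : SingularChain (n + 1) Y) :
    boundary n c ∈ kernelCycles p n :=
  ⟨boundary_mem_cycles n c, map_mem_boundaries p ⟨c, rfl⟩⟩

lemma subquotientRank_cycles_eq_add_kernelRank (p : C(Y, X)) (s : C(X, Y))
    (hps : p.comp s = .id X) (n : ℕ) :
    subquotientRank (cycles Y n) (boundaries Y n) =
      subquotientRank (cycles X n) (boundaries X n) + kernelRank p n :=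
  subquotientRank_eq_add_of_linearMap (map n p) (fun _ h ↦ map_mem_cycles p h)
    (fun _ h ↦ map_mem_boundaries p h) fun w hw ↦
    ⟨map n s w, map_mem_cycles s hw, by rw [map_map, hps, map_id]⟩

lemma map_mem_kernelCycles {p : C(Y, X)} {q : C(W, X)} {f : C(Y, W)} (hf : q.comp f = p) {n : ℕ}
    {c : SingularChain n Y} (hc : c ∈ kernelCycles p n) : map n f c ∈ kernelCycles q n := by
  refine ⟨map_mem_cycles f hc.1, ?_⟩
  rw [SetLike.mem_coe, Submodule.mem_comap, map_map, hf]
  exact hc.2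

lemma map_sub_self_mem_boundaries {f : C(X, X)} (hf : f.Homotopic (.id X)) {n : ℕ}
    {c : SingularChain n X} (hc : c ∈ cycles X n) : map n f c - c ∈ boundaries X n := by
  simpa only [map_id] using map_sub_map_mem_boundaries hf hc

lemma kernelRank_eq_of_homotopyEquiv {p : C(Y, X)} {q : C(W, X)} (e : Y ≃ₕ W)
    (he : q.comp e.toFun = p) (he' : p.comp e.invFun = q) (n : ℕ) :
    kernelRank p n = kernelRank q n := by
  refine subquotientRank_eq_of_linearMap (map n e.toFun) (fun z hz ↦ map_mem_kernelCycles he hz)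
    (fun z hz ↦ ⟨fun h ↦ ?_, map_mem_boundaries e.toFun⟩) fun w hw ↦
    ⟨map n e.invFun w, map_mem_kernelCycles he' hw, ?_⟩
  · have map_map_sub_mem := map_sub_self_mem_boundaries e.left_inv hz.1
    rw [← map_map] at map_map_sub_mem
    exact (Submodule.sub_mem_iff_right _ (map_mem_boundaries e.invFun h)).1 map_map_sub_mem
  · rw [map_map]
    exact map_sub_self_mem_boundaries e.right_inv hw.1

end Kernel

section Subsets

variable {Y : Type*} [TopologicalSpace Y]

/-- The inclusion of a subset, as a continuous map. -/
def incl (A : Set Y) : C(A, Y) := ⟨Subtype.val, continuous_subtype_val⟩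

lemma map_incl_injective (A : Set Y) (n : ℕ) : Function.Injective (map n (incl A)) := by
  refine Finsupp.mapDomain_injective fun σ τ h ↦ ?_
  ext1 t
  exact Subtype.ext (congrArg (fun φ : SingularSimplex n Y ↦ φ t) h)

lemma map_incl_mem_supportedIn (A : Set Y) {n : ℕ} (c : SingularChain n A) :
    map n (incl A) c ∈ supportedIn n A :=
  map_mem_supportedIn _ (range_subset_iff.2 Subtype.property) c

lemma exists_map_incl_eq {A : Set Y} {n : ℕ} {c : SingularChain n Y} (hc : c ∈ supportedIn n A) :
    ∃ e : SingularChain n A, map n (incl A) e = c := by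
  refine mem_of_mem_supported (Q := LinearMap.range (map n (incl A))) LinearMap.id
    (fun σ hσ ↦ ?_) hc
  refine ⟨Finsupp.single ⟨fun t ↦ ⟨σ t, hσ ⟨t, rfl⟩⟩, by fun_prop⟩ 1, ?_⟩
  rw [map_single]
  rfl

lemma mem_cycles_of_map_incl {A : Set Y} {n : ℕ} {c : SingularChain n A}
    (h : map n (incl A) c ∈ cycles Y n) : c ∈ cycles A n := by
  cases n with
  | zero => trivial
  | succ n =>
    refine map_incl_injective A n ?_
    rw [← boundary_map, map_zero]
    exact h

lemma supportedIn_sup_eq_top {A A' : Set Y} {n : ℕ}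
    (h : ∀ σ : SingularSimplex n Y, range σ ⊆ A ∨ range σ ⊆ A') :
    supportedIn n A ⊔ supportedIn n A' = ⊤ := by
  rw [supportedIn, supportedIn, ← Finsupp.supported_union, ← Finsupp.supported_univ]
  exact congrArg _ (eq_univ_of_forall h)

lemma disjoint_supportedIn {A A' : Set Y} (h : Disjoint A A') (n : ℕ) :
    Disjoint (supportedIn n A) (supportedIn n A') := by
  refine Finsupp.disjoint_supported_supported (Set.disjoint_left.2 fun σ hA hA' ↦ ?_)
  exact Set.disjoint_left.1 h (hA ⟨stdSimplex.vertex 0, rfl⟩) (hA' ⟨stdSimplex.vertex 0, rfl⟩)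

end Subsets

section HomologousIn

variable {X Y : Type} [TopologicalSpace X] [TopologicalSpace Y]

/-- Cycles in `A` are homologous in `A` to their images under `r`. -/
def HomologousIn (A : Set Y) (r : C(Y, Y)) : Prop :=
  ∀ n, ∀ α ∈ cycles Y n, α ∈ supportedIn n A →
    ∃ e ∈ supportedIn (n + 1) A, boundary n e = α - map n r α

lemma homologousIn_of_homotopic {A : Set Y} {r : C(Y, Y)} {r' : C(A, A)}
    (hr : (incl A).comp r' = r.comp (incl A)) (h : (ContinuousMap.id A).Homotopic r') :
    HomologousIn A r := by
  intro n α hα hαA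
  obtain ⟨c, rfl⟩ := exists_map_incl_eq hαA
  obtain ⟨e, he⟩ := map_sub_map_mem_boundaries h (mem_cycles_of_map_incl hα)
  refine ⟨map (n + 1) (incl A) e, map_incl_mem_supportedIn A e, ?_⟩
  rw [boundary_map, he, map_sub, map_id, map_map, map_map, hr]

lemma HomologousIn.sub_map_mem_boundaries {A : Set Y} {r : C(Y, Y)} (h : HomologousIn A r) {n : ℕ}
    {α : SingularChain n Y} (hα : α ∈ cycles Y n) (hαA : α ∈ supportedIn n A) :
    α - map n r α ∈ boundaries Y n :=
  let ⟨e, _, he⟩ := h n α hα hαA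
  ⟨e, he⟩

lemma HomologousIn.exists_boundary_eq {A : Set Y} {p : C(Y, X)} {s : C(X, Y)}
    (hA : HomologousIn A (s.comp p)) (hs : ∀ x, s x ∈ A) {n : ℕ} {α : SingularChain n Y}
    (hα : α ∈ kernelCycles p n) (hαA : α ∈ supportedIn n A) :
    ∃ e ∈ supportedIn (n + 1) A, boundary n e = α := by
  obtain ⟨e, heA, he⟩ := hA n α hα.1 hαA
  obtain ⟨x, hx⟩ := hα.2
  refine ⟨e + map (n + 1) s x,
    Submodule.add_mem _ heA (map_mem_supportedIn _ (range_subset_iff.2 hs) _), ?_⟩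
  rw [map_add, he, boundary_map, hx, map_map, sub_add_cancel]

end HomologousIn

/-! ## The Mayer–Vietoris shift -/

section MayerVietoris

variable {X Y : Type} [TopologicalSpace X] [TopologicalSpace Y]

/-- The pairs of a chain in `A` and a chain in `A'` whose difference is a kernel cycle. -/
def splitKernelCycles (p : C(Y, X)) (A A' : Set Y) (n : ℕ) :
    Submodule (ZMod 2) (SingularChain n Y × SingularChain n Y) :=
  (supportedIn n A).prod (supportedIn n A') ⊓
    (kernelCycles p n).comap (LinearMap.fst _ _ _ - LinearMap.snd _ _ _)

/-- The pairs of chains whose difference is a boundary. -/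
def splitBoundaries (Y : Type) [TopologicalSpace Y] (n : ℕ) :
    Submodule (ZMod 2) (SingularChain n Y × SingularChain n Y) :=
  (boundaries Y n).comap (LinearMap.fst _ _ _ - LinearMap.snd _ _ _)

lemma exists_subdiv_pow_eq_sub {A A' : Set Y} (hA : IsOpen A) (hA' : IsOpen A')
    (hAA' : A ∪ A' = univ) (n : ℕ) (c : SingularChain n Y) :
    ∃ m, ∃ a ∈ supportedIn n A, ∃ b ∈ supportedIn n A', (subdiv n ^ m) c = a - b := by
  obtain ⟨m, hm⟩ := (eventually_subdiv_pow_mem_sup hA hA' hAA' n c).exists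
  obtain ⟨a, ha, b, hb, h⟩ := Submodule.mem_sup.1 hm
  exact ⟨m, a, ha, b, hb, by rw [← h, ZModModule.sub_eq_add]⟩

lemma subquotientRank_splitKernelCycles (p : C(Y, X)) {A A' : Set Y} (hA : IsOpen A)
    (hA' : IsOpen A') (hAA' : A ∪ A' = univ) (n : ℕ) :
    subquotientRank (splitKernelCycles p A A' (n + 1)) (splitBoundaries Y (n + 1)) =
      kernelRank p (n + 1) := by
  refine subquotientRank_eq_of_linearMap (LinearMap.fst _ _ _ - LinearMap.snd _ _ _)
    (fun _ h ↦ h.2) (fun _ _ ↦ Iff.rfl) fun z hz ↦ ?_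
  obtain ⟨m, a, ha, b, hb, hab⟩ := exists_subdiv_pow_eq_sub hA hA' hAA' (n + 1) z
  have hsub : a - b - z = boundary (n + 1) (subdivPowHomotopy (n + 1) m z) := by
    have hz0 : boundary n z = 0 := hz.1
    have hT := boundary_subdivPowHomotopy n m z
    rw [hz0, map_zero, add_zero, hab] at hT
    rw [hT, ZModModule.sub_eq_add (a - b) z, add_comm z]
  refine ⟨(a, b), ⟨⟨ha, hb⟩, ?_⟩, _, hsub.symm⟩
  exact (Submodule.sub_mem_iff_left _ hz).1 (hsub ▸ boundary_mem_kernelCycles p _ _)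

lemma boundary_eq_of_mem_splitKernelCycles {p : C(Y, X)} {A A' : Set Y} {n : ℕ}
    {c : SingularChain (n + 1) Y × SingularChain (n + 1) Y}
    (hc : c ∈ splitKernelCycles p A A' (n + 1)) : boundary n c.1 = boundary n c.2 := by
  have h : boundary n (c.1 - c.2) = 0 := hc.2.1
  rwa [map_sub, sub_eq_zero] at h

lemma boundary_fst_mem_supportedIn_inter {p : C(Y, X)} {A A' : Set Y} {n : ℕ}
    {c : SingularChain (n + 1) Y × SingularChain (n + 1) Y}
    (hc : c ∈ splitKernelCycles p A A' (n + 1)) : boundary n c.1 ∈ supportedIn n (A ∩ A') := by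
  rw [supportedIn_inter]
  refine ⟨boundary_mem_supportedIn hc.1.1, ?_⟩
  rw [boundary_eq_of_mem_splitKernelCycles hc]
  exact boundary_mem_supportedIn hc.1.2

lemma exists_boundary_eq_of_mem_splitBoundaries {A A' : Set Y} (hA : IsOpen A) (hA' : IsOpen A')
    (hAA' : A ∪ A' = univ) {n : ℕ} {a b : SingularChain (n + 1) Y}
    (ha : a ∈ supportedIn (n + 1) A) (hb : b ∈ supportedIn (n + 1) A')
    (hab : (a, b) ∈ splitBoundaries Y (n + 1)) :
    ∃ u ∈ supportedIn (n + 1) (A ∩ A'), boundary n u = boundary n a := by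
  obtain ⟨y, hy : boundary (n + 1) y = a - b⟩ := hab
  obtain ⟨m, a', ha', b', hb', hab'⟩ := exists_subdiv_pow_eq_sub hA hA' hAA' (n + 2) y
  let correct (c c' : SingularChain _ Y) : SingularChain (n + 1) Y :=
    c + boundary (n + 1) c' - boundary (n + 1) (subdivPowHomotopy (n + 1) m c)
  have correct_eq : correct a a' = correct b b' := by
    have hT := congrArg (boundary (n + 1)) (boundary_subdivPowHomotopy (n + 1) m y)
    rw [map_add, boundary_boundary, zero_add, hy, hab', map_add, hy] at hT
    simp only [map_sub] at hT
    rw [← sub_eq_zero]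
    calc correct a a' - correct b b' = a - b +
          (boundary (n + 1) a' - boundary (n + 1) b') -
          (boundary (n + 1) (subdivPowHomotopy (n + 1) m a) -
            boundary (n + 1) (subdivPowHomotopy (n + 1) m b)) := by simp only [correct]; abel
      _ = 0 := by rw [hT, sub_self]
  have correct_mem {B : Set Y} {c c' : SingularChain _ Y} (hc : c ∈ supportedIn (n + 1) B)
      (hc' : c' ∈ supportedIn (n + 2) B) : correct c c' ∈ supportedIn (n + 1) B :=
    Submodule.sub_mem _ (Submodule.add_mem _ hc (boundary_mem_supportedIn hc'))
      (boundary_mem_supportedIn (subdivPowHomotopy_mem_supportedIn m hc))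
  refine ⟨correct a a', ?_, ?_⟩
  · rw [supportedIn_inter]
    exact ⟨correct_mem ha ha', correct_eq ▸ correct_mem hb hb'⟩
  · simp only [correct, map_sub, map_add, boundary_boundary, add_zero, sub_zero]

lemma mem_splitBoundaries_of_boundary_eq {p : C(Y, X)} {s : C(X, Y)} {A A' : Set Y}
    (hhA : HomologousIn A (s.comp p)) (hhA' : HomologousIn A' (s.comp p)) {n : ℕ}
    {c : SingularChain (n + 1) Y × SingularChain (n + 1) Y}
    (hc : c ∈ splitKernelCycles p A A' (n + 1)) {u : SingularChain (n + 1) Y}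
    (hu : u ∈ supportedIn (n + 1) (A ∩ A')) (hbu : boundary n u = boundary n c.1) :
    c ∈ splitBoundaries Y (n + 1) := by
  rw [supportedIn_inter] at hu
  have hcycle₁ : boundary n (c.1 - u) = 0 := by rw [map_sub, hbu, sub_self]
  have hcycle₂ : boundary n (c.2 - u) = 0 := by
    rw [map_sub, hbu, boundary_eq_of_mem_splitKernelCycles hc, sub_self]
  have h₁ := hhA.sub_map_mem_boundaries hcycle₁ (Submodule.sub_mem _ hc.1.1 hu.1)
  have h₂ := hhA'.sub_map_mem_boundaries hcycle₂ (Submodule.sub_mem _ hc.1.2 hu.2)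
  have h₃ : map (n + 1) (s.comp p) (c.1 - c.2) ∈ boundaries Y (n + 1) := by
    rw [← map_map]
    exact map_mem_boundaries s hc.2.2
  have hsum : c.1 - c.2 = c.1 - u - map (n + 1) (s.comp p) (c.1 - u) -
      (c.2 - u - map (n + 1) (s.comp p) (c.2 - u)) + map (n + 1) (s.comp p) (c.1 - c.2) := by
    simp only [map_sub]
    abel
  change c.1 - c.2 ∈ boundaries Y (n + 1)
  rw [hsum]
  exact Submodule.add_mem _ (Submodule.sub_mem _ h₁ h₂) h₃

lemma exists_mem_splitKernelCycles_boundary_eq {p : C(Y, X)} {s : C(X, Y)}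
    (hps : p.comp s = .id X) {A A' : Set Y} (hs : ∀ x, s x ∈ A ∩ A')
    (hhA : HomologousIn A (s.comp p)) (hhA' : HomologousIn A' (s.comp p)) {n : ℕ}
    {w : SingularChain n Y} (hw : w ∈ kernelCycles p n) (hwA : w ∈ supportedIn n (A ∩ A')) :
    ∃ c ∈ splitKernelCycles p A A' (n + 1), boundary n c.1 = w := by
  rw [supportedIn_inter] at hwA
  obtain ⟨a, ha, hba⟩ := hhA.exists_boundary_eq (fun x ↦ (hs x).1) hw hwA.1
  obtain ⟨b, hb, hbb⟩ := hhA'.exists_boundary_eq (fun x ↦ (hs x).2) hw hwA.2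
  let a' := a - map (n + 1) s (map (n + 1) p (a - b))
  have hba' : boundary n a' = w := by
    simp only [a', map_sub, boundary_map, hba, hbb, sub_self, sub_zero]
  have hpa' : map (n + 1) p (a' - b) = 0 := by
    simp only [a', map_sub, map_map n.succ p s, hps, map_id]
    abel
  refine ⟨(a', b), ⟨⟨Submodule.sub_mem _ ha (map_mem_supportedIn s ?_ _), hb⟩, ?_, ?_⟩, hba'⟩
  · exact range_subset_iff.2 fun x ↦ (hs x).1
  · change boundary n (a' - b) = 0
    rw [map_sub, hba', hbb, sub_self]
  · change map (n + 1) p (a' - b) ∈ boundaries X (n + 1)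
    rw [hpa']
    exact Submodule.zero_mem _

lemma subquotientRank_kernelCycles_inf_supportedIn (p : C(Y, X)) (A : Set Y) (n : ℕ) :
    subquotientRank (kernelCycles p n ⊓ supportedIn n A)
      ((supportedIn (n + 1) A).map (boundary n)) = kernelRank (p.comp (incl A)) n := by
  symm
  refine subquotientRank_eq_of_linearMap (map n (incl A))
    (fun c hc ↦ ⟨map_mem_kernelCycles rfl hc, map_incl_mem_supportedIn A c⟩)
    (fun c _ ↦ ⟨?_, ?_⟩) fun w hw ↦ ?_
  · rintro ⟨e, he, hce⟩
    obtain ⟨e, rfl⟩ := exists_map_incl_eq he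
    exact ⟨e, map_incl_injective A n ((boundary_map _ _ _).symm.trans hce)⟩
  · rintro ⟨e, rfl⟩
    exact ⟨map (n + 1) (incl A) e, map_incl_mem_supportedIn A e, boundary_map _ _ _⟩
  · obtain ⟨c, rfl⟩ := exists_map_incl_eq hw.2
    refine ⟨c, ⟨mem_cycles_of_map_incl hw.1.1, ?_⟩, by simp⟩
    rw [SetLike.mem_coe, Submodule.mem_comap, ← map_map]
    exact hw.1.2

lemma kernelRank_succ {p : C(Y, X)} {s : C(X, Y)} (hps : p.comp s = .id X) {A A' : Set Y}
    (hA : IsOpen A) (hA' : IsOpen A') (hAA' : A ∪ A' = univ) (hs : ∀ x, s x ∈ A ∩ A')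
    (hhA : HomologousIn A (s.comp p)) (hhA' : HomologousIn A' (s.comp p)) (n : ℕ) :
    kernelRank p (n + 1) = kernelRank (p.comp (incl (A ∩ A'))) n := by
  rw [← subquotientRank_splitKernelCycles p hA hA' hAA',
    ← subquotientRank_kernelCycles_inf_supportedIn]
  refine subquotientRank_eq_of_linearMap (boundary n ∘ₗ LinearMap.fst _ _ _)
    (fun c hc ↦ ⟨boundary_mem_kernelCycles p n _, boundary_fst_mem_supportedIn_inter hc⟩)
    (fun c hc ↦ ⟨?_, exists_boundary_eq_of_mem_splitBoundaries hA hA' hAA' hc.1.1 hc.1.2⟩)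
    fun w hw ↦ ?_
  · rintro ⟨u, hu, hbu⟩
    exact mem_splitBoundaries_of_boundary_eq hhA hhA' hc hu hbu
  · obtain ⟨c, hc, rfl⟩ := exists_mem_splitKernelCycles_boundary_eq hps hs hhA hhA' hw.1 hw.2
    exact ⟨c, hc, by simp⟩

lemma kernelRank_zero_eq_zero {p : C(Y, X)} {s : C(X, Y)} {A A' : Set Y} (hAA' : A ∪ A' = univ)
    (hhA : HomologousIn A (s.comp p)) (hhA' : HomologousIn A' (s.comp p)) :
    kernelRank p 0 = 0 := by
  refine subquotientRank_eq_zero fun z hz ↦ ?_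
  have htop : supportedIn 0 A ⊔ supportedIn 0 A' = ⊤ := by
    refine supportedIn_sup_eq_top fun σ ↦ ?_
    have hσ : range σ = {σ (stdSimplex.vertex 0)} :=
      range_eq_singleton_iff.2 fun t ↦
        congrArg σ (Subsingleton.elim (α := stdSimplex ℝ (Fin 1)) _ _)
    rw [hσ, singleton_subset_iff, singleton_subset_iff]
    exact hAA'.ge (mem_univ _)
  obtain ⟨a, ha, b, hb, rfl⟩ := Submodule.mem_sup.1 (htop ▸ Submodule.mem_top : z ∈ _)
  have hsp : map 0 (s.comp p) (a + b) ∈ boundaries Y 0 := by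
    rw [← map_map]
    exact map_mem_boundaries s hz.2
  have hsum : a + b =
      a - map 0 (s.comp p) a + (b - map 0 (s.comp p) b) + map 0 (s.comp p) (a + b) := by
    rw [map_add]
    abel
  rw [hsum]
  exact Submodule.add_mem _ (Submodule.add_mem _ (hhA.sub_map_mem_boundaries trivial ha)
    (hhA'.sub_map_mem_boundaries trivial hb)) hsp

end MayerVietoris

section Disjoint

variable {X Y : Type} [TopologicalSpace X] [TopologicalSpace Y]

lemma mem_cycles_of_add_mem_cycles {A A' : Set Y} (hdisj : Disjoint A A') {n : ℕ}
    {a b : SingularChain n Y} (ha : a ∈ supportedIn n A) (hb : b ∈ supportedIn n A')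
    (h : a + b ∈ cycles Y n) : a ∈ cycles Y n := by
  cases n with
  | zero => trivial
  | succ n =>
    refine Submodule.disjoint_def'.1 (disjoint_supportedIn hdisj n) _ (boundary_mem_supportedIn ha)
      _ (Submodule.neg_mem _ (boundary_mem_supportedIn hb)) ?_
    rw [eq_neg_iff_add_eq_zero, ← map_add]
    exact h

variable {p : C(Y, X)} {s s' : C(X, Y)} {A A' : Set Y}

lemma mem_boundaries_of_map_sub_map (hps : p.comp s = .id X)
    (htop : ∀ n, supportedIn n A ⊔ supportedIn n A' = ⊤) (hdisj : Disjoint A A')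
    (hs : ∀ x, s x ∈ A) (hs' : ∀ x, s' x ∈ A') {n : ℕ} {w : SingularChain n X}
    (hw : map n s w - map n s' w ∈ boundaries Y n) : w ∈ boundaries X n := by
  obtain ⟨y, hy⟩ := hw
  obtain ⟨a, ha, b, hb, rfl⟩ := Submodule.mem_sup.1 (htop (n + 1) ▸ Submodule.mem_top : y ∈ _)
  have hsw : map n s w - boundary n a = 0 := by
    refine Submodule.disjoint_def'.1 (disjoint_supportedIn hdisj n) _
      (Submodule.sub_mem _ (map_mem_supportedIn s (range_subset_iff.2 hs) w)
        (boundary_mem_supportedIn ha)) (map n s' w + boundary n b)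
      (Submodule.add_mem _ (map_mem_supportedIn s' (range_subset_iff.2 hs') w)
        (boundary_mem_supportedIn hb)) ?_
    rw [map_add] at hy
    rw [sub_eq_iff_eq_add, add_assoc, add_comm (boundary n b), hy]
    abel
  refine ⟨map (n + 1) p a, ?_⟩
  rw [boundary_map, ← sub_eq_zero.1 hsw, map_map, hps, map_id]

lemma map_sub_map_sub_mem_boundaries (hdisj : Disjoint A A')
    (hhA : HomologousIn A (s.comp p)) (hhA' : HomologousIn A' (s'.comp p)) {n : ℕ}
    {a b : SingularChain n Y} (ha : a ∈ supportedIn n A) (hb : b ∈ supportedIn n A')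
    (hab : a + b ∈ kernelCycles p n) :
    map n s (map n p a) - map n s' (map n p a) - (a + b) ∈ boundaries Y n := by
  have h₁ := hhA.sub_map_mem_boundaries (mem_cycles_of_add_mem_cycles hdisj ha hb hab.1) ha
  have h₂ := hhA'.sub_map_mem_boundaries
    (mem_cycles_of_add_mem_cycles hdisj.symm hb ha (add_comm a b ▸ hab.1)) hb
  have h₃ : map n s' (map n p (a + b)) ∈ boundaries Y n := map_mem_boundaries s' hab.2
  have hsum : map n s (map n p a) - map n s' (map n p a) - (a + b) =
      -(a - map n (s.comp p) a) - (b - map n (s'.comp p) b) - map n s' (map n p (a + b)) := by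
    simp only [map_add, map_map]
    abel
  rw [hsum]
  exact Submodule.sub_mem _ (Submodule.sub_mem _ (Submodule.neg_mem _ h₁) h₂) h₃

lemma kernelRank_eq_of_disjoint (hps : p.comp s = .id X) (hps' : p.comp s' = .id X)
    (hA : IsOpen A) (hA' : IsOpen A') (hAA' : A ∪ A' = univ) (hdisj : Disjoint A A')
    (hs : ∀ x, s x ∈ A) (hs' : ∀ x, s' x ∈ A') (hhA : HomologousIn A (s.comp p))
    (hhA' : HomologousIn A' (s'.comp p)) (n : ℕ) :
    kernelRank p n = subquotientRank (cycles X n) (boundaries X n) := by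
  have htop (n : ℕ) : supportedIn n A ⊔ supportedIn n A' = ⊤ := supportedIn_sup_eq_top fun σ ↦
    (isPreconnected_range σ.continuous).subset_or_subset hA hA' hdisj (hAA' ▸ subset_univ _)
  symm
  refine subquotientRank_eq_of_linearMap (map n s - map n s') (fun w hw ↦ ⟨?_, ?_⟩)
    (fun w _ ↦ ⟨mem_boundaries_of_map_sub_map hps htop hdisj hs hs', fun h ↦ ?_⟩)
    fun z hz ↦ ?_
  · exact Submodule.sub_mem _ (map_mem_cycles s hw) (map_mem_cycles s' hw)
  · rw [SetLike.mem_coe, Submodule.mem_comap, LinearMap.sub_apply, map_sub, map_map, map_map, hps,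
      hps', sub_self]
    exact Submodule.zero_mem _
  · exact Submodule.sub_mem _ (map_mem_boundaries s h) (map_mem_boundaries s' h)
  · obtain ⟨a, ha, b, hb, rfl⟩ := Submodule.mem_sup.1 (htop n ▸ Submodule.mem_top : z ∈ _)
    have ha_cycle := mem_cycles_of_add_mem_cycles hdisj ha hb hz.1
    exact ⟨map n p a, map_mem_cycles p ha_cycle,
      map_sub_map_sub_mem_boundaries hdisj hhA hhA' ha hb hz⟩

end Disjoint

end SingularChain

/-! ## Products with spheres -/

/-- A vector space without its origin. -/
abbrev Punctured (E : Type*) [Zero E] : Type _ := {v : E // v ≠ 0}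

/-- The section of the first projection with constant second component. -/
def constSection (X : Type*) {F : Type*} [TopologicalSpace X] [TopologicalSpace F] (v : F) :
    C(X, X × F) := (ContinuousMap.id X).prodMk (.const X v)

/-- The product of `X` with `E × ℝ` minus a closed vertical ray, the lower one for `ε > 0` and the
upper one for `ε < 0`. -/
def slitSpace (X E : Type*) [Zero E] (ε : ℝ) : Set (X × Punctured (E × ℝ)) :=
  {y | y.2.1.1 ≠ 0 ∨ 0 < ε * y.2.1.2}

lemma slitSpace_union (X E : Type*) [Zero E] : slitSpace X E 1 ∪ slitSpace X E (-1) = univ := by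
  rw [eq_univ_iff_forall]
  rintro ⟨x, ⟨⟨v, t⟩, h⟩⟩
  by_cases hv : v = 0
  · have ht : t ≠ 0 := fun ht ↦ h (by rw [hv, ht]; rfl)
    rcases ht.lt_or_gt with h | h
    · exact Or.inr (Or.inr (by simpa using h))
    · exact Or.inl (Or.inr (by simpa using h))
  · exact Or.inl (Or.inl hv)

lemma slitSpace_inter (X E : Type*) [Zero E] :
    slitSpace X E 1 ∩ slitSpace X E (-1) = {y | y.2.1.1 ≠ 0} := by
  ext y
  constructor
  · rintro ⟨h | h, h' | h'⟩
    · exact h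
    · exact h
    · exact h'
    · linarith
  · intro h
    exact ⟨Or.inl h, Or.inl h⟩

lemma ne_zero_of_slit {E : Type*} [Zero E] {ε : ℝ} {v : E} {t : ℝ} (h : v ≠ 0 ∨ 0 < ε * t) :
    (v, t) ≠ 0 := by
  intro h₀
  obtain ⟨rfl, rfl⟩ := Prod.mk.inj h₀
  simp at h

section Punctured

variable (X E : Type*) [TopologicalSpace X] [NormedAddCommGroup E]

lemma isOpen_slitSpace (ε : ℝ) : IsOpen (slitSpace X E ε) := by
  refine IsOpen.union ?_ ?_
  · exact isOpen_ne.preimage (continuous_fst.comp (continuous_subtype_val.comp continuous_snd))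
  · exact isOpen_lt continuous_const
      (by fun_prop : Continuous fun y : X × Punctured (E × ℝ) ↦ ε * y.2.1.2)

variable {E} [NormedSpace ℝ E]

lemma slit_segment {ε τ : ℝ} (hε : ε * ε = 1) (h₀ : 0 ≤ τ) (h₁ : τ ≤ 1) {v : E} {t : ℝ}
    (h : v ≠ 0 ∨ 0 < ε * t) : (1 - τ) • v ≠ 0 ∨ 0 < ε * ((1 - τ) * t + τ * ε) := by
  refine or_iff_not_imp_left.2 fun hv ↦ ?_
  have height_eq : ε * ((1 - τ) * t + τ * ε) = (1 - τ) * (ε * t) + τ := by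
    linear_combination τ * hε
  rw [height_eq]
  rcases smul_eq_zero.1 (not_not.1 hv) with hτ | rfl
  · rw [hτ, zero_mul, zero_add, ← sub_eq_zero.1 hτ]
    exact one_pos
  · have ht : 0 < ε * t := h.resolve_left (not_not.2 rfl)
    rcases h₀.eq_or_lt with rfl | h₀
    · simpa using ht
    · exact add_pos_of_nonneg_of_pos (mul_nonneg (sub_nonneg.2 h₁) ht.le) h₀

lemma id_homotopic_slitSpace_pole {ε : ℝ} (hε : ε * ε = 1) :
    (ContinuousMap.id (slitSpace X E ε)).Homotopic
      ⟨fun y ↦ ⟨(y.1.1, ⟨((0 : E), ε), ne_zero_of_slit (ε := ε) (Or.inr (by simp [hε]))⟩),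
        Or.inr (by simp [hε])⟩, by fun_prop⟩ := by
  refine ⟨⟨⟨fun q ↦ ⟨(q.2.1.1, ⟨((1 - (q.1 : ℝ)) • q.2.1.2.1.1,
      (1 - (q.1 : ℝ)) * q.2.1.2.1.2 + (q.1 : ℝ) * ε),
    ne_zero_of_slit (slit_segment hε q.1.2.1 q.1.2.2 q.2.2)⟩),
    slit_segment hε q.1.2.1 q.1.2.2 q.2.2⟩, by fun_prop⟩, fun y ↦ ?_, fun y ↦ ?_⟩⟩
  · simp
  · simp

lemma id_homotopic_slitSpace_const {ε : ℝ} (hε : ε * ε = 1) (v : Punctured (E × ℝ))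
    (hv : v.1.1 ≠ 0 ∨ 0 < ε * v.1.2) :
    (ContinuousMap.id (slitSpace X E ε)).Homotopic
      ⟨fun y ↦ ⟨(y.1.1, v), hv⟩, by fun_prop⟩ := by
  have h := id_homotopic_slitSpace_pole X (E := E) hε
  exact h.trans (h.comp (.refl
    (⟨fun y ↦ ⟨(y.1.1, v), hv⟩, by fun_prop⟩ : C(slitSpace X E ε, slitSpace X E ε)))).symm

end Punctured

section PuncturedKernel

open SingularChain

variable (X : Type) [TopologicalSpace X] {E F : Type} [NormedAddCommGroup E]
  [NormedAddCommGroup F]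

/-- Forgetting the last coordinate, as a homotopy equivalence. -/
def neZeroHomotopyEquiv :
    {y : X × Punctured (E × ℝ) | y.2.1.1 ≠ 0} ≃ₕ X × Punctured E where
  toFun := ⟨fun y ↦ (y.1.1, ⟨y.1.2.1.1, y.2⟩), by fun_prop⟩
  invFun :=
    ⟨fun y ↦ ⟨(y.1, ⟨(y.2.1, 0), fun h ↦ y.2.2 (congrArg Prod.fst h)⟩), y.2.2⟩, by fun_prop⟩
  left_inv := by
    refine ⟨⟨⟨fun q ↦ ⟨(q.2.1.1, ⟨(q.2.1.2.1.1, (q.1 : ℝ) * q.2.1.2.1.2),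
      fun h ↦ q.2.2 (congrArg Prod.fst h)⟩), q.2.2⟩, by fun_prop⟩, fun y ↦ ?_, fun y ↦ ?_⟩⟩
    · simp
    · simp
  right_inv := .refl _

lemma kernelRank_fst_punctured_ne_zero (n : ℕ) :
    kernelRank ((ContinuousMap.fst : C(X × Punctured (E × ℝ), X)).comp
      (incl {y | y.2.1.1 ≠ 0})) n = kernelRank (.fst : C(X × Punctured E, X)) n :=
  kernelRank_eq_of_homotopyEquiv (neZeroHomotopyEquiv X) (by rfl) (by rfl) n

variable [NormedSpace ℝ E] [NormedSpace ℝ F]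

lemma homologousIn_slitSpace {ε : ℝ} (hε : ε * ε = 1) (v : Punctured (E × ℝ))
    (hv : v.1.1 ≠ 0 ∨ 0 < ε * v.1.2) :
    HomologousIn (slitSpace X E ε) ((constSection X v).comp .fst) :=
  homologousIn_of_homotopic rfl (id_homotopic_slitSpace_const X hε v hv)

lemma exists_punctured_fst_ne_zero (E : Type*) [AddGroup E] [Nontrivial E] :
    ∃ v : Punctured (E × ℝ), v.1.1 ≠ 0 :=
  let ⟨v, hv⟩ := exists_ne (0 : E)
  ⟨⟨(v, 0), fun h ↦ hv (congrArg Prod.fst h)⟩, hv⟩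

lemma kernelRank_fst_punctured_prod_succ [Nontrivial E] (n : ℕ) :
    kernelRank (.fst : C(X × Punctured (E × ℝ), X)) (n + 1) =
      kernelRank (.fst : C(X × Punctured E, X)) n := by
  obtain ⟨v, hv⟩ := exists_punctured_fst_ne_zero E
  rw [kernelRank_succ (s := constSection X v) rfl (isOpen_slitSpace X E 1)
    (isOpen_slitSpace X E (-1)) (slitSpace_union X E) (fun x ↦ ⟨Or.inl hv, Or.inl hv⟩)
    (homologousIn_slitSpace X (by norm_num) v (Or.inl hv))
    (homologousIn_slitSpace X (by norm_num) v (Or.inl hv)), slitSpace_inter,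
    kernelRank_fst_punctured_ne_zero]

lemma kernelRank_fst_punctured_prod_zero [Nontrivial E] :
    kernelRank (.fst : C(X × Punctured (E × ℝ), X)) 0 = 0 := by
  obtain ⟨v, hv⟩ := exists_punctured_fst_ne_zero E
  exact kernelRank_zero_eq_zero (slitSpace_union X E)
    (homologousIn_slitSpace X (by norm_num) v (Or.inl hv))
    (homologousIn_slitSpace X (by norm_num) v (Or.inl hv))

/-- The homeomorphism between products with punctured spaces induced by a linear one. -/
def puncturedHomeomorph (e : E ≃L[ℝ] F) : X × Punctured E ≃ₜ X × Punctured F :=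
  (Homeomorph.refl X).prodCongr (e.toHomeomorph.subtype fun v ↦ by simp)

lemma kernelRank_fst_punctured_congr (e : E ≃L[ℝ] F) (n : ℕ) :
    kernelRank (.fst : C(X × Punctured E, X)) n =
      kernelRank (.fst : C(X × Punctured F, X)) n :=
  kernelRank_eq_of_homotopyEquiv (puncturedHomeomorph X e).toHomotopyEquiv
    (by rfl) (by rfl) n

lemma kernelRank_fst_punctured_line (n : ℕ) :
    kernelRank (.fst : C(X × Punctured ((Fin 0 → ℝ) × ℝ), X)) n =
      subquotientRank (cycles X n) (boundaries X n) := by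
  let v (ε : ℝ) (h : ε ≠ 0) : Punctured ((Fin 0 → ℝ) × ℝ) :=
    ⟨(0, ε), fun h' ↦ h (congrArg Prod.snd h')⟩
  have hdisj : Disjoint (slitSpace X (Fin 0 → ℝ) 1) (slitSpace X (Fin 0 → ℝ) (-1)) := by
    rw [disjoint_iff_inter_eq_empty, slitSpace_inter]
    exact eq_empty_of_forall_notMem fun y hy ↦ hy (Subsingleton.elim _ _)
  exact kernelRank_eq_of_disjoint (s := constSection X (v 1 (by norm_num)))
    (s' := constSection X (v (-1) (by norm_num))) rfl rfl (isOpen_slitSpace X _ 1)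
    (isOpen_slitSpace X _ (-1)) (slitSpace_union X _) hdisj
    (fun x ↦ Or.inr (by simp [constSection, v])) (fun x ↦ Or.inr (by simp [constSection, v]))
    (homologousIn_slitSpace X (by norm_num) _ (Or.inr (by simp [v])))
    (homologousIn_slitSpace X (by norm_num) _ (Or.inr (by simp [v]))) n

lemma kernelRank_fst_punctured [FiniteDimensional ℝ E] {m : ℕ} (hm : Module.finrank ℝ E = m + 1)
    (n : ℕ) : kernelRank (.fst : C(X × Punctured E, X)) n =
      if n < m then 0 else subquotientRank (cycles X (n - m)) (boundaries X (n - m)) := by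
  have model (m n : ℕ) : kernelRank (.fst : C(X × Punctured ((Fin m → ℝ) × ℝ), X)) n =
      if n < m then 0 else subquotientRank (cycles X (n - m)) (boundaries X (n - m)) := by
    induction m generalizing n with
    | zero => simpa using kernelRank_fst_punctured_line X n
    | succ m ih =>
      cases n with
      | zero => simpa using kernelRank_fst_punctured_prod_zero X
      | succ n =>
        have e : ((Fin m → ℝ) × ℝ) ≃L[ℝ] (Fin (m + 1) → ℝ) := .ofFinrankEq (by simp)
        rw [kernelRank_fst_punctured_prod_succ, ← kernelRank_fst_punctured_congr X e, ih,
          Nat.add_sub_add_right]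
        simp only [Nat.add_lt_add_iff_right]
  rw [← model m n]
  exact kernelRank_fst_punctured_congr X (ContinuousLinearEquiv.ofFinrankEq (by simp [hm])) n

/-- The inclusion of the unit sphere in the punctured space, as a homotopy equivalence. -/
def sphereHomotopyEquiv : X × sphere (0 : E) 1 ≃ₕ X × Punctured E where
  toFun := ⟨fun y ↦ (y.1, ⟨y.2.1, ne_zero_of_mem_unit_sphere y.2⟩), by fun_prop⟩
  invFun :=
    ⟨fun y ↦ (y.1, ⟨‖y.2.1‖⁻¹ • y.2.1, by
      rw [mem_sphere_zero_iff_norm, norm_smul, norm_inv, norm_norm,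
        inv_mul_cancel₀ (norm_ne_zero_iff.2 y.2.2)]⟩), by
      have norm_ne_zero (y : X × Punctured E) : ‖y.2.1‖ ≠ 0 := norm_ne_zero_iff.2 y.2.2
      fun_prop (disch := assumption)⟩
  left_inv := by
    refine ⟨⟨.snd, fun y ↦ Prod.ext rfl (Subtype.ext ?_), fun y ↦ rfl⟩⟩
    simp [norm_eq_of_mem_sphere y.2]
  right_inv := by
    have norm_ne_zero (q : unitInterval × (X × Punctured E)) : ‖q.2.2.1‖ ≠ 0 :=
      norm_ne_zero_iff.2 q.2.2.2
    have scale_pos (q : unitInterval × (X × Punctured E)) :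
        0 < (1 - (q.1 : ℝ)) * ‖q.2.2.1‖⁻¹ + (q.1 : ℝ) := by
      have h₀ : 0 < ‖q.2.2.1‖⁻¹ := inv_pos.2 (norm_pos_iff.2 q.2.2.2)
      rcases q.1.2.2.eq_or_lt with h | h
      · simp [h]
      · exact add_pos_of_pos_of_nonneg (mul_pos (sub_pos.2 h) h₀) q.1.2.1
    refine ⟨⟨⟨fun q ↦ (q.2.1, ⟨((1 - (q.1 : ℝ)) * ‖q.2.2.1‖⁻¹ + (q.1 : ℝ)) • q.2.2.1,
      smul_ne_zero (scale_pos q).ne' q.2.2.2⟩), by fun_prop (disch := assumption)⟩,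
      fun y ↦ ?_, fun y ↦ ?_⟩⟩
    · simp
    · simp

lemma kernelRank_fst_sphere (n : ℕ) : kernelRank (.fst : C(X × sphere (0 : E) 1, X)) n =
    kernelRank (.fst : C(X × Punctured E, X)) n :=
  kernelRank_eq_of_homotopyEquiv (sphereHomotopyEquiv X) (by rfl) (by rfl) n

end PuncturedKernel

/-! ## Betti numbers -/

lemma betti_eq_subquotientRank (k : ℕ) (X : Type) [TopologicalSpace X] :
    betti k X = Cardinal.toENat
      (subquotientRank (SingularChain.cycles X k) (SingularChain.boundaries X k)) := by
  rw [betti, rank_H]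

lemma bettiSum_congr {X Y : Type} [TopologicalSpace X] [TopologicalSpace Y] (e : X ≃ₜ Y) :
    bettiSum X = bettiSum Y := by
  have betti_congr (k : ℕ) : betti k X = betti k Y := by
    let homologyIso : H k X ≅ H k Y := ((AlgebraicTopology.singularHomologyFunctor
      (ModuleCat.{0} (ZMod 2)) k).obj (ModuleCat.of (ZMod 2) (ZMod 2))).mapIso (TopCat.isoOfHomeo e)
    rw [betti, betti, homologyIso.toLinearEquiv.rank_eq]
  simp only [bettiSum, betti_congr]

lemma sum_range_ite_lt_zero {M : Type*} [AddCommMonoid M] (f : ℕ → M) (m n : ℕ) :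
    ∑ k ∈ Finset.range n, (if k < m then 0 else f (k - m)) = ∑ k ∈ Finset.range (n - m), f k := by
  rcases le_total m n with h | h
  · obtain ⟨l, rfl⟩ := Nat.exists_eq_add_of_le h
    rw [Finset.sum_range_add, Finset.sum_eq_zero fun k hk ↦ if_pos (Finset.mem_range.1 hk),
      zero_add, Nat.add_sub_cancel_left]
    exact Finset.sum_congr rfl fun k _ ↦ by simp
  · rw [Nat.sub_eq_zero_of_le h, Finset.range_zero, Finset.sum_empty]
    exact Finset.sum_eq_zero fun k hk ↦ if_pos ((Finset.mem_range.1 hk).trans_le h)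

lemma iSup_sum_range_add_shift (f : ℕ → ℕ∞) (m : ℕ) :
    ⨆ n, ∑ k ∈ Finset.range n, (f k + if k < m then 0 else f (k - m)) =
      2 * ⨆ n, ∑ k ∈ Finset.range n, f k := by
  have hmono : Monotone fun n ↦ ∑ k ∈ Finset.range n, f k :=
    fun a b h ↦ Finset.sum_le_sum_of_subset (Finset.range_mono h)
  simp only [Finset.sum_add_distrib, sum_range_ite_lt_zero]
  rw [two_mul]
  refine le_antisymm (iSup_le fun n ↦ ?_) ?_
  · exact add_le_add (le_iSup (fun n ↦ ∑ k ∈ Finset.range n, f k) n)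
      (le_iSup (fun n ↦ ∑ k ∈ Finset.range n, f k) (n - m))
  · rw [ENat.iSup_add_iSup_of_monotone hmono hmono]
    refine iSup_mono' fun n ↦ ⟨n + m, add_le_add (hmono (Nat.le_add_right n m)) ?_⟩
    rw [Nat.add_sub_cancel]

section Sphere

variable {E : Type} [NormedAddCommGroup E] [NormedSpace ℝ E] [FiniteDimensional ℝ E] {m : ℕ}

lemma betti_prod_sphere (X : Type) [TopologicalSpace X] (hm : Module.finrank ℝ E = m + 1) (k : ℕ) :
    betti k (X × sphere (0 : E) 1) = betti k X + if k < m then 0 else betti (k - m) X := by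
  have : Nontrivial E := Module.nontrivial_of_finrank_pos (R := ℝ) (hm ▸ m.succ_pos)
  obtain ⟨v, hv⟩ : (sphere (0 : E) 1).Nonempty := NormedSpace.sphere_nonempty.2 zero_le_one
  simp only [betti_eq_subquotientRank]
  rw [SingularChain.subquotientRank_cycles_eq_add_kernelRank .fst (constSection X ⟨v, hv⟩) rfl,
    kernelRank_fst_sphere, kernelRank_fst_punctured X hm, map_add, apply_ite Cardinal.toENat,
    map_zero]

lemma bettiSum_prod_sphere (X : Type) [TopologicalSpace X] (hm : Module.finrank ℝ E = m + 1) :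
    bettiSum (X × sphere (0 : E) 1) = 2 * bettiSum X := by
  simp only [bettiSum, betti_prod_sphere X hm]
  exact iSup_sum_range_add_shift _ m

lemma betti_zero_punit : betti 0 PUnit = 1 := by
  have i := AlgebraicTopology.singularHomologyFunctorZeroOfTotallyDisconnectedSpace
    (ModuleCat.{0} (ZMod 2)) (ModuleCat.of (ZMod 2) (ZMod 2)) (TopCat.of PUnit)
  have j := CategoryTheory.Limits.coproductUniqueIso
    (fun _ : (TopCat.of PUnit : TopCat.{0}) ↦ ModuleCat.of (ZMod 2) (ZMod 2))
  rw [betti, (i ≪≫ j).toLinearEquiv.rank_eq]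
  simp

lemma betti_succ_punit (k : ℕ) : betti (k + 1) PUnit = 0 := by
  have := ModuleCat.subsingleton_of_isZero
    (AlgebraicTopology.isZero_singularHomologyFunctor_of_totallyDisconnectedSpace
      (ModuleCat.{0} (ZMod 2)) (k + 1) (ModuleCat.of (ZMod 2) (ZMod 2)) (TopCat.of PUnit)
      (Nat.succ_ne_zero k))
  rw [betti, rank_subsingleton' _ _, map_zero]

lemma bettiSum_punit : bettiSum PUnit = 1 := by
  refine le_antisymm (iSup_le fun n ↦ ?_) (le_iSup_of_le 1 ?_)
  · cases n with
    | zero => simp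
    | succ n => simp [Finset.sum_range_succ', betti_zero_punit, betti_succ_punit]
  · simp [betti_zero_punit]

lemma bettiSum_sphere (hm : Module.finrank ℝ E = m + 1) : bettiSum (sphere (0 : E) 1) = 2 := by
  rw [← bettiSum_congr (Homeomorph.punitProd (sphere (0 : E) 1)), bettiSum_prod_sphere _ hm,
    bettiSum_punit, mul_one]

end Sphere

open Filter Topology

/-! ## Critical points in local coordinates -/

lemma exists_contDiffAt_leftInverse {𝕜 P Q : Type*} [RCLike 𝕜] [NormedAddCommGroup P]
    [NormedSpace 𝕜 P] [CompleteSpace P] [NormedAddCommGroup Q] [NormedSpace 𝕜 Q] {f : P → Q} {u : P}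
    {n : WithTop ℕ∞} (hf : ContDiffAt 𝕜 n f u) (hn : n ≠ 0) (h : (fderiv 𝕜 f u).HasLeftInverse) :
    ∃ ψ : Q → P, ContDiffAt 𝕜 n ψ (f u) ∧ ∀ᶠ y in 𝓝 u, ψ (f y) = y := by
  obtain ⟨L, hL⟩ := h
  have hLf : ContDiffAt 𝕜 n (L ∘ f) u := L.contDiff.contDiffAt.comp u hf
  have hLf' : HasFDerivAt (L ∘ f) (ContinuousLinearEquiv.refl 𝕜 P : P →L[𝕜] P) u :=
    (L.hasFDerivAt.comp u (hf.differentiableAt hn).hasFDerivAt).congr_fderiv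
      (ContinuousLinearMap.ext hL)
  exact ⟨hLf.localInverse hLf' hn ∘ L,
    (hLf.to_localInverse hLf' hn).comp (f u) L.contDiff.contDiffAt,
    (hLf.hasStrictFDerivAt' hLf' hn).eventually_left_inverse⟩

section Hessian

variable {P Q : Type*} [NormedAddCommGroup P] [NormedSpace ℝ P] [NormedAddCommGroup Q]
  [NormedSpace ℝ Q]

/-- The Hessian of `F` at `u` is nondegenerate. -/
def NondegAt (F : P → ℝ) (u : P) : Prop :=
  ∀ v, (∀ w, fderiv ℝ (fderiv ℝ F) u v w = 0) → v = 0

lemma fderiv_fderiv_comp_of_fderiv_eq_zero {F : Q → ℝ} {ψ : P → Q} {u : P}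
    (hF : ContDiffAt ℝ 2 F (ψ u)) (hψ : ContDiffAt ℝ 2 ψ u) (h₀ : fderiv ℝ F (ψ u) = 0) (v w : P) :
    fderiv ℝ (fderiv ℝ (F ∘ ψ)) u v w =
      fderiv ℝ (fderiv ℝ F) (ψ u) (fderiv ℝ ψ u v) (fderiv ℝ ψ u w) := by
  have chain_rule : fderiv ℝ (F ∘ ψ) =ᶠ[𝓝 u] fun y ↦ (fderiv ℝ F (ψ y)).comp (fderiv ℝ ψ y) := by
    filter_upwards [hψ.continuousAt.eventually (hF.eventually (by simp)),
      hψ.eventually (by simp)] with y hy hy'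
    exact fderiv_comp y (hy.differentiableAt (by simp)) (hy'.differentiableAt (by simp))
  have hF₁ : ContDiffAt ℝ 1 (fderiv ℝ F) (ψ u) := hF.fderiv_right (by norm_num)
  have hψ₁ : ContDiffAt ℝ 1 (fderiv ℝ ψ) u := hψ.fderiv_right (by norm_num)
  have hF' : HasFDerivAt (fun y ↦ fderiv ℝ F (ψ y))
      ((fderiv ℝ (fderiv ℝ F) (ψ u)).comp (fderiv ℝ ψ u)) u :=
    (hF₁.differentiableAt (by simp)).hasFDerivAt.comp u
      (hψ.differentiableAt (by simp)).hasFDerivAt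
  have hψ' : HasFDerivAt (fderiv ℝ ψ) (fderiv ℝ (fderiv ℝ ψ) u) u :=
    (hψ₁.differentiableAt (by simp)).hasFDerivAt
  rw [chain_rule.fderiv_eq, (hF'.clm_comp hψ').fderiv]
  simp [h₀]

lemma fderiv_fderiv_real_comp_of_fderiv_eq_zero {F : P → ℝ} {φ : ℝ → ℝ} {u : P}
    (hF : ContDiffAt ℝ 2 F u) (hφ : ContDiffAt ℝ 2 φ (F u)) (h₀ : fderiv ℝ F u = 0) (v w : P) :
    fderiv ℝ (fderiv ℝ (φ ∘ F)) u v w = deriv φ (F u) * fderiv ℝ (fderiv ℝ F) u v w := by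
  have chain_rule : fderiv ℝ (φ ∘ F) =ᶠ[𝓝 u] fun y ↦ deriv φ (F y) • fderiv ℝ F y := by
    filter_upwards [hF.continuousAt.eventually (hφ.eventually (by simp)),
      hF.eventually (by simp)] with y hy hy'
    exact ((hy.differentiableAt (by simp)).hasDerivAt.comp_hasFDerivAt y
      (hy'.differentiableAt (by simp)).hasFDerivAt).fderiv
  have hF₁ : ContDiffAt ℝ 1 (fderiv ℝ F) u := hF.fderiv_right (by norm_num)
  have hφ₁ : ContDiffAt ℝ 1 (deriv φ) (F u) :=
    (hφ.fderiv_right (m := 1) (by norm_num)).clm_apply contDiffAt_const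
  have hφ' : HasFDerivAt (fun y ↦ deriv φ (F y)) (deriv (deriv φ) (F u) • fderiv ℝ F u) u :=
    (hφ₁.differentiableAt (by simp)).hasDerivAt.comp_hasFDerivAt u
      (hF.differentiableAt (by simp)).hasFDerivAt
  have hF' : HasFDerivAt (fderiv ℝ F) (fderiv ℝ (fderiv ℝ F) u) u :=
    (hF₁.differentiableAt (by simp)).hasFDerivAt
  rw [chain_rule.fderiv_eq, (hφ'.fun_smul hF').fderiv]
  simp [h₀]

lemma nondegAt_real_comp_iff {F : P → ℝ} {φ : ℝ → ℝ} {u : P} (hF : ContDiffAt ℝ 2 F u)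
    (hφ : ContDiffAt ℝ 2 φ (F u)) (h₀ : fderiv ℝ F u = 0) (hφ' : deriv φ (F u) ≠ 0) :
    NondegAt (φ ∘ F) u ↔ NondegAt F u := by
  simp only [NondegAt, fderiv_fderiv_real_comp_of_fderiv_eq_zero hF hφ h₀, mul_eq_zero, hφ',
    false_or]

lemma NondegAt.eventually_fderiv_ne_zero [FiniteDimensional ℝ P] {F : P → ℝ} {u : P}
    (h : NondegAt F u) (hF : ContDiffAt ℝ 2 F u) : ∀ᶠ y in 𝓝[≠] u, fderiv ℝ F y ≠ 0 := by
  have hF₁ : ContDiffAt ℝ 1 (fderiv ℝ F) u := hF.fderiv_right (by norm_num)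
  have hker : (fderiv ℝ (fderiv ℝ F) u).ker = ⊥ :=
    LinearMap.ker_eq_bot'.2 fun v hv ↦ h v fun w ↦ DFunLike.congr_fun hv w
  obtain ⟨C, -, hC⟩ := LinearMap.exists_antilipschitzWith _ hker
  exact (hF₁.differentiableAt (by simp)).hasFDerivAt.eventually_ne ⟨C, hC⟩

end Hessian

section LocalParam

variable {E : Type} [NormedAddCommGroup E] [InnerProductSpace ℝ E] {d : ℕ} {M : Set E}
  {U U' : Set (EuclideanSpace ℝ (Fin d))} {c c' : EuclideanSpace ℝ (Fin d) → E}
  {u u' : EuclideanSpace ℝ (Fin d)}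

lemma IsLocalParam.contDiffAt (h : IsLocalParam d M U c) (hu : u ∈ U) : ContDiffAt ℝ ∞ c u :=
  h.contDiffOn.contDiffAt (h.isOpen.mem_nhds hu)

lemma IsLocalParam.mem (h : IsLocalParam d M U c) (hu : u ∈ U) : c u ∈ M :=
  h.isOpenEmbedding.choose hu

lemma IsLocalParam.differentiableAt (h : IsLocalParam d M U c) (hu : u ∈ U) :
    DifferentiableAt ℝ c u :=
  (h.contDiffAt hu).differentiableAt (by simp)

lemma IsLocalParam.map_nhds (h : IsLocalParam d M U c) (hu : u ∈ U) :
    map c (𝓝 u) = 𝓝[M] (c u) := by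
  obtain ⟨hm, he⟩ := h.isOpenEmbedding
  calc map c (𝓝 u) = map Subtype.val (map (hm.restrict c U M) (𝓝 ⟨u, hu⟩)) := by
        rw [← h.isOpen.nhdsWithin_eq hu, ← map_nhds_subtype_val (⟨u, hu⟩ : U), map_map, map_map]
        rfl
    _ = 𝓝[M] (c u) := by
        rw [he.map_nhds_eq]
        exact map_nhds_subtype_val ⟨c u, hm hu⟩

lemma hasLeftInverse_of_injective {P : Type*} [NormedAddCommGroup P] [NormedSpace ℝ P]
    [FiniteDimensional ℝ P] {f : P →L[ℝ] E} (hf : Function.Injective f) : f.HasLeftInverse := by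
  let e := LinearEquiv.ofInjective f.toLinearMap hf
  refine ⟨e.symm.toLinearMap.toContinuousLinearMap.comp f.range.orthogonalProjectionOnto,
    fun x ↦ ?_⟩
  have hx : f.range.orthogonalProjectionOnto (f x) = e x :=
    Submodule.orthogonalProjectionOnto_mem_subspace_eq_self (e x)
  rw [ContinuousLinearMap.comp_apply, hx]
  exact e.symm_apply_apply x

lemma IsLocalParam.exists_transition (h : IsLocalParam d M U c) (h' : IsLocalParam d M U' c')
    (hu : u ∈ U) (hu' : u' ∈ U') (heq : c u = c' u') :
    ∃ φ : EuclideanSpace ℝ (Fin d) → EuclideanSpace ℝ (Fin d), φ u = u' ∧ ContDiffAt ℝ ∞ φ u ∧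
      c =ᶠ[𝓝 u] c' ∘ φ ∧ Function.Injective (fderiv ℝ φ u) := by
  obtain ⟨ψ, hψ, hψc'⟩ := exists_contDiffAt_leftInverse (h'.contDiffAt hu') (by simp)
    (hasLeftInverse_of_injective (h'.immersion u' hu'))
  have hφu : ψ (c u) = u' := by rw [heq, hψc'.self_of_nhds]
  have hφ : ContDiffAt ℝ ∞ (ψ ∘ c) u := ContDiffAt.comp u (heq ▸ hψ) (h.contDiffAt hu)
  have hcφ : c =ᶠ[𝓝 u] c' ∘ ψ ∘ c := by
    have c'_ψ_eq : ∀ᶠ x in 𝓝[M] (c' u'), x = c' (ψ x) := by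
      rw [← h'.map_nhds hu', eventually_map]
      filter_upwards [hψc'] with y hy
      rw [hy]
    rwa [← heq, ← h.map_nhds hu, eventually_map] at c'_ψ_eq
  refine ⟨ψ ∘ c, hφu, hφ, hcφ, ?_⟩
  have hfderiv : fderiv ℝ c u = (fderiv ℝ c' u').comp (fderiv ℝ (ψ ∘ c) u) := by
    have hc' : DifferentiableAt ℝ c' ((ψ ∘ c) u) := by
      rw [Function.comp_apply, hφu]
      exact h'.differentiableAt hu'
    rw [hcφ.fderiv_eq, fderiv_comp u hc' (hφ.differentiableAt (by simp)), Function.comp_apply, hφu]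
  have hinj := h.immersion u hu
  rw [hfderiv, ContinuousLinearMap.coe_comp] at hinj
  exact hinj.of_comp

lemma IsLocalParam.isCriticalPt_iff (h : IsLocalParam d M U c) (hu : u ∈ U) (g : E → ℝ) :
    IsCriticalPt d M g (c u) ↔
      HasFDerivAt (g ∘ c) (0 : EuclideanSpace ℝ (Fin d) →L[ℝ] ℝ) u := by
  refine ⟨?_, fun hd ↦ ⟨U, c, h, u, hu, rfl, hd⟩⟩
  rintro ⟨U', c', h', u', hu', heq, hd⟩
  obtain ⟨φ, rfl, hφ, hc, -⟩ := h.exists_transition h' hu hu' heq.symm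
  have hcomp := hd.comp u (hφ.differentiableAt (by simp)).hasFDerivAt
  rw [ContinuousLinearMap.zero_comp] at hcomp
  exact hcomp.congr_of_eventuallyEq (hc.fun_comp g)

lemma IsLocalParam.isNondegCriticalPt_iff (h : IsLocalParam d M U c) (hu : u ∈ U) {g : E → ℝ}
    (hg : ContDiffAt ℝ 2 (g ∘ c) u)
    (h₀ : HasFDerivAt (g ∘ c) (0 : EuclideanSpace ℝ (Fin d) →L[ℝ] ℝ) u) :
    IsNondegCriticalPt d M g (c u) ↔ NondegAt (g ∘ c) u := by
  refine ⟨?_, fun hn ↦ ⟨U, c, h, u, hu, rfl, h₀, hn⟩⟩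
  rintro ⟨U', c', h', u', hu', heq, -, hn⟩ a ha
  obtain ⟨φ, rfl, hφ, hc, hinj⟩ := h'.exists_transition h hu' hu heq
  have hgc : g ∘ c' =ᶠ[𝓝 u'] (g ∘ c) ∘ φ := hc.fun_comp g
  obtain ⟨v, rfl⟩ := LinearMap.surjective_of_injective (f := (fderiv ℝ φ u').toLinearMap) hinj a
  have hv : v = 0 := hn v fun w ↦ by
    rw [hgc.fderiv.fderiv_eq,
      fderiv_fderiv_comp_of_fderiv_eq_zero hg (hφ.of_le ENat.LEInfty.out) h₀.fderiv]
    exact ha _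
  rw [hv, map_zero]

lemma IsLocalParam.contDiffAt_height (h : IsLocalParam d M U c) (hu : u ∈ U) (q : E) :
    ContDiffAt ℝ 2 (height q ∘ c) u :=
  contDiffAt_const.inner ℝ ((h.contDiffAt hu).of_le ENat.LEInfty.out)

lemma IsLocalParam.hasFDerivAt_height (h : IsLocalParam d M U c) (hu : u ∈ U) (q : E) :
    HasFDerivAt (height q ∘ c) ((innerSL ℝ q).comp (fderiv ℝ c u)) u :=
  (innerSL ℝ q).hasFDerivAt.comp u (h.differentiableAt hu).hasFDerivAt

lemma IsLocalParam.isCriticalPt_height_iff (h : IsLocalParam d M U c) (hu : u ∈ U) (q : E) :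
    IsCriticalPt d M (height q) (c u) ↔ ∀ v, inner ℝ q (fderiv ℝ c u v) = 0 := by
  rw [h.isCriticalPt_iff hu]
  refine ⟨fun h₀ v ↦ DFunLike.congr_fun ((h.hasFDerivAt_height hu q).unique h₀) v, fun h₀ ↦ ?_⟩
  exact (h.hasFDerivAt_height hu q).congr_fderiv (ContinuousLinearMap.ext h₀)

lemma IsLocalParam.eventually_isCriticalPt_height_imp_eq (h : IsLocalParam d M U c) (hu : u ∈ U)
    {p : E} (hn : NondegAt (height p ∘ c) u) :
    ∀ᶠ x in 𝓝[M] (c u), IsCriticalPt d M (height p) x → x = c u := by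
  have hne := hn.eventually_fderiv_ne_zero (h.contDiffAt_height hu p)
  rw [eventually_nhdsWithin_iff] at hne
  rw [← h.map_nhds hu, eventually_map]
  filter_upwards [hne, h.isOpen.mem_nhds hu] with y hy hyU hcrit
  by_contra hcy
  exact hy (fun hyu ↦ hcy (congrArg c hyu)) ((h.isCriticalPt_iff hyU _).1 hcrit).fderiv

/-! ## Spherical distance functions and height functions -/

variable {p x : E}

lemma inner_ne_one_and_ne_neg_one (hp : p ∈ sphere (0 : E) 1) (hx : x ∈ sphere (0 : E) 1)
    (hxp : x ≠ p) (hxp' : x ≠ -p) : inner ℝ p x ≠ 1 ∧ inner ℝ p x ≠ -1 := by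
  rw [mem_sphere_zero_iff_norm] at hp hx
  refine ⟨fun h ↦ hxp ((inner_eq_one_iff_of_norm_eq_one hp hx).1 h).symm, fun h ↦ hxp' ?_⟩
  rw [← neg_eq_iff_eq_neg, eq_comm,
    ← inner_eq_one_iff_of_norm_eq_one (𝕜 := ℝ) hp ((norm_neg x).trans hx), inner_neg_right, h,
    neg_neg]

lemma inner_mem_Icc_of_mem_sphere (hp : p ∈ sphere (0 : E) 1) (hx : x ∈ sphere (0 : E) 1) :
    inner ℝ p x ∈ Icc (-1 : ℝ) 1 := by
  rw [mem_sphere_zero_iff_norm] at hp hx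
  simpa only [hp, hx, mul_one, abs_le, mem_Icc] using abs_real_inner_le_norm p x

section Sphere

variable (hM : M ⊆ sphere 0 1) (hp : p ∈ sphere (0 : E) 1)
include hM hp

lemma IsLocalParam.hasFDerivAt_sphDist_iff (h : IsLocalParam d M U c) (hu : u ∈ U)
    (hup : c u ≠ p) (hup' : c u ≠ -p) :
    HasFDerivAt (sphDist p ∘ c) (0 : EuclideanSpace ℝ (Fin d) →L[ℝ] ℝ) u ↔
      HasFDerivAt (height p ∘ c) (0 : EuclideanSpace ℝ (Fin d) →L[ℝ] ℝ) u := by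
  obtain ⟨hne, hne'⟩ := inner_ne_one_and_ne_neg_one hp (hM (h.mem hu)) hup hup'
  constructor
  · intro hd
    have hcos := (Real.hasDerivAt_cos _).comp_hasFDerivAt u hd
    rw [smul_zero] at hcos
    refine hcos.congr_of_eventuallyEq ?_
    filter_upwards [h.isOpen.mem_nhds hu] with y hy
    have hmem := inner_mem_Icc_of_mem_sphere hp (hM (h.mem hy))
    exact (Real.cos_arccos hmem.1 hmem.2).symm
  · intro hd
    have harccos := (Real.hasDerivAt_arccos hne' hne).comp_hasFDerivAt u hd
    rwa [smul_zero] at harccos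

lemma isCriticalPt_sphDist_iff (hsub : IsSubmanifold d M) (hx : x ∈ M)
    (hxp : x ≠ p) (hxp' : x ≠ -p) :
    IsCriticalPt d M (sphDist p) x ↔ IsCriticalPt d M (height p) x := by
  obtain ⟨U, c, h, u, hu, rfl⟩ := hsub x hx
  rw [h.isCriticalPt_iff hu, h.isCriticalPt_iff hu, h.hasFDerivAt_sphDist_iff hM hp hu hxp hxp']

lemma isCriticalPt_height_of_eq_or_eq_neg (hsub : IsSubmanifold d M) (hx : x ∈ M)
    (hxp : x = p ∨ x = -p) : IsCriticalPt d M (height p) x := by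
  obtain ⟨U, c, h, u, hu, rfl⟩ := hsub x hx
  have inner_self : inner ℝ p p = (1 : ℝ) := by
    rw [real_inner_self_eq_norm_sq, mem_sphere_zero_iff_norm.1 hp, one_pow]
  have hext : IsLocalExtr (height p ∘ c) u := by
    rcases hxp with hxp | hxp
    · right
      filter_upwards [h.isOpen.mem_nhds hu] with y hy
      simp only [Function.comp_apply, height, hxp, inner_self]
      exact (inner_mem_Icc_of_mem_sphere hp (hM (h.mem hy))).2
    · left
      filter_upwards [h.isOpen.mem_nhds hu] with y hy
      simp only [Function.comp_apply, height, hxp, inner_neg_right, inner_self]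
      exact (inner_mem_Icc_of_mem_sphere hp (hM (h.mem hy))).1
  have hd := h.hasFDerivAt_height hu p
  rwa [hext.hasFDerivAt_eq_zero hd, ← h.isCriticalPt_iff hu] at hd

lemma sphDistCriticalSet_eq_heightCriticalSet (hsub : IsSubmanifold d M) :
    sphDistCriticalSet d M p = heightCriticalSet d M p := by
  ext x
  refine and_congr_right fun hx ↦ ?_
  by_cases hxp : x = p ∨ x = -p
  · exact iff_of_true (hxp.imp_right Or.inl)
      (isCriticalPt_height_of_eq_or_eq_neg hM hp hsub hx hxp)
  · rw [← or_assoc, or_iff_right hxp]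
    rw [not_or] at hxp
    exact isCriticalPt_sphDist_iff hM hp hsub hx hxp.1 hxp.2

lemma IsLocalParam.isNondegCriticalPt_sphDist_iff (h : IsLocalParam d M U c) (hu : u ∈ U)
    (hup : c u ≠ p) (hup' : c u ≠ -p)
    (h₀ : HasFDerivAt (height p ∘ c) (0 : EuclideanSpace ℝ (Fin d) →L[ℝ] ℝ) u) :
    IsNondegCriticalPt d M (sphDist p) (c u) ↔ NondegAt (height p ∘ c) u := by
  obtain ⟨hne, hne'⟩ := inner_ne_one_and_ne_neg_one hp (hM (h.mem hu)) hup hup'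
  obtain ⟨hge, hle⟩ := inner_mem_Icc_of_mem_sphere hp (hM (h.mem hu))
  have hheight := h.contDiffAt_height hu p
  have harccos : ContDiffAt ℝ 2 Real.arccos ((height p ∘ c) u) := Real.contDiffAt_arccos hne' hne
  have hcomp : sphDist p ∘ c = Real.arccos ∘ (height p ∘ c) := rfl
  rw [h.isNondegCriticalPt_iff hu (hcomp ▸ harccos.comp u hheight)
    ((h.hasFDerivAt_sphDist_iff hM hp hu hup hup').2 h₀), hcomp]
  refine nondegAt_real_comp_iff hheight harccos h₀.fderiv ?_
  rw [Real.deriv_arccos, neg_ne_zero]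
  refine one_div_ne_zero (Real.sqrt_ne_zero'.2 (sub_pos.2 ?_))
  exact (sq_lt_one_iff_abs_lt_one _).2 (abs_lt.2 ⟨hge.lt_of_ne' hne', hle.lt_of_ne hne⟩)

lemma isNondegSphDist_iff (hsub : IsSubmanifold d M) :
    IsNondegSphDist d M p ↔ ∀ U c, IsLocalParam d M U c → ∀ u ∈ U, c u ≠ p → c u ≠ -p →
      HasFDerivAt (height p ∘ c) (0 : EuclideanSpace ℝ (Fin d) →L[ℝ] ℝ) u →
      NondegAt (height p ∘ c) u := by
  constructor
  · intro hn U c h u hu hup hup' h₀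
    refine (h.isNondegCriticalPt_sphDist_iff hM hp hu hup hup' h₀).1 (hn _ (h.mem hu) hup hup' ?_)
    rwa [h.isCriticalPt_iff hu, h.hasFDerivAt_sphDist_iff hM hp hu hup hup']
  · intro hn x hx hxp hxp' hcrit
    obtain ⟨U, c, h, u, hu, rfl⟩ := hsub x hx
    rw [h.isCriticalPt_iff hu, h.hasFDerivAt_sphDist_iff hM hp hu hxp hxp'] at hcrit
    exact (h.isNondegCriticalPt_sphDist_iff hM hp hu hxp hxp' hcrit).2
      (hn U c h u hu hxp hxp' hcrit)

end Sphere

end LocalParam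

/-! ## The Clifford action and the Hopf map -/

section Clifford

lemma R8.ext {x y : R8} (hfst : x.fst = y.fst) (hsnd : x.snd = y.snd) : x = y :=
  WithLp.ofLp_injective 2 (Prod.ext hfst hsnd)

/-- The Clifford action of `ℝ⁵ = ℍ × ℝ` on `ℍ²`: the vector `(a, t)` acts by the symmetric matrix
with rows `(t, a)` and `(ā, -t)`. -/
def cliffordMul : R5 →L[ℝ] R8 →L[ℝ] R8 :=
  LinearMap.toContinuousBilinearMap <| LinearMap.mk₂ ℝ
    (fun y x ↦ WithLp.toLp 2 (y.snd • x.fst + y.fst * x.snd, star y.fst * x.fst - y.snd • x.snd))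
    (fun _ _ _ ↦ R8.ext (by simp [add_smul, add_mul, add_add_add_comm])
      (by simp [add_smul, add_mul, add_sub_add_comm]))
    (fun _ _ _ ↦ R8.ext (by simp [mul_smul]) (by simp [mul_smul, smul_sub]))
    (fun _ _ _ ↦ R8.ext (by simp [mul_add, add_add_add_comm])
      (by simp [mul_add, add_sub_add_comm]))
    (fun r _ _ ↦ R8.ext (by simp [smul_comm r]) (by simp [smul_comm r, smul_sub]))

/-- The right action of `ℍ` on `ℍ²`, whose unit quaternions act transitively on the fibres of the
Hopf map. -/
def rightMul : R8 →L[ℝ] ℍ[ℝ] →L[ℝ] R8 :=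
  LinearMap.toContinuousBilinearMap <| LinearMap.mk₂ ℝ
    (fun x g ↦ WithLp.toLp 2 (x.fst * g, x.snd * g))
    (fun _ _ _ ↦ R8.ext (by simp [add_mul]) (by simp [add_mul]))
    (fun _ _ _ ↦ R8.ext (by simp) (by simp))
    (fun _ _ _ ↦ R8.ext (by simp [mul_add]) (by simp [mul_add]))
    (fun _ _ _ ↦ R8.ext (by simp) (by simp))

/-- The quaternionic Hermitian product of `ℍ²`, as a real bilinear map. -/
def hermitian : R8 →L[ℝ] R8 →L[ℝ] ℍ[ℝ] :=
  LinearMap.toContinuousBilinearMap <| LinearMap.mk₂ ℝ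
    (fun p x ↦ star p.fst * x.fst + star p.snd * x.snd)
    (fun _ _ _ ↦ by simp [add_mul, add_add_add_comm])
    (fun _ _ _ ↦ by simp)
    (fun _ _ _ ↦ by simp [mul_add, add_add_add_comm])
    (fun _ _ _ ↦ by simp)

@[simp] lemma cliffordMul_fst (y : R5) (x : R8) :
    (cliffordMul y x).fst = y.snd • x.fst + y.fst * x.snd := rfl

@[simp] lemma cliffordMul_snd (y : R5) (x : R8) :
    (cliffordMul y x).snd = star y.fst * x.fst - y.snd • x.snd := rfl

@[simp] lemma rightMul_fst (x : R8) (g : ℍ[ℝ]) : (rightMul x g).fst = x.fst * g := rfl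

@[simp] lemma rightMul_snd (x : R8) (g : ℍ[ℝ]) : (rightMul x g).snd = x.snd * g := rfl

lemma hermitian_apply (p x : R8) :
    hermitian p x = star p.fst * x.fst + star p.snd * x.snd := rfl

@[simp] lemma hopf_fst (x : R8) : (hopf x).fst = (2 : ℝ) • (x.fst * star x.snd) := rfl

@[simp] lemma hopf_snd (x : R8) : (hopf x).snd = ‖x.fst‖ ^ 2 - ‖x.snd‖ ^ 2 := rfl

lemma norm_sq_quaternion (a : ℍ[ℝ]) :
    ‖a‖ ^ 2 = a.re ^ 2 + a.imI ^ 2 + a.imJ ^ 2 + a.imK ^ 2 := by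
  rw [sq, ← Quaternion.normSq_eq_norm_mul_self, Quaternion.normSq_def']

lemma norm_sq_R8 (x : R8) : ‖x‖ ^ 2 = ‖x.fst‖ ^ 2 + ‖x.snd‖ ^ 2 :=
  WithLp.prod_norm_sq_eq_of_L2 x

lemma inner_cliffordMul_left (y : R5) (x x' : R8) :
    inner ℝ (cliffordMul y x) x' = inner ℝ x (cliffordMul y x') := by
  simp [Quaternion.inner_def]
  ring

lemma inner_cliffordMul_self (y : R5) (x : R8) :
    inner ℝ (cliffordMul y x) x = inner ℝ y (hopf x) := by
  simp [Quaternion.inner_def, norm_sq_quaternion]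
  ring

lemma cliffordMul_anticomm (y w : R5) (x : R8) :
    cliffordMul y (cliffordMul w x) + cliffordMul w (cliffordMul y x) =
      (2 * inner ℝ y w) • x := by
  refine R8.ext ?_ ?_ <;> ext <;> simp [Quaternion.inner_def] <;> ring

lemma cliffordMul_cliffordMul_self (y : R5) (x : R8) :
    cliffordMul y (cliffordMul y x) = ‖y‖ ^ 2 • x := by
  have h := cliffordMul_anticomm y y x
  rw [real_inner_self_eq_norm_sq, ← two_smul ℝ, mul_smul] at h
  exact smul_right_injective _ two_ne_zero h

lemma cliffordMul_hopf_self (x : R8) : cliffordMul (hopf x) x = ‖x‖ ^ 2 • x := by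
  rw [norm_sq_R8]
  refine R8.ext ?_ ?_ <;> ext <;> simp [norm_sq_quaternion] <;> ring

lemma cliffordMul_rightMul (y : R5) (x : R8) (g : ℍ[ℝ]) :
    cliffordMul y (rightMul x g) = rightMul (cliffordMul y x) g :=
  R8.ext (by simp [add_mul, mul_assoc]) (by simp [sub_mul, mul_assoc])

lemma norm_cliffordMul (y : R5) (x : R8) : ‖cliffordMul y x‖ = ‖y‖ * ‖x‖ := by
  have h : ‖cliffordMul y x‖ ^ 2 = (‖y‖ * ‖x‖) ^ 2 := by
    rw [← real_inner_self_eq_norm_sq, inner_cliffordMul_left, cliffordMul_cliffordMul_self,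
      inner_smul_right, real_inner_self_eq_norm_sq, mul_pow]
  exact (sq_eq_sq₀ (norm_nonneg _) (by positivity)).1 h

lemma rightMul_one (x : R8) : rightMul x 1 = x := R8.ext (mul_one _) (mul_one _)

lemma rightMul_coe (x : R8) (r : ℝ) : rightMul x (r : ℍ[ℝ]) = r • x :=
  R8.ext (Quaternion.mul_coe_eq_smul _ _) (Quaternion.mul_coe_eq_smul _ _)

lemma norm_rightMul (x : R8) (g : ℍ[ℝ]) : ‖rightMul x g‖ = ‖x‖ * ‖g‖ := by
  have h : ‖rightMul x g‖ ^ 2 = (‖x‖ * ‖g‖) ^ 2 := by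
    rw [mul_pow, norm_sq_R8, norm_sq_R8, rightMul_fst, rightMul_snd, norm_mul, norm_mul]
    ring
  exact (sq_eq_sq₀ (norm_nonneg _) (by positivity)).1 h

lemma hopf_rightMul (x : R8) (g : ℍ[ℝ]) : hopf (rightMul x g) = ‖g‖ ^ 2 • hopf x := by
  refine WithLp.ofLp_injective 2 (Prod.ext ?_ ?_)
  · change (2 : ℝ) • (x.fst * g * star (x.snd * g)) = ‖g‖ ^ 2 • ((2 : ℝ) • (x.fst * star x.snd))
    rw [star_mul, mul_assoc, ← mul_assoc g, Quaternion.self_mul_star,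
      Quaternion.normSq_eq_norm_mul_self, ← mul_assoc, Quaternion.mul_coe_eq_smul, smul_mul_assoc,
      smul_comm, sq]
  · change ‖x.fst * g‖ ^ 2 - ‖x.snd * g‖ ^ 2 = ‖g‖ ^ 2 * (‖x.fst‖ ^ 2 - ‖x.snd‖ ^ 2)
    rw [norm_mul, norm_mul]
    ring

lemma hopf_smul (r : ℝ) (x : R8) : hopf (r • x) = r ^ 2 • hopf x := by
  rw [← rightMul_coe, hopf_rightMul, Quaternion.norm_coe, Real.norm_eq_abs, sq_abs]

lemma hopf_neg (x : R8) : hopf (-x) = hopf x := by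
  simpa using hopf_smul (-1) x

lemma hermitian_rightMul (p x : R8) (g : ℍ[ℝ]) :
    hermitian p (rightMul x g) = hermitian p x * g := by
  simp [hermitian_apply, add_mul, mul_assoc]

lemma hermitian_self (p : R8) : hermitian p p = ((‖p‖ ^ 2 : ℝ) : ℍ[ℝ]) := by
  rw [hermitian_apply, Quaternion.star_mul_self, Quaternion.star_mul_self, norm_sq_R8,
    Quaternion.normSq_eq_norm_mul_self, Quaternion.normSq_eq_norm_mul_self, ← sq, ← sq,
    Quaternion.coe_add]

lemma hermitian_cliffordMul_self (p : R8) (y : R5) :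
    hermitian p (cliffordMul y p) = ((inner ℝ y (hopf p) : ℝ) : ℍ[ℝ]) := by
  ext <;>
    simp only [Quaternion.re_coe, Quaternion.imI_coe, Quaternion.imJ_coe, Quaternion.imK_coe] <;>
    simp [hermitian_apply, Quaternion.inner_def, norm_sq_quaternion] <;>
    ring

lemma re_hermitian (p x : R8) : (hermitian p x).re = inner ℝ p x := by
  simp [hermitian_apply, Quaternion.inner_def]

lemma rightMul_hermitian (x x' : R8) :
    rightMul x (hermitian x x') = (1 / 2 : ℝ) • (‖x‖ ^ 2 • x' + cliffordMul (hopf x) x') := by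
  rw [norm_sq_R8]
  refine R8.ext ?_ ?_ <;> ext <;> simp [hermitian_apply, norm_sq_quaternion] <;> ring

lemma contDiff_hopf : ContDiff ℝ ∞ hopf := by
  have hfst : ContDiff ℝ ∞ fun x : R8 ↦ x.fst := (WithLp.fstL 2 ℝ ℍ[ℝ] ℍ[ℝ]).contDiff
  have hsnd : ContDiff ℝ ∞ fun x : R8 ↦ x.snd := (WithLp.sndL 2 ℝ ℍ[ℝ] ℍ[ℝ]).contDiff
  let starₗ : ℍ[ℝ] →ₗ[ℝ] ℍ[ℝ] :=
    { toFun := star, map_add' := star_add, map_smul' := fun r a ↦ Quaternion.star_smul r a }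
  have hstar : ContDiff ℝ ∞ fun x : R8 ↦ star x.snd :=
    starₗ.toContinuousLinearMap.contDiff.comp hsnd
  exact (WithLp.prodContinuousLinearEquiv 2 ℝ ℍ[ℝ] ℝ).symm.contDiff.comp
    (((hfst.mul hstar).const_smul (2 : ℝ)).prodMk ((hfst.norm_sq ℝ).sub (hsnd.norm_sq ℝ)))

lemma hopf_eq_iff {x : R8} {y : R5} (hx : x ∈ sphere (0 : R8) 1) (hy : y ∈ sphere (0 : R5) 1) :
    hopf x = y ↔ cliffordMul y x = x := by
  rw [mem_sphere_zero_iff_norm] at hy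
  have hx' : ‖x‖ = 1 := mem_sphere_zero_iff_norm.1 hx
  have hopf_norm : ‖hopf x‖ = 1 := mem_sphere_zero_iff_norm.1 (hopf_mem_sphere hx)
  constructor
  · rintro rfl
    rw [cliffordMul_hopf_self, hx', one_pow, one_smul]
  · intro h
    have hinner := inner_cliffordMul_self y x
    rw [h, real_inner_self_eq_norm_sq, hx', one_pow] at hinner
    exact ((inner_eq_one_iff_of_norm_eq_one (𝕜 := ℝ) hy hopf_norm).1 hinner.symm).symm

end Clifford

/-! ## Local sections and trivializations of the Hopf fibration -/

section Section

/-- The section `y ↦ p + y p` of the Hopf map through `2 p`, which is to be normalized. -/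
def preSection (p : R8) (y : R5) : R8 := p + cliffordMul y p

/-- The local section of the Hopf map through `p`, over the complement of `-hopf p`. -/
def hopfSection (p : R8) (y : R5) : R8 := ‖preSection p y‖⁻¹ • preSection p y

lemma contDiff_preSection (p : R8) : ContDiff ℝ ∞ (preSection p) :=
  contDiff_const.add (cliffordMul.flip p).contDiff

lemma preSection_hopf_self {x : R8} (hx : x ∈ sphere (0 : R8) 1) :
    preSection x (hopf x) = (2 : ℝ) • x := by
  rw [preSection, cliffordMul_hopf_self, mem_sphere_zero_iff_norm.1 hx, one_pow, one_smul,
    two_smul]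

lemma hopfSection_hopf_self {x : R8} (hx : x ∈ sphere (0 : R8) 1) :
    hopfSection x (hopf x) = x := by
  rw [hopfSection, preSection_hopf_self hx, norm_smul, mem_sphere_zero_iff_norm.1 hx, smul_smul]
  norm_num

lemma hopfSection_neg (p : R8) (y : R5) : hopfSection (-p) y = -hopfSection p y := by
  have h : preSection (-p) y = -preSection p y := by
    rw [preSection, preSection, map_neg]
    abel
  rw [hopfSection, hopfSection, h, norm_neg, smul_neg]

variable {p : R8} {y : R5} (hp : p ∈ sphere (0 : R8) 1) (hy : y ∈ sphere (0 : R5) 1)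
include hp hy

lemma norm_preSection_sq : ‖preSection p y‖ ^ 2 = 2 * (1 + inner ℝ y (hopf p)) := by
  rw [preSection, norm_add_sq_real, norm_cliffordMul, mem_sphere_zero_iff_norm.1 hp,
    mem_sphere_zero_iff_norm.1 hy, real_inner_comm, inner_cliffordMul_self]
  ring

lemma norm_preSection_pos (h : y ≠ -hopf p) : 0 < ‖preSection p y‖ := by
  have hh := hopf_mem_sphere hp
  have hlt : -1 < inner ℝ y (hopf p) :=
    (inner_mem_Icc_of_mem_sphere hy hh).1.lt_of_ne' fun h' ↦ h <| by
      rw [mem_sphere_zero_iff_norm] at hh hy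
      refine (inner_eq_one_iff_of_norm_eq_one (𝕜 := ℝ) hy ((norm_neg _).trans hh)).1 ?_
      rw [inner_neg_right, h', neg_neg]
  refine (norm_nonneg _).lt_of_ne' fun h₀ ↦ ?_
  have hsq := norm_preSection_sq hp hy
  rw [h₀] at hsq
  linarith

lemma hopfSection_mem_sphere (h : y ≠ -hopf p) : hopfSection p y ∈ sphere (0 : R8) 1 := by
  rw [mem_sphere_zero_iff_norm, hopfSection, norm_smul, norm_inv, norm_norm,
    inv_mul_cancel₀ (norm_preSection_pos hp hy h).ne']

omit hp in
lemma cliffordMul_hopfSection : cliffordMul y (hopfSection p y) = hopfSection p y := by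
  have h : cliffordMul y (preSection p y) = preSection p y := by
    rw [preSection, map_add, cliffordMul_cliffordMul_self, mem_sphere_zero_iff_norm.1 hy, one_pow,
      one_smul, add_comm]
  rw [hopfSection, map_smul, h]

lemma hopf_hopfSection (h : y ≠ -hopf p) : hopf (hopfSection p y) = y :=
  (hopf_eq_iff (hopfSection_mem_sphere hp hy h) hy).2 (cliffordMul_hopfSection hy)

lemma contDiffAt_hopfSection (h : y ≠ -hopf p) : ContDiffAt ℝ ∞ (hopfSection p) y := by
  have hpos := norm_preSection_pos hp hy h
  have hsmooth : ContDiffAt ℝ ∞ (preSection p) y := (contDiff_preSection p).contDiffAt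
  exact ((hsmooth.norm ℝ (norm_pos_iff.1 hpos)).inv hpos.ne').smul hsmooth

lemma hermitian_hopfSection (h : y ≠ -hopf p) :
    hermitian p (hopfSection p y) = ((‖preSection p y‖ / 2 : ℝ) : ℍ[ℝ]) := by
  have hpos := norm_preSection_pos hp hy h
  have hpre : hermitian p (preSection p y) = ((1 + inner ℝ y (hopf p) : ℝ) : ℍ[ℝ]) := by
    rw [preSection, map_add, hermitian_self, hermitian_cliffordMul_self,
      mem_sphere_zero_iff_norm.1 hp, one_pow, Quaternion.coe_add]
  rw [hopfSection, map_smul, hpre, ← Quaternion.coe_smul]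
  congr 1
  rw [smul_eq_mul, inv_mul_eq_div, div_eq_div_iff hpos.ne' two_ne_zero]
  linarith [norm_preSection_sq hp hy, sq ‖preSection p y‖]

lemma hermitian_rightMul_hopfSection (h : y ≠ -hopf p) (g : ℍ[ℝ]) :
    hermitian (hopfSection p y) (rightMul (hopfSection p y) g) = g := by
  rw [hermitian_rightMul, hermitian_self,
    mem_sphere_zero_iff_norm.1 (hopfSection_mem_sphere hp hy h), one_pow, Quaternion.coe_one,
    one_mul]

lemma rightMul_hopfSection_mem_sphere (h : y ≠ -hopf p) {g : ℍ[ℝ]} (hg : ‖g‖ = 1) :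
    rightMul (hopfSection p y) g ∈ sphere (0 : R8) 1 := by
  rw [mem_sphere_zero_iff_norm, norm_rightMul, hg,
    mem_sphere_zero_iff_norm.1 (hopfSection_mem_sphere hp hy h), one_mul]

lemma hopf_rightMul_hopfSection (h : y ≠ -hopf p) {g : ℍ[ℝ]} (hg : ‖g‖ = 1) :
    hopf (rightMul (hopfSection p y) g) = y := by
  rw [hopf_rightMul, hopf_hopfSection hp hy h, hg, one_pow, one_smul]

omit hy

variable {x : R8} (hx : x ∈ sphere (0 : R8) 1) (h : hopf x ≠ -hopf p)
include hx h

lemma rightMul_hermitian_hopfSection :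
    rightMul (hopfSection p (hopf x)) (hermitian (hopfSection p (hopf x)) x) = x := by
  have hy := hopf_mem_sphere hx
  rw [rightMul_hermitian, mem_sphere_zero_iff_norm.1 (hopfSection_mem_sphere hp hy h),
    hopf_hopfSection hp hy h, (hopf_eq_iff hx hy).1 rfl, one_pow, one_smul, ← two_smul ℝ x,
    smul_smul]
  norm_num

lemma norm_hermitian_hopfSection : ‖hermitian (hopfSection p (hopf x)) x‖ = 1 := by
  have hnorm := congrArg norm (rightMul_hermitian_hopfSection hp hx h)
  rwa [norm_rightMul, mem_sphere_zero_iff_norm.1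
    (hopfSection_mem_sphere hp (hopf_mem_sphere hx) h), one_mul,
    mem_sphere_zero_iff_norm.1 hx] at hnorm

end Section

lemma exists_mem_sphere_hopf_eq {y : R5} (hy : y ∈ sphere (0 : R5) 1) :
    ∃ p ∈ sphere (0 : R8) 1, hopf p = y := by
  by_contra! hne
  have eq_neg (p : R8) (hp : p ∈ sphere (0 : R8) 1) : y = -hopf p := by
    by_contra h
    exact hne _ (hopfSection_mem_sphere hp hy h) (hopf_hopfSection hp hy h)
  have north := eq_neg (WithLp.toLp 2 (1, 0)) (by simp)
  have south := eq_neg (WithLp.toLp 2 (0, 1)) (by simp)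
  have hsnd := congrArg (fun z : R5 ↦ z.snd) (north.symm.trans south)
  norm_num [hopf] at hsnd

section Trivialization

variable {M : Set R5} {p : R8} (hM : M ⊆ sphere 0 1) (hp : p ∈ sphere (0 : R8) 1)
  (h : -hopf p ∉ M)
include hp h

lemma continuousOn_hopfSection (hM : M ⊆ sphere 0 1) : ContinuousOn (hopfSection p) M := fun _ hy ↦
  (contDiffAt_hopfSection hp (hM hy) (ne_of_mem_of_not_mem hy h)).continuousAt.continuousWithinAt

/-- The Hopf fibration is trivial over subsets which miss a point. -/
def hopfTrivialization : (M × sphere (0 : ℍ[ℝ]) 1) ≃ₜ hopfPreimage M where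
  toFun q :=
    have hne := ne_of_mem_of_not_mem q.1.2 h
    have hg := mem_sphere_zero_iff_norm.1 q.2.2
    ⟨rightMul (hopfSection p q.1) q.2, rightMul_hopfSection_mem_sphere hp (hM q.1.2) hne hg,
      (hopf_rightMul_hopfSection hp (hM q.1.2) hne hg).symm ▸ q.1.2⟩
  invFun x := (⟨hopf x, x.2.2⟩, ⟨hermitian (hopfSection p (hopf x)) x, mem_sphere_zero_iff_norm.2 <|
    norm_hermitian_hopfSection hp x.2.1 (ne_of_mem_of_not_mem x.2.2 h)⟩)
  left_inv q := by
    have hne := ne_of_mem_of_not_mem q.1.2 h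
    have hbase := hopf_rightMul_hopfSection hp (hM q.1.2) hne (mem_sphere_zero_iff_norm.1 q.2.2)
    refine Prod.ext (Subtype.ext hbase) (Subtype.ext ?_)
    simp only [hbase]
    exact hermitian_rightMul_hopfSection hp (hM q.1.2) hne q.2
  right_inv x := Subtype.ext <|
    rightMul_hermitian_hopfSection hp x.2.1 (ne_of_mem_of_not_mem x.2.2 h)
  continuous_toFun := by
    have hsec : Continuous fun q : M × sphere (0 : ℍ[ℝ]) 1 ↦ hopfSection p q.1 :=
      (continuousOn_hopfSection hp h hM).domRestrict.comp continuous_fst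
    exact ((rightMul.continuous.comp hsec).clm_apply
      (continuous_subtype_val.comp continuous_snd)).subtype_mk _
  continuous_invFun := by
    have hhopf : Continuous fun x : hopfPreimage M ↦ hopf x :=
      contDiff_hopf.continuous.comp continuous_subtype_val
    have hsec : Continuous fun x : hopfPreimage M ↦ hopfSection p (hopf x) :=
      (continuousOn_hopfSection hp h hM).comp_continuous hhopf fun x ↦ x.2.2
    exact (hhopf.subtype_mk _).prodMk
      (((hermitian.continuous.comp hsec).clm_apply continuous_subtype_val).subtype_mk _)

end Trivialization

/-! ## Local parametrizations of the preimage under the Hopf map -/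

lemma injective_fderiv_of_comp {E F G : Type*} [NormedAddCommGroup E] [NormedSpace ℝ E]
    [NormedAddCommGroup F] [NormedSpace ℝ F] [NormedAddCommGroup G] [NormedSpace ℝ G]
    {g : F → G} {f : E → F} {x : E} (hg : DifferentiableAt ℝ g (f x))
    (hf : DifferentiableAt ℝ f x) (h : Function.Injective (fderiv ℝ (g ∘ f) x)) :
    Function.Injective (fderiv ℝ f x) := by
  rw [fderiv_comp x hg hf, ContinuousLinearMap.coe_comp] at h
  exact h.of_comp

section Inverse

variable {E : Type} [NormedAddCommGroup E] [InnerProductSpace ℝ E] {d : ℕ} {M : Set E}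
  {U : Set (EuclideanSpace ℝ (Fin d))} {c : EuclideanSpace ℝ (Fin d) → E}

lemma IsLocalParam.injOn (h : IsLocalParam d M U c) : InjOn c U := by
  obtain ⟨hmaps, hemb⟩ := h.isOpenEmbedding
  exact fun u hu u' hu' heq ↦
    congrArg Subtype.val (@hemb.injective ⟨u, hu⟩ ⟨u', hu'⟩ (Subtype.ext heq))

lemma IsLocalParam.exists_inverse (h : IsLocalParam d M U c) :
    ∃ (W : Set E) (s : E → EuclideanSpace ℝ (Fin d)), IsOpen W ∧ MapsTo c U W ∧
      ContinuousOn s (M ∩ W) ∧ LeftInvOn s c U ∧ ∀ x ∈ M ∩ W, s x ∈ U ∧ c (s x) = x := by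
  obtain ⟨hmaps, hemb⟩ := h.isOpenEmbedding
  obtain ⟨W, hW, hWrange⟩ := isOpen_induced_iff.1 hemb.isOpen_range
  have mem_W_iff {x : E} (hx : x ∈ M) : x ∈ W ↔ ∃ u ∈ U, c u = x := by
    simpa [Subtype.ext_iff] using Set.ext_iff.1 hWrange ⟨x, hx⟩
  have hcW : MapsTo c U W := fun u hu ↦ (mem_W_iff (h.mem hu)).2 ⟨u, hu, rfl⟩
  choose! s hs using fun (x : E) (hx : x ∈ M ∩ W) ↦ (mem_W_iff hx.1).1 hx.2
  have hsc : LeftInvOn s c U := fun u hu ↦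
    have hsu := hs (c u) ⟨h.mem hu, hcW hu⟩
    h.injOn hsu.1 hu hsu.2
  refine ⟨W, s, hW, hcW, fun x hx ↦ ?_, hsc, hs⟩
  obtain ⟨u, hu, rfl⟩ := (mem_W_iff hx.1).1 hx.2
  rw [ContinuousWithinAt, nhdsWithin_inter_of_mem' (mem_nhdsWithin_of_mem_nhds (hW.mem_nhds hx.2)),
    ← h.map_nhds hu, tendsto_map'_iff, hsc hu]
  refine tendsto_id.congr' ?_
  filter_upwards [h.isOpen.mem_nhds hu] with u' hu' using (hsc hu').symm

lemma IsLocalParam.of_inverse {W : Set E} {s : E → EuclideanSpace ℝ (Fin d)} (hU : IsOpen U)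
    (hc : ContDiffOn ℝ ∞ c U) (himm : ∀ u ∈ U, Function.Injective (fderiv ℝ c u))
    (hW : IsOpen W) (hcW : MapsTo c U (M ∩ W)) (hs : ContinuousOn s (M ∩ W))
    (hsc : LeftInvOn s c U) (hcs : ∀ x ∈ M ∩ W, s x ∈ U ∧ c (s x) = x) :
    IsLocalParam d M U c := by
  have hmaps : MapsTo c U M := fun u hu ↦ (hcW hu).1
  refine ⟨hU, hc, himm, hmaps, .of_continuous_injective_isOpenMap ?_ ?_ ?_⟩
  · exact hc.continuousOn.mapsToRestrict hmaps
  · exact fun u u' h ↦ Subtype.ext (hsc.injOn u.2 u'.2 (congrArg Subtype.val h))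
  · intro O hO
    obtain ⟨O', hO', rfl⟩ := isOpen_induced_iff.1 hO
    obtain ⟨T, hT, hTeq⟩ := continuousOn_iff'.1 hs O' hO'
    refine isOpen_induced_iff.2 ⟨T ∩ W, hT.inter hW, ?_⟩
    ext ⟨x, hx⟩
    constructor
    · rintro ⟨hxT, hxW⟩
      have hsx : x ∈ s ⁻¹' O' ∩ (M ∩ W) := hTeq ▸ ⟨hxT, hx, hxW⟩
      obtain ⟨hsU, hcsx⟩ := hcs x hsx.2
      exact ⟨⟨s x, hsU⟩, hsx.1, Subtype.ext hcsx⟩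
    · rintro ⟨⟨u, hu⟩, huO, hux⟩
      obtain rfl : c u = x := congrArg Subtype.val hux
      have hmem : c u ∈ s ⁻¹' O' ∩ (M ∩ W) := ⟨mem_preimage.2 ((hsc hu).symm ▸ huO), hcW hu⟩
      exact ⟨(hTeq ▸ hmem).1, (hcW hu).2⟩

end Inverse

section UnitQuaternions

/-- The imaginary quaternion with given coordinates. -/
def imag : ℝ × ℝ × ℝ →L[ℝ] ℍ[ℝ] :=
  LinearMap.toContinuousLinearMap
    { toFun := fun η ↦ ⟨0, η.1, η.2.1, η.2.2⟩
      map_add' := fun _ _ ↦ QuaternionAlgebra.ext (add_zero 0).symm rfl rfl rfl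
      map_smul' := fun r _ ↦ QuaternionAlgebra.ext (mul_zero r).symm rfl rfl rfl }

/-- The coordinates of the imaginary part of a quaternion. -/
def imCoord : ℍ[ℝ] →L[ℝ] ℝ × ℝ × ℝ :=
  LinearMap.toContinuousLinearMap
    { toFun := fun a ↦ (a.imI, a.imJ, a.imK)
      map_add' := fun a b ↦ by simp
      map_smul' := fun r a ↦ by simp }

@[simp] lemma imCoord_imag (η : ℝ × ℝ × ℝ) : imCoord (imag η) = η := rfl
@[simp] lemma imCoord_one : imCoord 1 = 0 := rfl
@[simp] lemma re_imag (η : ℝ × ℝ × ℝ) : (imag η).re = 0 := rfl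

lemma re_add_imag (a : ℍ[ℝ]) : (a.re : ℍ[ℝ]) + imag (imCoord a) = a :=
  QuaternionAlgebra.ext (add_zero _) (zero_add _) (zero_add _) (zero_add _)

lemma one_le_norm_one_add_imag (η : ℝ × ℝ × ℝ) : 1 ≤ ‖1 + imag η‖ := by
  rw [← one_le_sq_iff₀ (norm_nonneg _), norm_sq_quaternion, Quaternion.re_add, Quaternion.re_one,
    re_imag, add_zero, one_pow]
  linarith [sq_nonneg (1 + imag η).imI, sq_nonneg (1 + imag η).imJ, sq_nonneg (1 + imag η).imK]

/-- The inverse of the central projection of the unit quaternions with positive real part to the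
tangent space at `1`. -/
def unitChart (η : ℝ × ℝ × ℝ) : ℍ[ℝ] := ‖1 + imag η‖⁻¹ • (1 + imag η)

/-- The central projection of the quaternions to the tangent space of the unit quaternions at
`1`. -/
def imRatio (a : ℍ[ℝ]) : ℝ × ℝ × ℝ := a.re⁻¹ • imCoord a

lemma unitChart_zero : unitChart 0 = 1 := by simp [unitChart]

lemma norm_unitChart (η : ℝ × ℝ × ℝ) : ‖unitChart η‖ = 1 := by
  have := one_le_norm_one_add_imag η
  rw [unitChart, norm_smul, norm_inv, norm_norm, inv_mul_cancel₀ (by linarith)]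

lemma re_unitChart_pos (η : ℝ × ℝ × ℝ) : 0 < (unitChart η).re := by
  have := one_le_norm_one_add_imag η
  rw [unitChart, Quaternion.re_smul, Quaternion.re_add, Quaternion.re_one, re_imag]
  positivity

lemma contDiff_unitChart : ContDiff ℝ ∞ unitChart := by
  refine contDiff_iff_contDiffAt.2 fun η ↦ ?_
  have hpos : 0 < ‖1 + imag η‖ := one_pos.trans_le (one_le_norm_one_add_imag η)
  have hsmooth : ContDiffAt ℝ ∞ (fun η ↦ 1 + imag η) η :=
    contDiffAt_const.add imag.contDiff.contDiffAt
  exact ((hsmooth.norm ℝ (norm_pos_iff.1 hpos)).inv hpos.ne').smul hsmooth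

-- The normalizing factor is minimal at `0`, so that it does not contribute to the derivative.
lemma hasFDerivAt_unitChart : HasFDerivAt unitChart imag 0 := by
  have hlin : HasFDerivAt (fun η ↦ 1 + imag η) imag 0 := imag.hasFDerivAt.const_add 1
  have hmin : IsLocalMin (fun η ↦ ‖1 + imag η‖) 0 := .of_forall fun η ↦ by
    simpa using one_le_norm_one_add_imag η
  have hnorm := (hlin.differentiableAt.norm ℝ (by simp)).hasFDerivAt
  rw [hmin.fderiv_eq_zero] at hnorm
  have hne : ‖(1 : ℍ[ℝ]) + imag 0‖ ≠ 0 := by simp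
  refine (((hasDerivAt_inv hne).comp_hasFDerivAt (0 : ℝ × ℝ × ℝ) hnorm).smul hlin).congr_fderiv ?_
  exact ContinuousLinearMap.ext fun v ↦ by simp

lemma imRatio_smul {r : ℝ} (hr : r ≠ 0) (a : ℍ[ℝ]) : imRatio (r • a) = imRatio a := by
  rw [imRatio, map_smul, Quaternion.re_smul, smul_smul, smul_eq_mul, mul_inv_rev,
    inv_mul_cancel_right₀ hr, imRatio]

lemma imRatio_unitChart (η : ℝ × ℝ × ℝ) : imRatio (unitChart η) = η := by
  have := one_le_norm_one_add_imag η
  rw [unitChart, imRatio_smul (by positivity)]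
  simp [imRatio]

lemma unitChart_imRatio {g : ℍ[ℝ]} (hg : ‖g‖ = 1) (hre : 0 < g.re) :
    unitChart (imRatio g) = g := by
  have h : 1 + imag (imRatio g) = g.re⁻¹ • g := by
    conv_rhs => arg 2; rw [← re_add_imag g]
    rw [imRatio, smul_add, map_smul, ← Quaternion.coe_smul, smul_eq_mul, inv_mul_cancel₀ hre.ne',
      Quaternion.coe_one]
  rw [unitChart, h, norm_smul, hg, mul_one, norm_inv, Real.norm_of_nonneg hre.le, inv_inv,
    smul_inv_smul₀ hre.ne']

lemma contDiffAt_imRatio {a : ℍ[ℝ]} (ha : a.re ≠ 0) : ContDiffAt ℝ ∞ imRatio a := by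
  have hre : ContDiff ℝ ∞ fun a : ℍ[ℝ] ↦ a.re := by
    simpa [Quaternion.inner_def] using (innerSL ℝ (1 : ℍ[ℝ])).contDiff (n := ∞)
  exact (hre.contDiffAt.inv ha).smul imCoord.contDiff.contDiffAt

end UnitQuaternions

section BundleChart

/-- Local coordinates on the total space of the Hopf fibration: a point of the base, and the
central projection of the fibre. -/
def bundleChart (q : R8) (z : R5 × (ℝ × ℝ × ℝ)) : R8 :=
  rightMul (hopfSection q z.1) (unitChart z.2)

/-- The inverse of `bundleChart`. -/
def bundleCoord (q x : R8) : R5 × (ℝ × ℝ × ℝ) := (hopf x, imRatio (hermitian q x))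

variable {q : R8} (hq : q ∈ sphere (0 : R8) 1)
include hq

lemma inner_rightMul_hopfSection {y : R5} (hy : y ∈ sphere (0 : R5) 1) (h : y ≠ -hopf q)
    (g : ℍ[ℝ]) : inner ℝ q (rightMul (hopfSection q y) g) = ‖preSection q y‖ / 2 * g.re := by
  rw [← re_hermitian, hermitian_rightMul, hermitian_hopfSection hq hy h,
    Quaternion.coe_mul_eq_smul, Quaternion.re_smul, smul_eq_mul]

section Domain

variable {z : R5 × (ℝ × ℝ × ℝ)} (hz : z.1 ∈ sphere (0 : R5) 1) (h : z.1 ≠ -hopf q)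
include hz h

lemma bundleChart_mem_sphere : bundleChart q z ∈ sphere (0 : R8) 1 :=
  rightMul_hopfSection_mem_sphere hq hz h (norm_unitChart _)

lemma hopf_bundleChart : hopf (bundleChart q z) = z.1 :=
  hopf_rightMul_hopfSection hq hz h (norm_unitChart _)

lemma inner_bundleChart_pos : 0 < inner ℝ q (bundleChart q z) := by
  rw [bundleChart, inner_rightMul_hopfSection hq hz h]
  exact mul_pos (half_pos (norm_preSection_pos hq hz h)) (re_unitChart_pos _)

lemma bundleCoord_bundleChart : bundleCoord q (bundleChart q z) = z := by
  refine Prod.ext (hopf_bundleChart hq hz h) ?_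
  rw [bundleCoord, bundleChart, hermitian_rightMul, hermitian_hopfSection hq hz h,
    Quaternion.coe_mul_eq_smul, imRatio_smul (half_pos (norm_preSection_pos hq hz h)).ne',
    imRatio_unitChart]

lemma contDiffAt_bundleChart : ContDiffAt ℝ ∞ (bundleChart q) z := by
  have hsec : ContDiffAt ℝ ∞ (fun z : R5 × (ℝ × ℝ × ℝ) ↦ hopfSection q z.1) z :=
    (contDiffAt_hopfSection hq hz h).comp z contDiffAt_fst
  exact (rightMul.contDiff.contDiffAt.comp z hsec).clm_apply
    (contDiff_unitChart.comp contDiff_snd).contDiffAt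

end Domain

omit hq in
lemma contDiffAt_bundleCoord {x : R8} (hx : 0 < inner ℝ q x) :
    ContDiffAt ℝ ∞ (bundleCoord q) x :=
  contDiff_hopf.contDiffAt.prodMk <| (contDiffAt_imRatio ((re_hermitian q x).symm ▸ hx.ne')).comp x
    (hermitian q).contDiff.contDiffAt

lemma bundleChart_bundleCoord {x : R8} (hx : x ∈ sphere (0 : R8) 1) (h : hopf x ≠ -hopf q)
    (hpos : 0 < inner ℝ q x) : bundleChart q (bundleCoord q x) = x := by
  set g := hermitian (hopfSection q (hopf x)) x with hg
  have hx_eq : rightMul (hopfSection q (hopf x)) g = x := rightMul_hermitian_hopfSection hq hx h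
  have hhalf := half_pos (norm_preSection_pos hq (hopf_mem_sphere hx) h)
  have hre : 0 < g.re := by
    rwa [← hx_eq, inner_rightMul_hopfSection hq (hopf_mem_sphere hx) h, mul_pos_iff_of_pos_left
      hhalf] at hpos
  have hratio : imRatio (hermitian q x) = imRatio g := by
    conv_lhs => rw [← hx_eq]
    rw [hermitian_rightMul, hermitian_hopfSection hq (hopf_mem_sphere hx) h,
      Quaternion.coe_mul_eq_smul, imRatio_smul hhalf.ne']
  rw [bundleCoord, bundleChart, hratio,
    unitChart_imRatio (norm_hermitian_hopfSection hq hx h) hre, hx_eq]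

end BundleChart

section Chart

/-- Splitting off three coordinates, for the fibre of the Hopf fibration. -/
def splitCoord (d : ℕ) :
    EuclideanSpace ℝ (Fin (d + 3)) ≃L[ℝ] EuclideanSpace ℝ (Fin d) × (ℝ × ℝ × ℝ) :=
  ContinuousLinearEquiv.ofFinrankEq (by simp)

/-- The parametrization of the preimage of a submanifold under the Hopf map induced by a
parametrization `c` of the submanifold. -/
def hopfChart {d : ℕ} (q : R8) (c : EuclideanSpace ℝ (Fin d) → R5)
    (w : EuclideanSpace ℝ (Fin (d + 3))) : R8 :=
  bundleChart q (Prod.map c id (splitCoord d w))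

/-- The domain of `hopfChart`. -/
def chartDomain {d : ℕ} (U : Set (EuclideanSpace ℝ (Fin d))) (c : EuclideanSpace ℝ (Fin d) → R5)
    (q : R8) : Set (EuclideanSpace ℝ (Fin (d + 3))) :=
  {w | (splitCoord d w).1 ∈ U ∧ c (splitCoord d w).1 ≠ -hopf q}

variable {d : ℕ} {M : Set R5} {U : Set (EuclideanSpace ℝ (Fin d))}
  {c : EuclideanSpace ℝ (Fin d) → R5} {q : R8}

lemma IsLocalParam.isOpen_chartDomain (hc : IsLocalParam d M U c) (q : R8) :
    IsOpen (chartDomain U c q) :=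
  have h : IsOpen (U ∩ c ⁻¹' {-hopf q}ᶜ) :=
    hc.contDiffOn.continuousOn.isOpen_inter_preimage hc.isOpen isOpen_compl_singleton
  h.preimage (continuous_fst.comp (splitCoord d).continuous)

variable (hc : IsLocalParam d M U c) (hM : M ⊆ sphere 0 1) (hq : q ∈ sphere (0 : R8) 1)
include hc hM hq

lemma IsLocalParam.contDiffAt_hopfChart {w : EuclideanSpace ℝ (Fin (d + 3))}
    (hw : w ∈ chartDomain U c q) : ContDiffAt ℝ ∞ (hopfChart q c) w := by
  have hmap : ContDiffAt ℝ ∞ (fun w ↦ Prod.map c id (splitCoord d w)) w :=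
    (((hc.contDiffAt hw.1).comp (splitCoord d w) contDiffAt_fst).prodMk contDiffAt_snd).comp w
      (splitCoord d).contDiff.contDiffAt
  exact (contDiffAt_bundleChart hq (hM (hc.mem hw.1)) hw.2).comp w hmap

lemma IsLocalParam.bundleCoord_hopfChart {w : EuclideanSpace ℝ (Fin (d + 3))}
    (hw : w ∈ chartDomain U c q) :
    bundleCoord q (hopfChart q c w) = Prod.map c id (splitCoord d w) :=
  bundleCoord_bundleChart hq (hM (hc.mem hw.1)) hw.2

lemma IsLocalParam.injective_fderiv_hopfChart {w : EuclideanSpace ℝ (Fin (d + 3))}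
    (hw : w ∈ chartDomain U c q) : Function.Injective (fderiv ℝ (hopfChart q c) w) := by
  have hcoord : bundleCoord q ∘ hopfChart q c =ᶠ[𝓝 w] Prod.map c id ∘ splitCoord d := by
    filter_upwards [(hc.isOpen_chartDomain q).mem_nhds hw] with w' hw'
      using hc.bundleCoord_hopfChart hM hq hw'
  have hderiv : HasFDerivAt (Prod.map c id ∘ splitCoord d)
      (((fderiv ℝ c (splitCoord d w).1).prodMap (.id ℝ _)).comp (splitCoord d : _ →L[ℝ] _)) w :=
    ((hc.differentiableAt hw.1).hasFDerivAt.prodMap _ (hasFDerivAt_id _)).comp w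
      (splitCoord d).hasFDerivAt
  refine injective_fderiv_of_comp (g := bundleCoord q)
    ((contDiffAt_bundleCoord (inner_bundleChart_pos hq (hM (hc.mem hw.1)) hw.2)).differentiableAt
      (by simp)) ((hc.contDiffAt_hopfChart hM hq hw).differentiableAt (by simp)) ?_
  rw [hcoord.fderiv_eq, hderiv.fderiv]
  exact ((hc.immersion _ hw.1).prodMap Function.injective_id).comp (splitCoord d).injective

lemma IsLocalParam.hopfChart :
    IsLocalParam (d + 3) (hopfPreimage M) (chartDomain U c q) (hopfChart q c) := by
  obtain ⟨W, s, hW, hcW, hs, hsc, hcs⟩ := hc.exists_inverse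
  have hhopf := contDiff_hopf.continuous
  refine .of_inverse (W := {x | hopf x ∈ W ∧ hopf x ≠ -hopf q ∧ 0 < inner ℝ q x})
    (s := fun x ↦ (splitCoord d).symm (Prod.map s id (bundleCoord q x)))
    (hc.isOpen_chartDomain q)
    (fun w hw ↦ (hc.contDiffAt_hopfChart hM hq hw).contDiffWithinAt)
    (fun w hw ↦ hc.injective_fderiv_hopfChart hM hq hw) ?_ ?_ ?_ ?_ ?_
  · exact (hW.preimage hhopf).inter ((isOpen_compl_singleton.preimage hhopf).inter
      (isOpen_lt continuous_const (innerSL ℝ q).continuous))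
  · intro w hw
    have hy := hM (hc.mem hw.1)
    have hbase : hopf (HopfTaut.hopfChart q c w) = c (splitCoord d w).1 :=
      hopf_bundleChart hq hy hw.2
    exact ⟨⟨bundleChart_mem_sphere hq hy hw.2, hbase ▸ hc.mem hw.1⟩, hbase ▸ hcW hw.1,
      hbase ▸ hw.2, inner_bundleChart_pos hq hy hw.2⟩
  · refine (splitCoord d).symm.continuous.comp_continuousOn (ContinuousOn.prodMk ?_ ?_)
    · exact hs.comp hhopf.continuousOn fun x hx ↦ ⟨hx.1.2, hx.2.1⟩
    · exact continuous_snd.comp_continuousOn fun x hx ↦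
        (contDiffAt_bundleCoord hx.2.2.2).continuousAt.continuousWithinAt
  · intro w hw
    rw [ContinuousLinearEquiv.symm_apply_eq, hc.bundleCoord_hopfChart hM hq hw]
    exact Prod.ext (hsc hw.1) rfl
  · rintro x ⟨hx, hxW, hne, hpos⟩
    obtain ⟨hsU, hcsx⟩ := hcs (hopf x) ⟨hx.2, hxW⟩
    have hcoord : Prod.map c id (Prod.map s id (bundleCoord q x)) = bundleCoord q x :=
      Prod.ext hcsx rfl
    simp only [chartDomain, HopfTaut.hopfChart, mem_ofPred_eq,
      ContinuousLinearEquiv.apply_symm_apply]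
    refine ⟨⟨hsU, hcsx.trans_ne hne⟩, ?_⟩
    rw [hcoord, bundleChart_bundleCoord hq hx.1 hne hpos]

end Chart

lemma hopf_ne_neg_self {x : R8} (hx : x ∈ sphere (0 : R8) 1) : hopf x ≠ -hopf x :=
  fun h ↦
  ne_neg_of_mem_unit_sphere ℝ ⟨_, hopf_mem_sphere hx⟩ (Subtype.ext h)

lemma IsSubmanifold.hopfPreimage {d : ℕ} {M : Set R5} (h : IsSubmanifold d M)
    (hM : M ⊆ sphere 0 1) : IsSubmanifold (d + 3) (hopfPreimage M) := by
  intro x hx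
  obtain ⟨U, c, hc, u, hu, hux⟩ := h _ hx.2
  refine ⟨_, _, hc.hopfChart hM hx.1, (splitCoord d).symm (u, 0), ?_, ?_⟩
  · simp only [chartDomain, mem_ofPred_eq, ContinuousLinearEquiv.apply_symm_apply, hux]
    exact ⟨hu, hopf_ne_neg_self hx.1⟩
  · simp only [HopfTaut.hopfChart, bundleChart, ContinuousLinearEquiv.apply_symm_apply, Prod.map,
      hux, hopfSection_hopf_self hx.1, id, unitChart_zero, rightMul_one]

lemma hasFDerivAt_bundleChart {q : R8} (hq : q ∈ sphere (0 : R8) 1) {y : R5}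
    (hy : y ∈ sphere (0 : R5) 1) (h : y ≠ -hopf q) :
    HasFDerivAt (bundleChart q)
      ((fderiv ℝ (hopfSection q) y).coprod ((rightMul (hopfSection q y)).comp imag)) (y, 0) := by
  let z₀ : R5 × (ℝ × ℝ × ℝ) := (y, 0)
  have hsec : HasFDerivAt (fun z : R5 × (ℝ × ℝ × ℝ) ↦ hopfSection q z.1)
      ((fderiv ℝ (hopfSection q) y).comp (.fst ℝ _ _)) z₀ :=
    HasFDerivAt.comp (g := hopfSection q) z₀
      ((contDiffAt_hopfSection hq hy h).differentiableAt (by simp)).hasFDerivAt hasFDerivAt_fst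
  have hunit : HasFDerivAt (fun z : R5 × (ℝ × ℝ × ℝ) ↦ unitChart z.2)
      (imag.comp (.snd ℝ _ _)) z₀ :=
    HasFDerivAt.comp (g := unitChart) z₀ hasFDerivAt_unitChart hasFDerivAt_snd
  refine ((rightMul.hasFDerivAt.comp z₀ hsec).clm_apply hunit).congr_fderiv
    (ContinuousLinearMap.ext fun z ↦ ?_)
  simp [z₀, unitChart_zero, rightMul_one, add_comm]

lemma IsLocalParam.hasFDerivAt_hopfChart {d : ℕ} {M : Set R5}
    {U : Set (EuclideanSpace ℝ (Fin d))} {c : EuclideanSpace ℝ (Fin d) → R5} {q : R8}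
    (hc : IsLocalParam d M U c) (hM : M ⊆ sphere 0 1) (hq : q ∈ sphere (0 : R8) 1)
    {u : EuclideanSpace ℝ (Fin d)} (hu : u ∈ U) (hne : c u ≠ -hopf q) :
    HasFDerivAt (HopfTaut.hopfChart q c)
      ((((fderiv ℝ (hopfSection q) (c u)).comp (fderiv ℝ c u)).coprod
        ((rightMul (hopfSection q (c u))).comp imag)).comp (splitCoord d : _ →L[ℝ] _))
      ((splitCoord d).symm (u, 0)) := by
  have hbundle := hasFDerivAt_bundleChart hq (hM (hc.mem hu)) hne
  have hmap : HasFDerivAt (Prod.map c id) ((fderiv ℝ c u).prodMap (.id ℝ _))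
      (u, (0 : ℝ × ℝ × ℝ)) :=
    (hc.differentiableAt hu).hasFDerivAt.prodMap _ (hasFDerivAt_id _)
  have hcomp := HasFDerivAt.comp (g := bundleChart q) (u, (0 : ℝ × ℝ × ℝ)) hbundle hmap
  rw [← (splitCoord d).apply_symm_apply (u, 0)] at hcomp
  refine (hcomp.comp _ (splitCoord d).hasFDerivAt).congr_fderiv
    (ContinuousLinearMap.ext fun v ↦ ?_)
  simp

/-! ## Critical points of height functions on the preimage under the Hopf map -/

section HalfAngle

/-- The map `cos θ ↦ cos (θ / 2)` for `|θ| ≤ π`, relating heights on the base to heights on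
local sections of the Hopf map. -/
def halfAngle (t : ℝ) : ℝ := √(2 * (1 + t)) / 2

lemma contDiffAt_halfAngle {t : ℝ} (ht : 0 < 1 + t) {n : WithTop ℕ∞} :
    ContDiffAt ℝ n halfAngle t := by
  have h : 2 * (1 + t) ≠ 0 := by positivity
  exact ((contDiffAt_const.mul (contDiffAt_const.add contDiffAt_id)).sqrt h).div_const 2

lemma deriv_halfAngle_ne_zero {t : ℝ} (ht : 0 < 1 + t) : deriv halfAngle t ≠ 0 := by
  have h : 2 * (1 + t) ≠ 0 := by positivity
  have hlin : HasDerivAt (fun t : ℝ ↦ 2 * (1 + t)) (2 * 1) t :=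
    ((hasDerivAt_id t).const_add 1).const_mul 2
  have hderiv : HasDerivAt halfAngle _ t := (hlin.sqrt h).div_const 2
  rw [hderiv.deriv]
  positivity

variable {p : R8} {y : R5} (hp : p ∈ sphere (0 : R8) 1) (hy : y ∈ sphere (0 : R5) 1)
  (h : y ≠ -hopf p)
include hp hy h

lemma one_add_inner_hopf_pos : 0 < 1 + inner ℝ (hopf p) y := by
  have hsq := pow_pos (norm_preSection_pos hp hy h) 2
  rw [norm_preSection_sq hp hy, real_inner_comm] at hsq
  linarith

lemma inner_hopfSection : inner ℝ p (hopfSection p y) = halfAngle (inner ℝ (hopf p) y) := by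
  rw [← re_hermitian, hermitian_hopfSection hp hy h, Quaternion.re_coe, halfAngle,
    real_inner_comm, ← norm_preSection_sq hp hy, Real.sqrt_sq (norm_nonneg _)]

lemma inner_rightMul_hopfSection_imag (ζ : ℝ × ℝ × ℝ) :
    inner ℝ p (rightMul (hopfSection p y) (imag ζ)) = 0 := by
  rw [inner_rightMul_hopfSection hp hy h, re_imag, mul_zero]

end HalfAngle

section UnitQuaternions

lemma eq_one_or_eq_neg_one_of_imCoord_eq_zero {g : ℍ[ℝ]} (hg : ‖g‖ = 1) (h : imCoord g = 0) :
    g = 1 ∨ g = -1 := by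
  have hre : (g.re : ℍ[ℝ]) = g := by simpa [h] using re_add_imag g
  rw [← hre, Quaternion.norm_coe, Real.norm_eq_abs, abs_eq zero_le_one] at hg
  rcases hg with hg | hg
  · left; rw [← hre, hg, Quaternion.coe_one]
  · right; rw [← hre, hg, Quaternion.coe_neg, Quaternion.coe_one]

lemma imCoord_eq_zero {a : ℍ[ℝ]} (h : ∀ ζ, (a * imag ζ).re = 0) : imCoord a = 0 := by
  have hre (ζ : ℝ × ℝ × ℝ) : a.imI * ζ.1 + a.imJ * ζ.2.1 + a.imK * ζ.2.2 = 0 := by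
    have hζ : a.re * 0 - a.imI * ζ.1 - a.imJ * ζ.2.1 - a.imK * ζ.2.2 = 0 :=
      (Quaternion.re_mul a (imag ζ)).symm.trans (h ζ)
    linarith
  have hI : a.imI = 0 := by simpa using hre (1, 0, 0)
  have hJ : a.imJ = 0 := by simpa using hre (0, 1, 0)
  have hK : a.imK = 0 := by simpa using hre (0, 0, 1)
  exact Prod.ext hI (Prod.ext hJ hK)

lemma eq_or_eq_neg_hopfSection {p x : R8} (hp : p ∈ sphere (0 : R8) 1)
    (hx : x ∈ sphere (0 : R8) 1) (h : hopf x ≠ -hopf p) (him : imCoord (hermitian p x) = 0) :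
    x = hopfSection p (hopf x) ∨ x = -hopfSection p (hopf x) := by
  have hy := hopf_mem_sphere hx
  have hpos := norm_preSection_pos hp hy h
  have hnorm := norm_hermitian_hopfSection hp hx h
  have hg := rightMul_hermitian_hopfSection hp hx h
  generalize hermitian (hopfSection p (hopf x)) x = g at hg hnorm
  have himg : imCoord g = 0 := by
    rw [← hg, hermitian_rightMul, hermitian_hopfSection hp hy h, Quaternion.coe_mul_eq_smul,
      map_smul] at him
    exact (smul_eq_zero.1 him).resolve_left (by positivity)
  rcases eq_one_or_eq_neg_one_of_imCoord_eq_zero hnorm himg with rfl | rfl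
  · exact .inl (hg.symm.trans (rightMul_one _))
  · exact .inr (hg.symm.trans (by rw [map_neg, rightMul_one]))

end UnitQuaternions

lemma encard_hopfSection_image_union {p : R8} {T : Set R5} (hp : p ∈ sphere (0 : R8) 1)
    (hT : T ⊆ sphere 0 1) (hne : -hopf p ∉ T) :
    (hopfSection p '' T ∪ (fun y ↦ -hopfSection p y) '' T).encard = 2 * T.encard := by
  have hne' {y} (hy : y ∈ T) : y ≠ -hopf p := fun h ↦ hne (h ▸ hy)
  have hopf_sec {y} (hy : y ∈ T) := hopf_hopfSection hp (hT hy) (hne' hy)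
  have hinj : InjOn (hopfSection p) T := fun y hy y' hy' h ↦ by
    rw [← hopf_sec hy, h, hopf_sec hy']
  have hinj' : InjOn (fun y ↦ -hopfSection p y) T := fun y hy y' hy' h ↦
    hinj hy hy' (neg_injective h)
  have hdisj : Disjoint (hopfSection p '' T) ((fun y ↦ -hopfSection p y) '' T) := by
    rw [Set.disjoint_left]
    rintro _ ⟨y, hy, rfl⟩ ⟨y', hy', h⟩
    obtain rfl : y' = y := by
      rw [← hopf_sec hy', ← hopf_neg, ← hopf_sec hy]
      exact congrArg hopf h
    exact ne_neg_of_mem_unit_sphere ℝ ⟨_, hopfSection_mem_sphere hp (hT hy) (hne' hy)⟩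
      (Subtype.ext h.symm)
  rw [encard_union_eq hdisj, hinj.encard_image, hinj'.encard_image, two_mul]

lemma isCriticalPt_height_neg_iff {E : Type} [NormedAddCommGroup E] [InnerProductSpace ℝ E]
    {d : ℕ} {M : Set E} (hsub : IsSubmanifold d M) (p : E) {x : E} (hx : x ∈ M) :
    IsCriticalPt d M (height (-p)) x ↔ IsCriticalPt d M (height p) x := by
  obtain ⟨U, c, h, u, hu, rfl⟩ := hsub x hx
  simp only [h.isCriticalPt_height_iff hu, inner_neg_left, neg_eq_zero]

section CriticalPoints

variable {d : ℕ} {M : Set R5} {U : Set (EuclideanSpace ℝ (Fin d))}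
  {c : EuclideanSpace ℝ (Fin d) → R5} {p q x : R8} {u : EuclideanSpace ℝ (Fin d)}

lemma hopfChart_symm (q : R8) (c : EuclideanSpace ℝ (Fin d) → R5) (u : EuclideanSpace ℝ (Fin d)) :
    hopfChart q c ((splitCoord d).symm (u, 0)) = hopfSection q (c u) := by
  rw [hopfChart, ContinuousLinearEquiv.apply_symm_apply, bundleChart, Prod.map, id,
    unitChart_zero, rightMul_one]

lemma symm_mem_chartDomain (hu : u ∈ U) (hne : c u ≠ -hopf q) :
    (splitCoord d).symm (u, 0) ∈ chartDomain U c q := by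
  simp only [chartDomain, mem_ofPred_eq, ContinuousLinearEquiv.apply_symm_apply]
  exact ⟨hu, hne⟩

section LocalParam

variable (h : IsLocalParam d M U c) (hM : M ⊆ sphere 0 1) (hu : u ∈ U)
include h hM hu

lemma IsLocalParam.isCriticalPt_hopfSection_iff (p : R8) (hq : q ∈ sphere (0 : R8) 1)
    (hne : c u ≠ -hopf q) :
    IsCriticalPt (d + 3) (hopfPreimage M) (height p) (hopfSection q (c u)) ↔
      (∀ v, inner ℝ p (fderiv ℝ (hopfSection q) (c u) (fderiv ℝ c u v)) = 0) ∧
        ∀ ζ, inner ℝ p (rightMul (hopfSection q (c u)) (imag ζ)) = 0 := by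
  rw [← hopfChart_symm,
    (h.hopfChart hM hq).isCriticalPt_height_iff (symm_mem_chartDomain hu hne),
    (h.hasFDerivAt_hopfChart hM hq hu hne).fderiv, hopfChart_symm]
  constructor
  · intro hcrit
    refine ⟨fun v ↦ ?_, fun ζ ↦ ?_⟩
    · simpa using hcrit ((splitCoord d).symm (v, 0))
    · simpa using hcrit ((splitCoord d).symm (0, ζ))
  · rintro ⟨hbase, hfibre⟩ z
    simp [inner_add_right, hbase, hfibre]

variable (hp : p ∈ sphere (0 : R8) 1) (hne : c u ≠ -hopf p)
include hp hne

lemma IsLocalParam.eventually_height_hopfSection :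
    height p ∘ hopfSection p ∘ c =ᶠ[𝓝 u] halfAngle ∘ height (hopf p) ∘ c := by
  filter_upwards [h.isOpen.mem_nhds hu, (h.contDiffAt hu).continuousAt.eventually_ne hne]
    with u' hu' hne' using inner_hopfSection hp (hM (h.mem hu')) hne'

lemma IsLocalParam.hasFDerivAt_height_hopfSection :
    HasFDerivAt (height p ∘ hopfSection p ∘ c)
      ((innerSL ℝ p).comp ((fderiv ℝ (hopfSection p) (c u)).comp (fderiv ℝ c u))) u :=
  (innerSL ℝ p).hasFDerivAt.comp u <|
    ((contDiffAt_hopfSection hp (hM (h.mem hu)) hne).differentiableAt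
      (by simp)).hasFDerivAt.comp u (h.differentiableAt hu).hasFDerivAt

lemma IsLocalParam.isCriticalPt_hopfSection_self_iff :
    IsCriticalPt (d + 3) (hopfPreimage M) (height p) (hopfSection p (c u)) ↔
      IsCriticalPt d M (height (hopf p)) (c u) := by
  have hy := hM (h.mem hu)
  have hpos := one_add_inner_hopf_pos hp hy hne
  have hchain : HasFDerivAt (height p ∘ hopfSection p ∘ c) _ u :=
    (((contDiffAt_halfAngle hpos (n := 1)).differentiableAt one_ne_zero).hasDerivAt
      |>.comp_hasFDerivAt u (h.hasFDerivAt_height hu (hopf p))).congr_of_eventuallyEq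
        (h.eventually_height_hopfSection hM hu hp hne)
  have hderiv (v) : inner ℝ p (fderiv ℝ (hopfSection p) (c u) (fderiv ℝ c u v)) =
      deriv halfAngle (inner ℝ (hopf p) (c u)) * inner ℝ (hopf p) (fderiv ℝ c u v) :=
    DFunLike.congr_fun ((h.hasFDerivAt_height_hopfSection hM hu hp hne).unique hchain) v
  rw [h.isCriticalPt_hopfSection_iff hM hu p hp hne, h.isCriticalPt_height_iff hu]
  simp only [hderiv, mul_eq_zero, deriv_halfAngle_ne_zero hpos, false_or,
    inner_rightMul_hopfSection_imag hp hy hne, implies_true, and_true]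

end LocalParam

variable (hM : M ⊆ sphere 0 1) (hsub : IsSubmanifold d M)
include hM hsub

lemma imCoord_hermitian_eq_zero_of_isCriticalPt (hx : x ∈ hopfPreimage M)
    (hcrit : IsCriticalPt (d + 3) (hopfPreimage M) (height p) x) :
    imCoord (hermitian p x) = 0 := by
  obtain ⟨U, c, h, u, hu, hux⟩ := hsub _ hx.2
  have hiff := h.isCriticalPt_hopfSection_iff hM hu p hx.1 (hux ▸ hopf_ne_neg_self hx.1)
  rw [hux, hopfSection_hopf_self hx.1] at hiff
  refine imCoord_eq_zero fun ζ ↦ ?_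
  rw [← hermitian_rightMul, re_hermitian]
  exact (hiff.1 hcrit).2 ζ

variable (hp : p ∈ sphere (0 : R8) 1)
include hp

lemma isCriticalPt_iff_of_eq_hopfSection (hx : x ∈ hopfPreimage M) (hne : hopf x ≠ -hopf p)
    (hxp : x = hopfSection p (hopf x)) :
    IsCriticalPt (d + 3) (hopfPreimage M) (height p) x ↔
      IsCriticalPt d M (height (hopf p)) (hopf x) := by
  obtain ⟨U, c, h, u, hu, hux⟩ := hsub _ hx.2
  have hiff := h.isCriticalPt_hopfSection_self_iff hM hu hp (hux.trans_ne hne)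
  rwa [hux, ← hxp] at hiff

lemma isCriticalPt_hopfPreimage_iff (hx : x ∈ hopfPreimage M) (hne : hopf x ≠ -hopf p) :
    IsCriticalPt (d + 3) (hopfPreimage M) (height p) x ↔
      (x = hopfSection p (hopf x) ∨ x = -hopfSection p (hopf x)) ∧
        IsCriticalPt d M (height (hopf p)) (hopf x) := by
  have hiff (hxp : x = hopfSection p (hopf x) ∨ x = -hopfSection p (hopf x)) :
      IsCriticalPt (d + 3) (hopfPreimage M) (height p) x ↔
        IsCriticalPt d M (height (hopf p)) (hopf x) := by
    rcases hxp with hxp | hxp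
    · exact isCriticalPt_iff_of_eq_hopfSection hM hsub hp hx hne hxp
    · rw [← hopfSection_neg] at hxp
      rw [← isCriticalPt_height_neg_iff (hsub.hopfPreimage hM) p hx, ← hopf_neg p]
      exact isCriticalPt_iff_of_eq_hopfSection hM hsub (by simpa using hp) hx (by rwa [hopf_neg])
        hxp
  refine ⟨fun hcrit ↦ ?_, fun hcrit ↦ (hiff hcrit.1).2 hcrit.2⟩
  have hxp := eq_or_eq_neg_hopfSection hp hx.1 hne
    (imCoord_hermitian_eq_zero_of_isCriticalPt hM hsub hx hcrit)
  exact ⟨hxp, (hiff hxp).1 hcrit⟩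

lemma heightCriticalSet_hopfPreimage_sdiff :
    heightCriticalSet (d + 3) (hopfPreimage M) p \ hopf ⁻¹' {-hopf p} =
      hopfSection p '' (heightCriticalSet d M (hopf p) \ {-hopf p}) ∪
        (fun y ↦ -hopfSection p y) '' (heightCriticalSet d M (hopf p) \ {-hopf p}) := by
  ext x
  constructor
  · rintro ⟨⟨hx, hcrit⟩, hne⟩
    obtain ⟨hxp | hxp, hcrit'⟩ := (isCriticalPt_hopfPreimage_iff hM hsub hp hx hne).1 hcrit
    · exact .inl ⟨_, ⟨⟨hx.2, hcrit'⟩, hne⟩, hxp.symm⟩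
    · exact .inr ⟨_, ⟨⟨hx.2, hcrit'⟩, hne⟩, hxp.symm⟩
  · rintro (⟨y, ⟨⟨hy, hcrit⟩, hne⟩, rfl⟩ | ⟨y, ⟨⟨hy, hcrit⟩, hne⟩, rfl⟩)
    all_goals
      have hopf_sec : hopf (hopfSection p y) = y := hopf_hopfSection hp (hM hy) hne
      have sec_mem : hopfSection p y ∈ sphere 0 1 := hopfSection_mem_sphere hp (hM hy) hne
    · have hx : hopfSection p y ∈ hopfPreimage M := ⟨sec_mem, by rwa [hopf_sec]⟩
      refine ⟨⟨hx, (isCriticalPt_hopfPreimage_iff hM hsub hp hx ?_).2 ?_⟩, ?_⟩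
      all_goals simp only [mem_preimage, hopf_sec, true_or, true_and]
      exacts [hne, hcrit, hne]
    · have hx : -hopfSection p y ∈ hopfPreimage M :=
        ⟨by simpa using sec_mem, by rwa [hopf_neg, hopf_sec]⟩
      refine ⟨⟨hx, (isCriticalPt_hopfPreimage_iff hM hsub hp hx ?_).2 ?_⟩, ?_⟩
      all_goals simp only [mem_preimage, hopf_neg, hopf_sec, or_true, true_and]
      exacts [hne, hcrit, hne]

lemma encard_heightCriticalSet_hopfPreimage_sdiff :
    (heightCriticalSet (d + 3) (hopfPreimage M) p \ hopf ⁻¹' {-hopf p}).encard =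
      2 * (heightCriticalSet d M (hopf p) \ {-hopf p}).encard := by
  rw [heightCriticalSet_hopfPreimage_sdiff hM hsub hp]
  exact encard_hopfSection_image_union hp (fun y hy ↦ hM hy.1.1) fun h ↦ h.2 rfl

theorem encard_heightCriticalSet_hopfPreimage (hne : -hopf p ∉ M) :
    (heightCriticalSet (d + 3) (hopfPreimage M) p).encard =
      2 * (heightCriticalSet d M (hopf p)).encard := by
  have hbase : heightCriticalSet d M (hopf p) \ {-hopf p} = heightCriticalSet d M (hopf p) :=
    sdiff_singleton_eq_self fun h ↦ hne h.1
  have htotal : heightCriticalSet (d + 3) (hopfPreimage M) p \ hopf ⁻¹' {-hopf p} =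
      heightCriticalSet (d + 3) (hopfPreimage M) p :=
    sdiff_eq_left.2 <| Set.disjoint_left.2 fun x hx hxp ↦ hne <| mem_singleton_iff.1 hxp ▸ hx.1.2
  rw [← htotal, encard_heightCriticalSet_hopfPreimage_sdiff hM hsub hp, hbase]

end CriticalPoints

section Nondegeneracy

lemma NondegAt.congr {P : Type*} [NormedAddCommGroup P] [NormedSpace ℝ P] {F G : P → ℝ} {u : P}
    (hF : NondegAt F u) (hFG : F =ᶠ[𝓝 u] G) : NondegAt G u := by
  rwa [NondegAt, ← hFG.fderiv.fderiv_eq]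

lemma NondegAt.of_fderiv_eq_comp {P Q : Type*} [NormedAddCommGroup P] [NormedSpace ℝ P]
    [NormedAddCommGroup Q] [NormedSpace ℝ Q] {F : Q → ℝ} {A : P → ℝ} {ι : P →L[ℝ] Q}
    {π : Q →L[ℝ] P} {u : P} (hn : NondegAt F (ι u)) (hι : Function.Injective ι)
    (hF : DifferentiableAt ℝ (fderiv ℝ F) (ι u)) (hA : DifferentiableAt ℝ (fderiv ℝ A) u)
    (h : ∀ᶠ u' in 𝓝 u, fderiv ℝ F (ι u') = (fderiv ℝ A u').comp π) : NondegAt A u := by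
  intro v hv
  have hFA := (hF.hasFDerivAt.comp u ι.hasFDerivAt).unique
    ((hA.hasFDerivAt.clm_comp (hasFDerivAt_const π u)).congr_of_eventuallyEq h)
  refine (map_eq_zero_iff ι hι).1 <| hn _ fun w ↦ ?_
  have happly : fderiv ℝ (fderiv ℝ F) (ι u) (ι v) w = fderiv ℝ (fderiv ℝ A) u v (π w) := by
    simpa using DFunLike.congr_fun (DFunLike.congr_fun hFA v) w
  rw [happly, hv]

variable {d : ℕ} {M : Set R5} {U : Set (EuclideanSpace ℝ (Fin d))}
  {c : EuclideanSpace ℝ (Fin d) → R5} {p : R8} {u : EuclideanSpace ℝ (Fin d)}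
  (h : IsLocalParam d M U c) (hM : M ⊆ sphere 0 1) (hp : p ∈ sphere (0 : R8) 1) (hu : u ∈ U)
  (hne : c u ≠ -hopf p)
include h hM hp hu hne

lemma IsLocalParam.fderiv_height_hopfChart :
    fderiv ℝ (height p ∘ HopfTaut.hopfChart p c) ((splitCoord d).symm (u, 0)) =
      (fderiv ℝ (height p ∘ hopfSection p ∘ c) u).comp
        ((ContinuousLinearMap.fst ℝ _ (ℝ × ℝ × ℝ)).comp (splitCoord d : _ →L[ℝ] _)) := by
  have hF : HasFDerivAt (height p ∘ HopfTaut.hopfChart p c) _ ((splitCoord d).symm (u, 0)) :=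
    (innerSL ℝ p).hasFDerivAt.comp _ (h.hasFDerivAt_hopfChart hM hp hu hne)
  rw [(h.hasFDerivAt_height_hopfSection hM hu hp hne).fderiv, hF.fderiv]
  ext z
  simp [inner_add_right, inner_rightMul_hopfSection_imag hp (hM (h.mem hu)) hne]

lemma IsLocalParam.nondegAt_of_hopfChart (hcrit : fderiv ℝ (height (hopf p) ∘ c) u = 0)
    (hn : NondegAt (height p ∘ HopfTaut.hopfChart p c) ((splitCoord d).symm (u, 0))) :
    NondegAt (height (hopf p) ∘ c) u := by
  have hhalf : ContDiffAt ℝ 2 halfAngle ((height (hopf p) ∘ c) u) :=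
    contDiffAt_halfAngle (one_add_inner_hopf_pos hp (hM (h.mem hu)) hne)
  have hheight := h.contDiffAt_height hu (hopf p)
  have heq := h.eventually_height_hopfSection hM hu hp hne
  rw [← nondegAt_real_comp_iff hheight hhalf hcrit
    (deriv_halfAngle_ne_zero (one_add_inner_hopf_pos hp (hM (h.mem hu)) hne))]
  refine NondegAt.congr ?_ heq
  have hF := (h.hopfChart hM hp).contDiffAt_height (symm_mem_chartDomain hu hne) p
  have hA : ContDiffAt ℝ 2 (height p ∘ hopfSection p ∘ c) u :=
    (hhalf.comp u hheight).congr_of_eventuallyEq heq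
  let ι : EuclideanSpace ℝ (Fin d) →L[ℝ] EuclideanSpace ℝ (Fin (d + 3)) :=
    ((splitCoord d).symm : _ →L[ℝ] _).comp (.inl ℝ _ (ℝ × ℝ × ℝ))
  refine NondegAt.of_fderiv_eq_comp (F := height p ∘ HopfTaut.hopfChart p c) (ι := ι)
    (π := (ContinuousLinearMap.fst ℝ _ (ℝ × ℝ × ℝ)).comp (splitCoord d : _ →L[ℝ] _)) hn
    ((splitCoord d).symm.injective.comp (Prod.mk_left_injective 0))
    ((hF.fderiv_right (m := 1) (by norm_num)).differentiableAt one_ne_zero)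
    ((hA.fderiv_right (m := 1) (by norm_num)).differentiableAt one_ne_zero) ?_
  filter_upwards [h.isOpen.mem_nhds hu, (h.contDiffAt hu).continuousAt.eventually_ne hne]
    with u' hu' hne' using h.fderiv_height_hopfChart hM hp hu' hne'

end Nondegeneracy

section Fibre

lemma hermitian_eq_zero {p x : R8} (hp : p ∈ sphere (0 : R8) 1) (hx : x ∈ sphere (0 : R8) 1)
    (h : hopf x = -hopf p) : hermitian p x = 0 := by
  have hrm : rightMul p (hermitian p x) = 0 := by
    rw [rightMul_hermitian, ← neg_eq_iff_eq_neg.2 h, map_neg, neg_apply, cliffordMul_hopf_self,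
      mem_sphere_zero_iff_norm.1 hp, mem_sphere_zero_iff_norm.1 hx, add_neg_cancel, smul_zero]
  have hnorm := congrArg norm hrm
  rw [norm_rightMul, mem_sphere_zero_iff_norm.1 hp, one_mul, norm_zero] at hnorm
  exact norm_eq_zero.1 hnorm

lemma inner_fderiv_hopfSection_hopf_self {p x : R8} (hx : x ∈ sphere (0 : R8) 1)
    (hpx : inner ℝ p x = 0) (v : R5) :
    inner ℝ p (fderiv ℝ (hopfSection x) (hopf x) v) = 2⁻¹ * inner ℝ p (cliffordMul v x) := by
  have hpre := preSection_hopf_self hx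
  have hnorm : ‖preSection x (hopf x)‖ = 2 := by
    rw [hpre, norm_smul, mem_sphere_zero_iff_norm.1 hx]
    norm_num
  have hpreD : HasFDerivAt (preSection x) (cliffordMul.flip x) (hopf x) :=
    (cliffordMul.flip x).hasFDerivAt.const_add x
  have hinvD : DifferentiableAt ℝ (fun y ↦ ‖preSection x y‖⁻¹) (hopf x) :=
    (hpreD.differentiableAt.norm ℝ (norm_pos_iff.1 (by rw [hnorm]; norm_num))).inv
      (by rw [hnorm]; norm_num)
  have hsec : HasFDerivAt (hopfSection x) _ (hopf x) := hinvD.hasFDerivAt.smul hpreD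
  rw [hsec.fderiv, hnorm, hpre]
  simp [inner_add_right, inner_smul_right, hpx, -WithLp.prod_inner_apply]

lemma IsLocalParam.isCriticalPt_fibre_iff {d : ℕ} {M : Set R5}
    {U : Set (EuclideanSpace ℝ (Fin d))} {c : EuclideanSpace ℝ (Fin d) → R5} {p x : R8}
    (h : IsLocalParam d M U c) (hM : M ⊆ sphere 0 1) (hp : p ∈ sphere (0 : R8) 1)
    (hx : x ∈ sphere (0 : R8) 1) {u : EuclideanSpace ℝ (Fin d)} (hu : u ∈ U) (hux : c u = hopf x)
    (hxp : hopf x = -hopf p) :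
    IsCriticalPt (d + 3) (hopfPreimage M) (height p) x ↔
      ∀ v, inner ℝ p (cliffordMul (fderiv ℝ c u v) x) = 0 := by
  have hiff := h.isCriticalPt_hopfSection_iff hM hu p hx (hux ▸ hopf_ne_neg_self hx)
  rw [hux, hopfSection_hopf_self hx] at hiff
  have hherm : hermitian p x = 0 := hermitian_eq_zero hp hx hxp
  have hpx : inner ℝ p x = 0 := by rw [← re_hermitian, hherm, Quaternion.re_zero]
  have hfibre (ζ : ℝ × ℝ × ℝ) : inner ℝ p (rightMul x (imag ζ)) = 0 := by
    rw [← re_hermitian, hermitian_rightMul, hherm, zero_mul, Quaternion.re_zero]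
  rw [hiff]
  simp only [inner_fderiv_hopfSection_hopf_self hx hpx, hfibre, implies_true, and_true,
    mul_eq_zero, inv_eq_zero, OfNat.ofNat_ne_zero, false_or]

end Fibre

open Module
open scoped Pointwise

/-! ## Dimension and measure of submanifolds of spheres -/

lemma isConnected_unit_sphere_of_finrank {E : Type*} [NormedAddCommGroup E] [NormedSpace ℝ E]
    {d : ℕ} (hd : finrank ℝ E = d + 1) (hd0 : d ≠ 0) : IsConnected (sphere (0 : E) 1) := by
  have : FiniteDimensional ℝ E := finite_of_finrank_eq_succ hd
  refine isConnected_sphere ?_ 0 zero_le_one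
  rw [← finrank_eq_rank, hd]
  exact_mod_cast (by omega : 1 < d + 1)

section Dimension

variable {E : Type} [NormedAddCommGroup E] [InnerProductSpace ℝ E] {d : ℕ} {M : Set E}
  {U : Set (EuclideanSpace ℝ (Fin d))} {c : EuclideanSpace ℝ (Fin d) → E}
  {u : EuclideanSpace ℝ (Fin d)}

lemma IsLocalParam.inner_fderiv (h : IsLocalParam d M U c) (hM : M ⊆ sphere 0 1) (hu : u ∈ U)
    (v : EuclideanSpace ℝ (Fin d)) : inner ℝ (c u) (fderiv ℝ c u v) = 0 := by
  have hconst : (fun u' ↦ ‖c u'‖ ^ 2) =ᶠ[𝓝 u] fun _ ↦ (1 : ℝ) := by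
    filter_upwards [h.isOpen.mem_nhds hu] with u' hu'
    rw [mem_sphere_zero_iff_norm.1 (hM (h.mem hu')), one_pow]
  have hderiv := (h.differentiableAt hu).hasFDerivAt.norm_sq.unique
    ((hasFDerivAt_const (1 : ℝ) u).congr_of_eventuallyEq hconst)
  simpa using DFunLike.congr_fun hderiv v

lemma IsLocalParam.finrank_range (h : IsLocalParam d M U c) (hu : u ∈ U) :
    finrank ℝ (fderiv ℝ c u).range = d := by
  rw [LinearMap.finrank_range_of_inj (h.immersion u hu), finrank_euclideanSpace_fin]

lemma IsLocalParam.ne_zero (h : IsLocalParam d M U c) (hM : M ⊆ sphere 0 1) (hu : u ∈ U) :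
    c u ≠ 0 :=
  ne_zero_of_mem_unit_sphere ⟨c u, hM (h.mem hu)⟩

lemma IsSubmanifold.dim_lt [FiniteDimensional ℝ E] (hsub : IsSubmanifold d M)
    (hM : M ⊆ sphere 0 1) (hne : M.Nonempty) : d < finrank ℝ E := by
  obtain ⟨x, hx⟩ := hne
  obtain ⟨U, c, h, u, hu, rfl⟩ := hsub x hx
  rw [← h.finrank_range hu]
  refine Submodule.finrank_lt fun htop ↦ ?_
  obtain ⟨v, hv⟩ : c u ∈ (fderiv ℝ c u).range := htop ▸ Submodule.mem_top
  have horth := h.inner_fderiv hM hu v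
  rw [show fderiv ℝ c u v = c u from hv, inner_self_eq_zero] at horth
  exact h.ne_zero hM hu horth

lemma IsLocalParam.exists_smul_eq [FiniteDimensional ℝ E] (h : IsLocalParam d M U c)
    (hM : M ⊆ sphere 0 1) (hd : finrank ℝ E = d + 1) (hu : u ∈ U) {p : E}
    (hp : ∀ v, inner ℝ p (fderiv ℝ c u v) = 0) : ∃ r : ℝ, r • c u = p := by
  have mem_orthogonal {p : E} (hp : ∀ v, inner ℝ p (fderiv ℝ c u v) = 0) :
      p ∈ (fderiv ℝ c u).rangeᗮ := by
    rw [Submodule.mem_orthogonal']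
    rintro _ ⟨v, rfl⟩
    exact hp v
  have hline : finrank ℝ (fderiv ℝ c u).rangeᗮ = 1 := by
    have hsum := (fderiv ℝ c u).range.finrank_add_finrank_orthogonal
    rw [h.finrank_range hu] at hsum
    omega
  obtain ⟨r, hr⟩ := (finrank_eq_one_iff_of_nonzero'
    (⟨c u, mem_orthogonal (h.inner_fderiv hM hu)⟩ : (fderiv ℝ c u).rangeᗮ)
    (fun h0 ↦ h.ne_zero hM hu (congrArg Subtype.val h0))).1 hline ⟨p, mem_orthogonal hp⟩
  exact ⟨r, congrArg Subtype.val hr⟩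

/-- The map `(r, u) ↦ r • c u` parametrizing the cone over the image of `c`. -/
def radialExtension {P : Type*} (c : P → E) (z : ℝ × P) : E := z.1 • c z.2

lemma IsLocalParam.contDiffOn_radialExtension (h : IsLocalParam d M U c) :
    ContDiffOn ℝ ∞ (radialExtension c) (univ ×ˢ U) :=
  contDiff_fst.contDiffOn.smul (h.contDiffOn.comp contDiff_snd.contDiffOn fun _ hz ↦ hz.2)

lemma IsLocalParam.hasStrictFDerivAt_radialExtension (h : IsLocalParam d M U c) (hu : u ∈ U) :
    HasStrictFDerivAt (radialExtension c)
      ((fderiv ℝ c u).comp (.snd ℝ ℝ _) + (ContinuousLinearMap.fst ℝ ℝ _).smulRight (c u))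
      (1, u) := by
  have hsmooth : ContDiffAt ℝ ∞ (radialExtension c) (1, u) :=
    h.contDiffOn_radialExtension.contDiffAt
      ((isOpen_univ.prod h.isOpen).mem_nhds ⟨mem_univ _, hu⟩)
  refine hsmooth.hasStrictFDerivAt' ?_ (by simp)
  have hfst : HasFDerivAt (fun z : ℝ × EuclideanSpace ℝ (Fin d) ↦ z.1)
      (ContinuousLinearMap.fst ℝ ℝ _) (1, u) := hasFDerivAt_fst
  have hsnd : HasFDerivAt (fun z : ℝ × EuclideanSpace ℝ (Fin d) ↦ c z.2)
      ((fderiv ℝ c u).comp (.snd ℝ ℝ _)) (1, u) :=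
    HasFDerivAt.comp (g := c) (1, u) (h.differentiableAt hu).hasFDerivAt hasFDerivAt_snd
  exact (hfst.smul hsnd).congr_fderiv (by rw [one_smul])

lemma IsLocalParam.range_fderiv_radialExtension [FiniteDimensional ℝ E]
    (h : IsLocalParam d M U c) (hM : M ⊆ sphere 0 1) (hd : finrank ℝ E = d + 1) (hu : u ∈ U) :
    ((fderiv ℝ c u).comp (.snd ℝ ℝ _) +
      (ContinuousLinearMap.fst ℝ ℝ _).smulRight (c u)).range = ⊤ := by
  rw [← Submodule.orthogonal_eq_bot_iff, Submodule.eq_bot_iff]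
  intro p hp
  rw [Submodule.mem_orthogonal'] at hp
  obtain ⟨r, rfl⟩ := h.exists_smul_eq hM hd hu (p := p) fun v ↦ by
    simpa using hp _ ⟨(0, v), rfl⟩
  have hradial := hp _ ⟨(1, 0), rfl⟩
  simp only [ContinuousLinearMap.coe_coe, add_apply, ContinuousLinearMap.comp_apply,
    ContinuousLinearMap.coe_snd', map_zero, zero_add, ContinuousLinearMap.smulRight_apply,
    ContinuousLinearMap.coe_fst', one_smul, inner_smul_left, inner_self_eq_zero, mul_eq_zero,
    h.ne_zero hM hu, or_false, conj_trivial] at hradial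
  rw [hradial, zero_smul]

lemma IsLocalParam.mem_nhdsWithin_sphere [FiniteDimensional ℝ E] (h : IsLocalParam d M U c)
    (hM : M ⊆ sphere 0 1) (hd : finrank ℝ E = d + 1) (hu : u ∈ U) :
    M ∈ 𝓝[sphere 0 1] (c u) := by
  have hmap := (h.hasStrictFDerivAt_radialExtension hu).map_nhds_eq_of_surj
    (h.range_fderiv_radialExtension hM hd hu)
  have hnhds : Ioi (0 : ℝ) ×ˢ U ∈ 𝓝 ((1 : ℝ), u) :=
    (isOpen_Ioi.prod h.isOpen).mem_nhds ⟨mem_Ioi.2 zero_lt_one, hu⟩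
  have himage := image_mem_map (m := radialExtension c) hnhds
  rw [hmap, show radialExtension c (1, u) = c u from one_smul ℝ _] at himage
  refine mem_nhdsWithin_iff_exists_mem_nhds_inter.2 ⟨_, himage, ?_⟩
  rintro _ ⟨⟨⟨r, u'⟩, ⟨hr, hu'⟩, rfl⟩, hz⟩
  obtain rfl : r = 1 := by
    simpa [radialExtension, norm_smul, mem_sphere_zero_iff_norm.1 (hM (h.mem hu')),
      abs_of_pos (mem_Ioi.1 hr)] using mem_sphere_zero_iff_norm.1 hz
  simpa only [radialExtension, one_smul] using h.mem hu'

lemma IsSubmanifold.eq_sphere (hsub : IsSubmanifold d M) (hM : M ⊆ sphere 0 1)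
    (hne : M.Nonempty) (hclosed : IsClosed M) (hd : finrank ℝ E = d + 1) (hd0 : d ≠ 0) :
    M = sphere 0 1 := by
  have : FiniteDimensional ℝ E := finite_of_finrank_eq_succ hd
  have : PreconnectedSpace (sphere (0 : E) 1) := isPreconnected_iff_preconnectedSpace.1
    (isConnected_unit_sphere_of_finrank hd hd0).isPreconnected
  have hclopen : IsClopen (Subtype.val ⁻¹' M : Set (sphere (0 : E) 1)) := by
    refine ⟨hclosed.preimage continuous_subtype_val, isOpen_iff_mem_nhds.2 ?_⟩
    rintro ⟨x, hx⟩ hxM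
    obtain ⟨U, c, h, u, hu, rfl⟩ := hsub x hxM
    exact preimage_coe_mem_nhds_subtype.2 (h.mem_nhdsWithin_sphere hM hd hu)
  obtain ⟨x, hx⟩ := hne
  have huniv := hclopen.eq_univ ⟨⟨x, hM hx⟩, hx⟩
  exact hM.antisymm fun y hy ↦ huniv.ge (mem_univ ⟨y, hy⟩)

end Dimension

section Cone

lemma inv_norm_smul_smul {E : Type*} [NormedAddCommGroup E] [NormedSpace ℝ E] {r : ℝ}
    (hr : 0 < r) {x : E} (hx : x ∈ sphere (0 : E) 1) : ‖r • x‖⁻¹ • (r • x) = x := by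
  rw [norm_smul, mem_sphere_zero_iff_norm.1 hx, mul_one, Real.norm_of_nonneg hr.le, smul_smul,
    inv_mul_cancel₀ hr.ne', one_smul]

lemma tendsto_inv_norm_smul {E : Type*} [NormedAddCommGroup E] [NormedSpace ℝ E] {M : Set E}
    (hM : M ⊆ sphere 0 1) {r : ℝ} (hr : 0 < r) {x : E} (hx : x ∈ M) :
    Tendsto (fun z : E ↦ ‖z‖⁻¹ • z) (𝓝[Ioi (0 : ℝ) • M] (r • x)) (𝓝[M] x) := by
  refine tendsto_nhdsWithin_iff.2 ⟨?_, ?_⟩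
  · have hne : r • x ≠ 0 := smul_ne_zero hr.ne' (ne_zero_of_mem_unit_sphere ⟨x, hM hx⟩)
    have hcont : ContinuousAt (fun z : E ↦ ‖z‖⁻¹ • z) (r • x) :=
      (continuousAt_id.norm.inv₀ (norm_ne_zero_iff.2 hne)).smul continuousAt_id
    have htendsto := hcont.tendsto
    rw [inv_norm_smul_smul hr (hM hx)] at htendsto
    exact htendsto.mono_left nhdsWithin_le_nhds
  · filter_upwards [self_mem_nhdsWithin]
    rintro _ ⟨s, hs, y, hy, rfl⟩
    exact (inv_norm_smul_smul hs (hM hy)).symm ▸ hy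

variable {E : Type} [NormedAddCommGroup E] [InnerProductSpace ℝ E] [FiniteDimensional ℝ E]
  [MeasurableSpace E] [BorelSpace E] {d : ℕ} {M : Set E}

lemma IsLocalParam.measure_radialExtension_image_eq_zero {U : Set (EuclideanSpace ℝ (Fin d))}
    {c : EuclideanSpace ℝ (Fin d) → E} (h : IsLocalParam d M U c)
    (hd : d + 1 < finrank ℝ E) {B : Set (EuclideanSpace ℝ (Fin d))} (hB : Convex ℝ B)
    (hBU : B ⊆ U) (μ : Measure E) [μ.IsAddHaarMeasure] :
    μ (radialExtension c '' (univ ×ˢ B)) = 0 := by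
  have hsmooth : ContDiffOn ℝ 1 (radialExtension c) (univ ×ˢ B) :=
    (h.contDiffOn_radialExtension.mono (prod_mono_right hBU)).of_le (by exact_mod_cast le_top)
  have hdim : dimH (radialExtension c '' (univ ×ˢ B)) ≤ (d + 1 : ℕ) :=
    calc dimH (radialExtension c '' (univ ×ˢ B))
      _ ≤ dimH ((univ : Set ℝ) ×ˢ B) :=
        hsmooth.dimH_image_le (convex_univ.prod hB) subset_rfl
      _ ≤ dimH (univ : Set (ℝ × EuclideanSpace ℝ (Fin d))) := dimH_mono (subset_univ _)
      _ = (d + 1 : ℕ) := by rw [Real.dimH_univ_eq_finrank]; simp [add_comm]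
  have := isAddHaarMeasure_hausdorffMeasure (E := E)
  refine measure_zero_of_dimH_lt (d := (finrank ℝ E : NNReal)) ?_ (hdim.trans_lt ?_)
  · exact_mod_cast Measure.absolutelyContinuous_isAddHaarMeasure μ μH[(finrank ℝ E : ℝ)]
  · exact_mod_cast hd

lemma IsSubmanifold.measure_Ioi_smul_eq_zero (hsub : IsSubmanifold d M) (hM : M ⊆ sphere 0 1)
    (hd : d + 1 < finrank ℝ E) (μ : Measure E) [μ.IsAddHaarMeasure] :
    μ (Ioi (0 : ℝ) • M) = 0 := by
  refine measure_null_of_locally_null _ ?_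
  rintro _ ⟨r, hr, x, hx, rfl⟩
  obtain ⟨U, c, h, u, hu, rfl⟩ := hsub x hx
  obtain ⟨ε, hε, hball⟩ := Metric.isOpen_iff.1 h.isOpen u hu
  have hnhds : c '' ball u ε ∈ 𝓝[M] (c u) := by
    rw [← h.map_nhds hu]
    exact image_mem_map (ball_mem_nhds u hε)
  refine ⟨_, tendsto_inv_norm_smul hM hr hx hnhds, measure_mono_null ?_
    (h.measure_radialExtension_image_eq_zero hd (convex_ball u ε) hball μ)⟩
  rintro z ⟨u', hu', hz : c u' = ‖z‖⁻¹ • z⟩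
  refine ⟨(‖z‖, u'), ⟨mem_univ _, hu'⟩, ?_⟩
  rw [radialExtension, hz]
  rcases eq_or_ne z 0 with rfl | hz0
  · simp
  · exact smul_inv_smul₀ (norm_ne_zero_iff.2 hz0) z

end Cone

section Hopf

variable {d : ℕ}

lemma IsSubmanifold.neg {E : Type} [NormedAddCommGroup E] [InnerProductSpace ℝ E]
    {M : Set E} (hsub : IsSubmanifold d M) : IsSubmanifold d (-M) := by
  intro x hx
  obtain ⟨U, c, h, u, hu, hux⟩ := hsub _ hx
  obtain ⟨W, s, hW, hcW, hs, hsc, hcs⟩ := h.exists_inverse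
  refine ⟨U, fun u ↦ -c u, .of_inverse (W := -W) (s := fun x ↦ s (-x)) h.isOpen
    h.contDiffOn.neg ?_ hW.neg ?_ ?_ ?_ ?_, u, hu, by simp [hux]⟩
  · intro u hu
    rw [fderiv_fun_neg]
    exact neg_injective.comp (h.immersion u hu)
  · exact fun u hu ↦ by simpa using ⟨h.mem hu, hcW hu⟩
  · exact hs.comp continuous_neg.continuousOn fun x hx ↦ hx
  · exact fun u hu ↦ by simpa using hsc hu
  · exact fun x hx ↦ ⟨(hcs (-x) hx).1, by rw [(hcs (-x) hx).2, neg_neg]⟩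

lemma finrank_R5 : finrank ℝ R5 = 5 := by
  rw [(WithLp.linearEquiv 2 ℝ (ℍ[ℝ] × ℝ)).finrank_eq]
  simp [Quaternion.finrank_eq_four]

lemma finrank_R8 : finrank ℝ R8 = 8 := by
  rw [(WithLp.linearEquiv 2 ℝ (ℍ[ℝ] × ℍ[ℝ])).finrank_eq]
  simp [Quaternion.finrank_eq_four]

lemma isClosed_hopfPreimage {M : Set R5} (hM : IsClosed M) : IsClosed (hopfPreimage M) :=
  isClosed_sphere.inter (hM.preimage contDiff_hopf.continuous)

lemma sphereMeasure_preimage_eq_zero {V : Set R8} (hV : IsSubmanifold d V)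
    (hS : V ⊆ sphere 0 1) (hd : d < 7) (hclosed : IsClosed V) :
    sphereMeasure (Subtype.val ⁻¹' V) = 0 := by
  have hcone : (volume : Measure R8) (Ioo (0 : ℝ) 1 • V) = 0 :=
    measure_mono_null (Set.smul_subset_smul_right Ioo_subset_Ioi_self)
      (hV.measure_Ioi_smul_eq_zero hS (by rw [finrank_R8]; omega) volume)
  rw [sphereMeasure, Measure.toSphere_apply' _
    (hclosed.preimage continuous_subtype_val).measurableSet, Subtype.image_preimage_coe,
    inter_eq_right.2 hS, hcone, mul_zero]

variable {M : Set R5} (hM : M ⊆ sphere 0 1) (hsub : IsSubmanifold d M) (hclosed : IsClosed M)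
include hM hsub hclosed

lemma ae_neg_hopf_notMem_of_dim_lt (hd : d < 4) :
    ∀ᵐ q : sphere (0 : R8) 1 ∂sphereMeasure, -hopf (q : R8) ∉ M := by
  have hnegM : -M ⊆ sphere (0 : R5) 1 := fun y hy ↦ by simpa using hM hy
  have hnull := sphereMeasure_preimage_eq_zero (hsub.neg.hopfPreimage hnegM) (fun x hx ↦ hx.1)
    (by omega) (isClosed_hopfPreimage hclosed.neg)
  rw [ae_iff]
  refine measure_mono_null (fun q hq ↦ ?_) hnull
  exact ⟨q.2, not_not.1 hq⟩

lemma dim_lt_of_ne_sphere (hne : M.Nonempty) (h : M ≠ sphere 0 1) : d < 4 := by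
  have hd := hsub.dim_lt hM hne
  rw [finrank_R5] at hd
  refine lt_of_le_of_ne (by omega) fun hd4 ↦ h ?_
  subst hd4
  exact hsub.eq_sphere hM hne hclosed finrank_R5 four_ne_zero

theorem ae_neg_hopf_notMem (h : M ≠ sphere 0 1) :
    ∀ᵐ q : sphere (0 : R8) 1 ∂sphereMeasure, -hopf (q : R8) ∉ M := by
  rcases M.eq_empty_or_nonempty with rfl | hne
  · exact ae_of_all _ fun _ ↦ notMem_empty _
  · exact ae_neg_hopf_notMem_of_dim_lt hM hsub hclosed
      (dim_lt_of_ne_sphere hM hsub hclosed hne h)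

end Hopf

lemma dim_eq_four_of_isSubmanifold_sphere {d : ℕ}
    (hsub : IsSubmanifold d (sphere (0 : R5) 1)) : d = 4 := by
  have hne : (sphere (0 : R5) 1).Nonempty :=
    have : Nontrivial R5 := nontrivial_of_finrank_pos (R := ℝ) (by rw [finrank_R5]; norm_num)
    NormedSpace.sphere_nonempty.2 zero_le_one
  have hd := hsub.dim_lt subset_rfl hne
  rw [finrank_R5] at hd
  by_contra hd4
  have hae := ae_neg_hopf_notMem_of_dim_lt subset_rfl hsub isClosed_sphere (by omega)
  have : sphereMeasure ≠ 0 := by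
    rw [sphereMeasure, ne_eq, Measure.toSphere_eq_zero_iff_finrank, finrank_R8]
    norm_num
  have : NeZero sphereMeasure := ⟨this⟩
  obtain ⟨q, hq⟩ := hae.exists
  exact hq (by simpa using hopf_mem_sphere q.2)

/-! ## Critical points in the antipodal fibre -/

section UnitSphere

lemma eq_or_eq_neg_of_smul_mem_sphere {E : Type*} [NormedAddCommGroup E] [NormedSpace ℝ E]
    {r : ℝ} {x : E} (hx : x ∈ sphere (0 : E) 1) (h : r • x ∈ sphere (0 : E) 1) :
    r • x = x ∨ r • x = -x := by
  rw [mem_sphere_zero_iff_norm, norm_smul, mem_sphere_zero_iff_norm.1 hx, mul_one,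
    Real.norm_eq_abs, abs_eq zero_le_one] at h
  rcases h with rfl | rfl
  · exact .inl (one_smul ℝ x)
  · exact .inr (neg_one_smul ℝ x)

lemma encard_pair_neg {E : Type*} [NormedAddCommGroup E] [NormedSpace ℝ E] {x : E}
    (hx : x ∈ sphere (0 : E) 1) : ({x, -x} : Set E).encard = 2 :=
  encard_pair fun h ↦ ne_neg_of_mem_unit_sphere ℝ ⟨x, hx⟩ (Subtype.ext h)

variable {E : Type*} [NormedAddCommGroup E] [NormedSpace ℝ E] {K : Submodule ℝ E}

lemma encard_sphere_inter_of_finrank_eq_one (hK : finrank ℝ K = 1) :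
    (sphere (0 : E) 1 ∩ K).encard = 2 := by
  have : Nontrivial K := nontrivial_of_finrank_pos (R := ℝ) (by omega)
  obtain ⟨v, hv⟩ : (sphere (0 : K) 1).Nonempty := NormedSpace.sphere_nonempty.2 zero_le_one
  have hspan := (finrank_eq_one_iff_of_nonzero' v (ne_zero_of_mem_unit_sphere ⟨v, hv⟩)).1 hK
  have hv' : (v : E) ∈ sphere (0 : E) 1 := by simpa using hv
  rw [← encard_pair_neg hv']
  congr 1
  ext w
  constructor
  · rintro ⟨hw, hwK⟩
    obtain ⟨r, hr⟩ := hspan ⟨w, hwK⟩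
    obtain rfl : r • (v : E) = w := congrArg Subtype.val hr
    exact eq_or_eq_neg_of_smul_mem_sphere hv' hw
  · rintro (rfl | rfl)
    exacts [⟨hv', v.2⟩, ⟨by simpa using hv', K.neg_mem v.2⟩]

lemma preperfect_sphere_inter (hK : 1 < finrank ℝ K) :
    Preperfect (sphere (0 : E) 1 ∩ K) := by
  obtain ⟨m, hm⟩ := Nat.exists_eq_add_of_lt hK
  have hconn : IsConnected (sphere (0 : K) 1) :=
    isConnected_unit_sphere_of_finrank (d := m + 1) (by omega) m.succ_ne_zero
  have himage : Subtype.val '' sphere (0 : K) 1 = sphere (0 : E) 1 ∩ K := by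
    ext x
    simp [and_comm]
  rw [← himage]
  obtain ⟨v, hv⟩ := hconn.nonempty
  refine (hconn.isPreconnected.image _ continuous_subtype_val.continuousOn
    ).preperfect_of_nontrivial ?_
  refine Set.Nontrivial.image ⟨v, hv, -v, by simpa using hv, fun h ↦ ?_⟩ Subtype.val_injective
  exact ne_neg_of_mem_unit_sphere ℝ ⟨v, hv⟩ (Subtype.ext h)

end UnitSphere

section FibreSpace

/-- The eigenspace of Clifford multiplication by `y` for the eigenvalue `1`. Its unit sphere is
the fibre of the Hopf map over `y`. -/
def fibreSpace (y : R5) : Submodule ℝ R8 := (cliffordMul y - .id ℝ R8).ker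

variable {p x : R8} {y v : R5}

lemma mem_fibreSpace : x ∈ fibreSpace y ↔ cliffordMul y x = x := by
  rw [fibreSpace, LinearMap.mem_ker]
  exact sub_eq_zero

lemma injective_rightMul (hx : x ∈ sphere (0 : R8) 1) : Function.Injective (rightMul x) := by
  refine (injective_iff_map_eq_zero _).2 fun g hg ↦ ?_
  rwa [← norm_eq_zero, norm_rightMul, mem_sphere_zero_iff_norm.1 hx, one_mul,
    norm_eq_zero] at hg

lemma range_rightMul (hx : x ∈ sphere (0 : R8) 1) :
    (rightMul x).range = fibreSpace (hopf x) := by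
  have hnorm : ‖x‖ ^ 2 = 1 := by rw [mem_sphere_zero_iff_norm.1 hx, one_pow]
  ext z
  rw [mem_fibreSpace]
  constructor
  · rintro ⟨g, rfl⟩
    exact (cliffordMul_rightMul _ _ _).trans
      (by rw [cliffordMul_hopf_self, hnorm, one_smul]; rfl)
  · intro h
    refine ⟨hermitian x z, (rightMul_hermitian x z).trans ?_⟩
    rw [h, hnorm, one_smul, ← two_smul ℝ z, smul_smul]
    norm_num

lemma finrank_fibreSpace (hy : y ∈ sphere (0 : R5) 1) : finrank ℝ (fibreSpace y) = 4 := by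
  obtain ⟨x, hx, rfl⟩ := exists_mem_sphere_hopf_eq hy
  rw [← range_rightMul hx, LinearMap.finrank_range_of_inj (injective_rightMul hx),
    Quaternion.finrank_eq_four]

lemma cliffordMul_mem_fibreSpace_neg (hx : x ∈ fibreSpace y) (hv : inner ℝ y v = 0) :
    cliffordMul v x ∈ fibreSpace (-y) := by
  have hanti := cliffordMul_anticomm y v x
  rw [hv, mul_zero, zero_smul, mem_fibreSpace.1 hx] at hanti
  rw [mem_fibreSpace, map_neg, neg_apply]
  exact neg_eq_of_add_eq_zero_right hanti

/-- For a submanifold through `-hopf p` with tangent space `T` there, the critical points of the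
height function in the direction `p` over `-hopf p` form the unit sphere of this space. -/
def fibreCriticalSpace (p : R8) (T : Submodule ℝ R5) : Submodule ℝ R8 :=
  (T.map (cliffordMul.flip p).toLinearMap)ᗮ ⊓ fibreSpace (-hopf p)

lemma injective_cliffordMul_flip (hp : p ∈ sphere (0 : R8) 1) :
    Function.Injective (cliffordMul.flip p) := by
  refine (injective_iff_map_eq_zero _).2 fun v hv ↦ ?_
  rwa [← norm_eq_zero, ContinuousLinearMap.flip_apply, norm_cliffordMul,
    mem_sphere_zero_iff_norm.1 hp, mul_one, norm_eq_zero] at hv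

lemma finrank_fibreCriticalSpace (hp : p ∈ sphere (0 : R8) 1) {T : Submodule ℝ R5}
    (hT : ∀ v ∈ T, inner ℝ (hopf p) v = 0) :
    finrank ℝ T + finrank ℝ (fibreCriticalSpace p T) = 4 := by
  have hpy : p ∈ fibreSpace (hopf p) :=
    mem_fibreSpace.2 ((hopf_eq_iff hp (hopf_mem_sphere hp)).1 rfl)
  have hle : T.map (cliffordMul.flip p).toLinearMap ≤ fibreSpace (-hopf p) := by
    rintro _ ⟨v, hv, rfl⟩
    exact cliffordMul_mem_fibreSpace_neg hpy (hT v hv)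
  rw [← finrank_fibreSpace (y := -hopf p) (by simpa using hopf_mem_sphere hp),
    ← Submodule.finrank_add_inf_finrank_orthogonal hle,
    (Submodule.equivMapOfInjective _ (injective_cliffordMul_flip hp) T).finrank_eq]
  rfl

end FibreSpace

section NondegenerateHeight

variable {E : Type} [NormedAddCommGroup E] [InnerProductSpace ℝ E] {d : ℕ} {M : Set E} {p x : E}

lemma not_accPt_heightCriticalSet (hM : M ⊆ sphere 0 1) (hp : p ∈ sphere (0 : E) 1)
    (hsub : IsSubmanifold d M) (hn : IsNondegSphDist d M p) (hx : x ∈ heightCriticalSet d M p)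
    (hxp : x ≠ p) (hxp' : x ≠ -p) : ¬AccPt x (𝓟 (heightCriticalSet d M p)) := by
  obtain ⟨U, c, h, u, hu, rfl⟩ := hsub x hx.1
  have hnondeg := (isNondegSphDist_iff hM hp hsub).1 hn U c h u hu hxp hxp'
    ((h.isCriticalPt_iff hu _).1 hx.2)
  have hisolated := eventually_nhdsWithin_iff.1 (h.eventually_isCriticalPt_height_imp_eq hu hnondeg)
  rw [accPt_iff_frequently, not_frequently]
  filter_upwards [hisolated] with z hz hzc
  exact hzc.1 (hz hzc.2.1 hzc.2.2)

end NondegenerateHeight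

section AntipodalFibre

variable {d : ℕ} {M : Set R5} (hM : M ⊆ sphere 0 1) {p : R8} (hp : p ∈ sphere (0 : R8) 1)
include hM hp

section LocalParam

variable {U : Set (EuclideanSpace ℝ (Fin d))} {c : EuclideanSpace ℝ (Fin d) → R5}
  {u : EuclideanSpace ℝ (Fin d)} (h : IsLocalParam d M U c) (hu : u ∈ U) (hup : c u = -hopf p)
include h hu hup

lemma IsLocalParam.heightCriticalSet_inter_fibre :
    heightCriticalSet (d + 3) (hopfPreimage M) p ∩ hopf ⁻¹' {-hopf p} =
      sphere 0 1 ∩ fibreCriticalSpace p (fderiv ℝ c u).range := by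
  have hy : -hopf p ∈ M := hup ▸ h.mem hu
  have isCriticalPt_iff {x} (hx : x ∈ sphere (0 : R8) 1) (hxp : hopf x = -hopf p) :
      IsCriticalPt (d + 3) (hopfPreimage M) (height p) x ↔
        x ∈ ((fderiv ℝ c u).range.map (cliffordMul.flip p).toLinearMap)ᗮ := by
    rw [h.isCriticalPt_fibre_iff hM hp hx hu (hup.trans hxp.symm) hxp, Submodule.mem_orthogonal]
    constructor
    · rintro hcrit _ ⟨_, ⟨v, rfl⟩, rfl⟩
      exact (inner_cliffordMul_left _ _ _).trans (hcrit v)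
    · exact fun horth v ↦ (inner_cliffordMul_left _ _ _).symm.trans
        (horth _ ⟨_, ⟨v, rfl⟩, rfl⟩)
  ext x
  constructor
  · rintro ⟨⟨hx, hcrit⟩, hxp⟩
    exact ⟨hx.1, (isCriticalPt_iff hx.1 hxp).1 hcrit,
      mem_fibreSpace.2 ((hopf_eq_iff hx.1 (hM hy)).1 hxp)⟩
  · rintro ⟨hx, horth, hfibre⟩
    have hxp : hopf x = -hopf p := (hopf_eq_iff hx (hM hy)).2 (mem_fibreSpace.1 hfibre)
    exact ⟨⟨⟨hx, hxp ▸ hy⟩, (isCriticalPt_iff hx hxp).2 horth⟩, hxp⟩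

lemma IsLocalParam.dim_add_finrank_fibreCriticalSpace :
    d + finrank ℝ (fibreCriticalSpace p (fderiv ℝ c u).range) = 4 := by
  have htangent : ∀ v ∈ (fderiv ℝ c u).range, inner ℝ (hopf p) v = 0 := by
    rintro _ ⟨w, rfl⟩
    have horth := h.inner_fderiv hM hu w
    rwa [hup, inner_neg_left, neg_eq_zero] at horth
  have hsum := finrank_fibreCriticalSpace hp htangent
  rwa [h.finrank_range hu] at hsum

variable (hsub : IsSubmanifold d M) (hn : IsNondegSphDist (d + 3) (hopfPreimage M) p)
include hsub hn

lemma IsLocalParam.finrank_fibreCriticalSpace_le_one :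
    finrank ℝ (fibreCriticalSpace p (fderiv ℝ c u).range) ≤ 1 := by
  by_contra! hK
  have hperfect := preperfect_sphere_inter hK
  have hne := (hopf_ne_neg_self hp).symm
  have : Nontrivial (fibreCriticalSpace p (fderiv ℝ c u).range) :=
    nontrivial_of_finrank_pos (R := ℝ) (by omega)
  obtain ⟨⟨x, hxK⟩, hx⟩ : (sphere (0 : fibreCriticalSpace p (fderiv ℝ c u).range) 1).Nonempty :=
    NormedSpace.sphere_nonempty.2 zero_le_one
  have hmem : x ∈ sphere (0 : R8) 1 ∩ fibreCriticalSpace p (fderiv ℝ c u).range :=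
    ⟨by simpa using hx, hxK⟩
  have hacc := hperfect x hmem
  rw [← h.heightCriticalSet_inter_fibre hM hp hu hup] at hmem hacc
  have hxp : hopf x = -hopf p := hmem.2
  refine not_accPt_heightCriticalSet (fun x hx ↦ hx.1) hp (hsub.hopfPreimage hM) hn hmem.1 ?_ ?_
    (hacc.mono (principal_mono.2 inter_subset_left))
  · exact fun h ↦ hne (by rw [← hxp, h])
  · exact fun h ↦ hne (by rw [← hxp, h, hopf_neg])

end LocalParam

variable (hsub : IsSubmanifold d M) (hn : IsNondegSphDist (d + 3) (hopfPreimage M) p)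
include hsub hn

lemma encard_heightCriticalSet_inter_fibre (hd : d < 4) (hy : -hopf p ∈ M) :
    (heightCriticalSet (d + 3) (hopfPreimage M) p ∩ hopf ⁻¹' {-hopf p}).encard = 2 := by
  obtain ⟨U, c, h, u, hu, hup⟩ := hsub _ hy
  have hdim := h.dim_add_finrank_fibreCriticalSpace hM hp hu hup
  have hle := h.finrank_fibreCriticalSpace_le_one hM hp hu hup hsub hn
  rw [h.heightCriticalSet_inter_fibre hM hp hu hup]
  exact encard_sphere_inter_of_finrank_eq_one (by omega)

lemma encard_heightCriticalSet_hopfPreimage_of_nondeg (hd : d < 4) :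
    (heightCriticalSet (d + 3) (hopfPreimage M) p).encard =
      2 * (heightCriticalSet d M (hopf p)).encard := by
  by_cases hy : -hopf p ∈ M
  · have hcrit : -hopf p ∈ heightCriticalSet d M (hopf p) :=
      ⟨hy, isCriticalPt_height_of_eq_or_eq_neg hM (hopf_mem_sphere hp) hsub hy (.inr rfl)⟩
    rw [← encard_sdiff_add_encard_inter _ (hopf ⁻¹' {-hopf p}),
      encard_heightCriticalSet_hopfPreimage_sdiff hM hsub hp,
      encard_heightCriticalSet_inter_fibre hM hp hsub hn hd hy,
      ← encard_sdiff_singleton_add_one hcrit, mul_add, mul_one]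
  · exact encard_heightCriticalSet_hopfPreimage hM hsub hp hy

lemma IsNondegSphDist.of_hopfPreimage : IsNondegSphDist d M (hopf p) := by
  rw [isNondegSphDist_iff (fun x hx ↦ hx.1) hp (hsub.hopfPreimage hM)] at hn
  refine (isNondegSphDist_iff hM (hopf_mem_sphere hp) hsub).2 fun U c h u hu hup hup' hcrit ↦ ?_
  have hsec := hopf_hopfSection hp (hM (h.mem hu)) hup'
  have hmem := symm_mem_chartDomain hu hup'
  refine h.nondegAt_of_hopfChart hM hp hu hup' hcrit.fderiv
    (hn _ _ (h.hopfChart hM hp) _ hmem ?_ ?_ ?_)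
  · rw [hopfChart_symm]
    exact fun hp' ↦ hup (by rw [← hsec, hp'])
  · rw [hopfChart_symm]
    exact fun hp' ↦ hup (by rw [← hsec, hp', hopf_neg])
  · rwa [← (h.hopfChart hM hp).isCriticalPt_iff hmem, hopfChart_symm,
      h.isCriticalPt_hopfSection_self_iff hM hu hp hup', h.isCriticalPt_iff hu]

end AntipodalFibre

/-! ## Tautness -/

section Sphere

variable {E : Type} [NormedAddCommGroup E] [InnerProductSpace ℝ E] {d : ℕ}
  (hd : finrank ℝ E = d + 1) (hsub : IsSubmanifold d (sphere (0 : E) 1))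
include hd hsub

lemma heightCriticalSet_sphere {p : E} (hp : p ∈ sphere (0 : E) 1) :
    heightCriticalSet d (sphere 0 1) p = {p, -p} := by
  have : FiniteDimensional ℝ E := finite_of_finrank_eq_succ hd
  ext x
  constructor
  · rintro ⟨hx, hcrit⟩
    obtain ⟨U, c, h, u, hu, rfl⟩ := hsub x hx
    obtain ⟨r, rfl⟩ := h.exists_smul_eq subset_rfl hd hu ((h.isCriticalPt_height_iff hu p).1 hcrit)
    rcases eq_or_eq_neg_of_smul_mem_sphere hx hp with h | h
    · exact .inl h.symm
    · exact .inr (by rw [mem_singleton_iff, h, neg_neg])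
  · intro hx
    have hxS : x ∈ sphere (0 : E) 1 := by rcases hx with rfl | rfl <;> simpa using hp
    exact ⟨hxS, isCriticalPt_height_of_eq_or_eq_neg subset_rfl hp hsub hxS hx⟩

lemma isTaut_sphere (hd0 : d ≠ 0) : IsTaut d (sphere (0 : E) 1) where
  subset_sphere := subset_rfl
  isCompact :=
    have : FiniteDimensional ℝ E := finite_of_finrank_eq_succ hd
    isCompact_sphere 0 1
  isConnected := isConnected_unit_sphere_of_finrank hd hd0
  isSubmanifold := hsub
  perfect p hp _ := by
    have : FiniteDimensional ℝ E := finite_of_finrank_eq_succ hd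
    rw [bettiSum_sphere hd, sphDistCriticalSet_eq_heightCriticalSet subset_rfl hp hsub,
      heightCriticalSet_sphere hd hsub hp, encard_pair_neg hp]

end Sphere

lemma hopfPreimage_sphere : hopfPreimage (sphere 0 1) = sphere 0 1 :=
  Subset.antisymm (fun _ hx ↦ hx.1) fun _ hx ↦ ⟨hx, hopf_mem_sphere hx⟩

lemma isCompact_hopfPreimage {M : Set R5} (hM : IsClosed M) : IsCompact (hopfPreimage M) :=
  (isCompact_sphere 0 1).of_isClosed_subset (isClosed_hopfPreimage hM) fun _ hx ↦ hx.1

lemma exists_neg_hopf_notMem {M : Set R5} (hM : M ⊆ sphere 0 1) (h : M ≠ sphere 0 1) :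
    ∃ p ∈ sphere (0 : R8) 1, -hopf p ∉ M := by
  obtain ⟨y, hy, hyM⟩ := exists_of_ssubset (hM.ssubset_of_ne h)
  obtain ⟨p, hp, hpy⟩ := exists_mem_sphere_hopf_eq (y := -y) (by simpa using hy)
  exact ⟨p, hp, by rwa [hpy, neg_neg]⟩

lemma nonempty_homeomorph_hopfPreimage {M : Set R5} (hM : M ⊆ sphere 0 1) (h : M ≠ sphere 0 1) :
    Nonempty ((M × sphere (0 : ℍ[ℝ]) 1) ≃ₜ hopfPreimage M) :=
  let ⟨_, hp, hpM⟩ := exists_neg_hopf_notMem hM h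
  ⟨hopfTrivialization hM hp hpM⟩

lemma isConnected_hopfPreimage {M : Set R5} (hM : M ⊆ sphere 0 1) (h : M ≠ sphere 0 1)
    (hconn : IsConnected M) : IsConnected (hopfPreimage M) := by
  obtain ⟨e⟩ := nonempty_homeomorph_hopfPreimage hM h
  have : ConnectedSpace M := isConnected_iff_connectedSpace.1 hconn
  have : ConnectedSpace (sphere (0 : ℍ[ℝ]) 1) := isConnected_iff_connectedSpace.1
    (isConnected_unit_sphere_of_finrank Quaternion.finrank_eq_four three_ne_zero)
  exact isConnected_iff_connectedSpace.2 (e.surjective.connectedSpace e.continuous)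

lemma bettiSum_prod_unitQuaternions (X : Type) [TopologicalSpace X] :
    bettiSum (X × sphere (0 : ℍ[ℝ]) 1) = 2 * bettiSum X :=
  bettiSum_prod_sphere X (m := 3) Quaternion.finrank_eq_four

lemma bettiSum_hopfPreimage {M : Set R5} (hM : M ⊆ sphere 0 1) (h : M ≠ sphere 0 1) :
    bettiSum (hopfPreimage M) = 2 * bettiSum M := by
  obtain ⟨e⟩ := nonempty_homeomorph_hopfPreimage hM h
  rw [← bettiSum_congr e, bettiSum_prod_unitQuaternions]

lemma IsTaut.hopfPreimage_of_ne_sphere {d : ℕ} {M : Set R5} (h : IsTaut d M)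
    (hne : M ≠ sphere 0 1) : IsTaut (d + 3) (HopfTaut.hopfPreimage M) := by
  have hM := h.subset_sphere
  have hsub := h.isSubmanifold
  have hclosed := h.isCompact.isClosed
  have hd := dim_lt_of_ne_sphere hM hsub hclosed h.isConnected.nonempty hne
  refine ⟨fun x hx ↦ hx.1, isCompact_hopfPreimage hclosed, isConnected_hopfPreimage hM hne
    h.isConnected, hsub.hopfPreimage hM, fun p hp hn ↦ ?_⟩
  have hperfect := h.perfect _ (hopf_mem_sphere hp) (hn.of_hopfPreimage hM hp hsub)
  rw [sphDistCriticalSet_eq_heightCriticalSet hM (hopf_mem_sphere hp) hsub] at hperfect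
  rw [sphDistCriticalSet_eq_heightCriticalSet (fun x hx ↦ hx.1) hp (hsub.hopfPreimage hM),
    encard_heightCriticalSet_hopfPreimage_of_nondeg hM hp hsub hn hd, hperfect,
    bettiSum_hopfPreimage hM hne]

theorem IsTaut.hopfPreimage {d : ℕ} {M : Set R5} (h : IsTaut d M) :
    IsTaut (d + 3) (hopfPreimage M) := by
  by_cases hM : M = sphere 0 1
  · subst hM
    have hd := dim_eq_four_of_isSubmanifold_sphere h.isSubmanifold
    have hsub := h.isSubmanifold.hopfPreimage subset_rfl
    rw [hopfPreimage_sphere] at hsub ⊢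
    exact isTaut_sphere (by rw [finrank_R8, hd]) hsub (by omega)
  · exact h.hopfPreimage_of_ne_sphere hM

end HopfTaut

end

theorem theorem3p7p1_general (d : ℕ) (M : Set HopfTaut.R5) (hM : M ⊆ Metric.sphere 0 1)
    (hcompact : IsCompact M) (hsub : HopfTaut.IsSubmanifold d M) :
    (HopfTaut.IsTaut d M → HopfTaut.IsTaut (d + 3) (HopfTaut.hopfPreimage M)) ∧
    (∀ q ∈ Metric.sphere (0 : HopfTaut.R8) 1, -HopfTaut.hopf q ∉ M →
      (HopfTaut.heightCriticalSet (d + 3) (HopfTaut.hopfPreimage M) q).encard =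
        2 * (HopfTaut.heightCriticalSet d M (HopfTaut.hopf q)).encard) ∧
    (M ≠ Metric.sphere 0 1 →
      ∀ᵐ q : Metric.sphere (0 : HopfTaut.R8) 1 ∂HopfTaut.sphereMeasure,
        -HopfTaut.hopf (q : HopfTaut.R8) ∉ M) ∧
    HopfTaut.bettiSum (M × Metric.sphere (0 : Quaternion ℝ) 1) = 2 * HopfTaut.bettiSum M :=
  ⟨HopfTaut.IsTaut.hopfPreimage,
    fun _ hq hne ↦ HopfTaut.encard_heightCriticalSet_hopfPreimage hM hsub hq hne,
    HopfTaut.ae_neg_hopf_notMem hM hsub hcompact.isClosed,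
    HopfTaut.bettiSum_prod_unitQuaternions M⟩

theorem theorem3p7p1 (d : ℕ) (M : Set HopfTaut.R5) (hM : M ⊆ Metric.sphere 0 1)
    (hcompact : IsCompact M) (hconn : IsConnected M) (hsub : HopfTaut.IsSubmanifold d M) :
    -- if `M` is taut in `S⁴`, then `h⁻¹(M)` is taut in `S⁷`
    (HopfTaut.IsTaut d M → HopfTaut.IsTaut (d + 3) (HopfTaut.hopfPreimage M)) ∧
    -- the height function in the direction `q` on `h⁻¹(M)` has twice as many critical points as
    -- the height function in the direction `h q` on `M`, unless `-h q` lies on `M`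
    (∀ q ∈ Metric.sphere (0 : HopfTaut.R8) 1, -HopfTaut.hopf q ∉ M →
      (HopfTaut.heightCriticalSet (d + 3) (HopfTaut.hopfPreimage M) q).encard =
        2 * (HopfTaut.heightCriticalSet d M (HopfTaut.hopf q)).encard) ∧
    -- which holds for almost every `q` in `S⁷`
    (M ≠ Metric.sphere 0 1 →
      ∀ᵐ q : Metric.sphere (0 : HopfTaut.R8) 1 ∂HopfTaut.sphereMeasure,
        -HopfTaut.hopf (q : HopfTaut.R8) ∉ M) ∧
    -- the `ℤ/2`-Betti sum of `M × S³` is twice that of `M`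
    HopfTaut.bettiSum (M × Metric.sphere (0 : Quaternion ℝ) 1) = 2 * HopfTaut.bettiSum M :=
  theorem3p7p1_general d M hM hcompact hsub
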